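/- Let $F$ be a field of characteristic $2$, let $m\ge 4$ be even, and let $a_1,\dots,a_m\in F^\times$, $b_1,\dots,b_m\in F$. Let $(V,q)$ be a nonsingular quadratic space over $F$, isometric to $[a_1,b_1]\perp\dots\perp[a_m,b_m]$, where $[a,b]$ is the form $(x,y)\mapsto ax^2+xy+by^2$, and let $b_q$ be its polar form. \textbf{Conventions.} An algebra $A$, central simple over $F$ or Azumaya over a quadratic étale $F$-algebra, has a reduced trace $\mathrm{Trd}_A$ with values in its centre. For an algebra with involution, $\mathrm{Sym}(A,\sigma)=\{x\mid\sigma(x)=x\}$; a semi-trace is a linear map $f$ from $\mathrm{Sym}(A,\sigma)$ to the centre such that $f(x+\sigma(x))=\mathrm{Trd}_A(x)$ for all $x\in A$. \emph{Adjoint quadratic pair.} $\mathrm{Ad}_q=(\mathrm{End}_F(V),\sigma_q,f_q)$, where $\sigma_q$ is the involution adjoint to $b_q$ and $f_q$ is the semi-trace with $f_q(x\,b_q(x,\cdot))=q(x)$ for all $x\in V$. \emph{Clifford algebra.} For a central simple $F$-algebra with quadratic pair $(A,\sigma,f)$, choose $\ell\in A$ with $\ell+\sigma(\ell)=1$ and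 $f(s)=\mathrm{Trd}_A(\ell s)$ for all $s\in\mathrm{Sym}(A,\sigma)$. Then $\mathcal C(A,\sigma,f)$ is the quotient of the tensor algebra of the vector space $A$ by the ideal generated by the elements $s-f(s)$, for $s\in\mathrm{Sym}(A,\sigma)$, and $u-\mathrm{Sand}(u)(\ell)$, for those $u\in A\otimes A$ such that $\mathrm{Sand}(u)(\sigma(x))=\mathrm{Sand}(u)(x)$ for all $x\in A$; here $\mathrm{Sand}(a\otimes b)(x)=axb$. Let $c:A\to\mathcal C(A,\sigma,f)$ be the canonical map. The canonical involution $\underline\sigma$ is the one with $\underline\sigma(c(x))=c(\sigma(x))$ for $x\in A$. \emph{Canonical semi-trace.} For $\mathcal C=\mathcal C(\mathrm{Ad}_q)$, with centre $Z$, the canonical semi-trace is $\underline{f_q}:\mathrm{Sym}(\mathcal C,\underline{\sigma_q})\to Z$, $s\mapsto \mathrm{Trd}_{\mathcal C}(c(\lambda)s)$, for any $\lambda\in \mathrm{End}_F(V)$ of trace $1$; it does not depend on $\lambda$. \emph{Quaternion algebras.} $[a,b)$ is the quaternion algebra generated by $u,v$ with $u(1-u)=a$, $v^2=b$, $uv=v(1-u)$;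 its canonical involution $\bar{\ }$ is given by $\bar u=1-u$, $\bar v=-v$. For $1\le i\le m-1$ let $Q_i=[a_ib_i,a_ia_m)$. \emph{Tensor product.} Let $f_\otimes$ be the canonical semi-trace on $\bigl(Q_1\otimes\dots\otimes Q_{m-1},\bar{\ }\otimes\dots\otimes\bar{\ }\bigr)$, i.e. the unique semi-trace that vanishes on $\bigotimes_i\mathrm{Sym}(Q_i,\bar{\ })$. Let $K=F[X]/(X^2+X+a_1b_1+\dots+a_mb_m)$, the quadratic étale extension of $F$ attached to the discriminant (Arf invariant) of $q$. \textbf{Statement.} The semi-traces $\underline{f_q}$ and $f_\otimes$ exist and are unique, and there is an isomorphism of $F$-algebras with quadratic pair $$(\mathcal C(\mathrm{Ad}_q),\underline{\sigma_q},\underline{f_q})\simeq\bigl(Q_1\otimes\dots\otimes Q_{m-1},\bar{\ }\otimes\dots\otimes\bar{\ },f_\otimes\bigr)\otimes_F K,$$ that is, an isomorphism of $F$-algebras which, together with the isomorphism $Z\simeq K$ that it induces on the centres, carries $\underline{\sigma_q}$ to $(\bar{\ }\otimes\dots\otimes\bar{\ })\otimes\mathrm{id}_K$ and $\underline{f_q}$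 to $f_\otimes\otimes\mathrm{id}_K$. -/

import Mathlib

open scoped TensorProduct Quaternion

universe u

noncomputable section

namespace QuadPair

/-! ### Reduced traces -/

/-- `T` is the reduced trace of the algebra `A` over the commutative ring `Z` (in the applications
`Z` is a field, or the quadratic étale centre of a Clifford algebra): after every extension of
scalars from `Z` to an algebraically closed field `Ω`, the algebra `A` becomes a full matrix algebra
and `T` becomes the matrix trace. For `Z` a product of two copies of a field, this is the
componentwise reduced trace. -/
def IsReducedTrace (Z A : Type u) [CommRing Z] [Ring A] [Algebra Z A] (T : A →ₗ[Z] Z) : Prop :=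
  ∀ (Ω : Type u) [Field Ω] [IsAlgClosed Ω] [Algebra Z Ω],
    ∃ (n : ℕ) (e : (Ω ⊗[Z] A) ≃ₐ[Ω] Matrix (Fin n) (Fin n) Ω),
      ∀ a : A, algebraMap Z Ω (T a) = (e (1 ⊗ₜ[Z] a)).trace

/-! ### Algebras with involution -/

/-- An `F`-linear involution on an `F`-algebra `A`. -/
structure AlgInvolution (F A : Type*) [CommRing F] [Ring A] [Algebra F A] extends A →ₗ[F] A where
  map_mul_rev : ∀ x y : A, toFun (x * y) = toFun y * toFun x
  involutive : ∀ x : A, toFun (toFun x) = x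

namespace AlgInvolution

variable {F A : Type*} [CommRing F] [Ring A] [Algebra F A]

instance : CoeFun (AlgInvolution F A) (fun _ => A → A) := ⟨fun σ => σ.toLinearMap⟩

theorem map_mul' (σ : AlgInvolution F A) (x y : A) : σ (x * y) = σ y * σ x := σ.map_mul_rev x y

theorem apply_apply (σ : AlgInvolution F A) (x : A) : σ (σ x) = x := σ.involutive x

theorem map_one' (σ : AlgInvolution F A) : σ 1 = 1 := by
  have h := σ.map_mul' (σ 1) 1
  rw [mul_one, apply_apply, mul_one] at h
  exact h.symm

/-- The space `Sym(A, σ)` of symmetric elements. -/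
def sym (σ : AlgInvolution F A) : Submodule F A := LinearMap.eqLocus σ.toLinearMap LinearMap.id

theorem mem_sym {σ : AlgInvolution F A} {x : A} : x ∈ σ.sym ↔ σ x = x := Iff.rfl

theorem add_mem_sym (σ : AlgInvolution F A) (x : A) : x + σ x ∈ σ.sym := by
  rw [mem_sym, map_add, apply_apply, add_comm]

/-- The involution `id ⊗ σ` on `K ⊗ A`, for a commutative `F`-algebra `K`. -/
def baseChange (K : Type*) [CommRing K] [Algebra F K] (σ : AlgInvolution F A) :
    AlgInvolution F (K ⊗[F] A) where
  toLinearMap := TensorProduct.map LinearMap.id σ.toLinearMap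
  map_mul_rev x y := by
    change TensorProduct.map LinearMap.id σ.toLinearMap (x * y) =
      TensorProduct.map LinearMap.id σ.toLinearMap y *
        TensorProduct.map LinearMap.id σ.toLinearMap x
    induction x using TensorProduct.induction_on with
    | zero => simp
    | add x₁ x₂ h₁ h₂ => rw [add_mul, map_add, h₁, h₂, map_add, mul_add]
    | tmul k a =>
      induction y using TensorProduct.induction_on with
      | zero => simp
      | add y₁ y₂ h₁ h₂ => rw [mul_add, map_add, h₁, h₂, map_add, add_mul]
      | tmul l b => simp [σ.map_mul', mul_comm]
  involutive x := by
    change TensorProduct.map LinearMap.id σ.toLinearMap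
      (TensorProduct.map LinearMap.id σ.toLinearMap x) = x
    induction x using TensorProduct.induction_on with
    | zero => simp
    | add x₁ x₂ h₁ h₂ => rw [map_add, map_add, h₁, h₂]
    | tmul k a => simp [σ.apply_apply]

/-- The involution `⊗ᵢ σᵢ` on `⊗ᵢ Aᵢ`. -/
def piTensor {ι : Type*} {F : Type*} {A : ι → Type*} [CommRing F] [∀ i, Ring (A i)]
    [∀ i, Algebra F (A i)] (σ : ∀ i, AlgInvolution F (A i)) :
    AlgInvolution F (⨂[F] i, A i) where
  toLinearMap := PiTensorProduct.map (fun i => (σ i).toLinearMap)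
  map_mul_rev x y := by
    change PiTensorProduct.map (fun i => (σ i).toLinearMap) (x * y) =
      PiTensorProduct.map (fun i => (σ i).toLinearMap) y *
        PiTensorProduct.map (fun i => (σ i).toLinearMap) x
    induction x using PiTensorProduct.induction_on with
    | add x₁ x₂ h₁ h₂ => rw [add_mul, map_add, h₁, h₂, map_add, mul_add]
    | smul_tprod r a =>
      induction y using PiTensorProduct.induction_on with
      | add y₁ y₂ h₁ h₂ => rw [mul_add, map_add, h₁, h₂, map_add, add_mul]
      | smul_tprod s b =>
        rw [PiTensorProduct.smul_tprod_mul_smul_tprod, map_smul, map_smul, map_smul,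
          PiTensorProduct.map_tprod, PiTensorProduct.map_tprod, PiTensorProduct.map_tprod,
          PiTensorProduct.smul_tprod_mul_smul_tprod, mul_comm r s]
        congr 2
        funext i
        exact (σ i).map_mul' _ _
  involutive x := by
    change PiTensorProduct.map (fun i => (σ i).toLinearMap)
      (PiTensorProduct.map (fun i => (σ i).toLinearMap) x) = x
    induction x using PiTensorProduct.induction_on with
    | add x₁ x₂ h₁ h₂ => rw [map_add, map_add, h₁, h₂]
    | smul_tprod r a =>
      rw [map_smul, map_smul, PiTensorProduct.map_tprod, PiTensorProduct.map_tprod]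
      congr 2
      funext i
      exact (σ i).apply_apply _

end AlgInvolution

/-! ### Semi-traces and isomorphisms -/

section Semitrace

variable {F A : Type u} [Field F] [Ring A] [Algebra F A]

/-- A semi-trace on the `F`-algebra with involution `(A, σ)`: a linear form on `Sym(A, σ)` with
`f (x + σ x) = Trd x` for all `x`. -/
def IsSemitrace (σ : AlgInvolution F A) (f : σ.sym →ₗ[F] F) : Prop :=
  ∃ T : A →ₗ[F] F, IsReducedTrace F A T ∧ ∀ x : A, f ⟨x + σ x, σ.add_mem_sym x⟩ = T x

/-- The element `ℓ` determines the semi-trace `f`: `ℓ + σ ℓ = 1` and `f s = Trd (ℓ s)`. -/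
def Determines (σ : AlgInvolution F A) (f : σ.sym →ₗ[F] F) (l : A) : Prop :=
  l + σ l = 1 ∧
    ∃ T : A →ₗ[F] F, IsReducedTrace F A T ∧ ∀ s : σ.sym, f s = T (l * (s : A))

/-- The span in `⊗ᵢ Aᵢ` of the tensors `⊗ᵢ xᵢ` with all `xᵢ` symmetric, i.e. the
image of `⊗ᵢ Sym(Aᵢ, σᵢ)`. -/
def symTensors {ι : Type*} {B : ι → Type u} [∀ i, Ring (B i)] [∀ i, Algebra F (B i)]
    (σ : ∀ i, AlgInvolution F (B i)) : Submodule F (⨂[F] i, B i) :=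
  Submodule.span F {t | ∃ x : ∀ i, B i, (∀ i, x i ∈ (σ i).sym) ∧ t = PiTensorProduct.tprod F x}

/-- `f` is the canonical semi-trace `f_⊗` of a tensor product of algebras with symplectic
involution in characteristic two: the semi-trace vanishing on `⊗ᵢ Sym(Aᵢ, σᵢ)`. -/
def IsTensorSemitrace {ι : Type} {B : ι → Type u} [∀ i, Ring (B i)] [∀ i, Algebra F (B i)]
    (σ : ∀ i, AlgInvolution F (B i)) (f : (AlgInvolution.piTensor σ).sym →ₗ[F] F) : Prop :=
  IsSemitrace (AlgInvolution.piTensor σ) f ∧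
    ∀ s : (AlgInvolution.piTensor σ).sym, (s : ⨂[F] i, B i) ∈ symTensors σ → f s = 0

/-- The extension `id ⊗ f : Sym(K ⊗ A, id ⊗ σ) = K ⊗ Sym(A, σ) → K` of a linear form `f` on
`Sym(A, σ)`, obtained by restricting `id ⊗ g`, where `g : A → F` is any linear extension
of `f`. -/
def extendScalars (K : Type u) [CommRing K] [Algebra F K] (σ : AlgInvolution F A)
    (f : σ.sym →ₗ[F] F) : (σ.baseChange K).sym →ₗ[F] K :=
  (TensorProduct.rid F K).toLinearMap ∘ₗ
    TensorProduct.map LinearMap.id f.exists_extend.choose ∘ₗ (σ.baseChange K).sym.subtype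

theorem tmul_mem_sym (K : Type u) [CommRing K] [Algebra F K] (σ : AlgInvolution F A)
    (k : K) (s : σ.sym) : k ⊗ₜ[F] (s : A) ∈ (σ.baseChange K).sym := by
  change TensorProduct.map LinearMap.id σ.toLinearMap (k ⊗ₜ[F] (s : A)) = k ⊗ₜ[F] (s : A)
  rw [TensorProduct.map_tmul, LinearMap.id_apply]
  congr 1
  exact s.2

theorem extendScalars_tmul (K : Type u) [CommRing K] [Algebra F K] (σ : AlgInvolution F A)
    (f : σ.sym →ₗ[F] F) (k : K) (s : σ.sym) :
    extendScalars K σ f ⟨k ⊗ₜ[F] (s : A), tmul_mem_sym K σ k s⟩ = f s • k := by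
  have h : f.exists_extend.choose (s : A) = f s :=
    LinearMap.congr_fun f.exists_extend.choose_spec s
  simp [extendScalars, h]

/-- Isomorphism of the `F`-algebras with quadratic pair `(A, σ, f)` and `(B, τ, g)`, whose
semi-traces take their values in commutative rings `Z` and `K` over which `A` and `B` are
algebras: an isomorphism of `F`-algebras `A ≃ B`, compatible with an isomorphism `Z ≃ K`,
which respects the involutions and the semi-traces. -/
def QuadPairIso {B Z K : Type u} [Ring B] [Algebra F B] [CommRing Z] [Algebra F Z] [Algebra Z A]
    [CommRing K] [Algebra F K] [Algebra K B]
    (σ : AlgInvolution F A) (f : σ.sym →ₗ[F] Z) (τ : AlgInvolution F B) (g : τ.sym →ₗ[F] K) :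
    Prop :=
  ∃ (Φ : A ≃ₐ[F] B) (ψ : Z ≃ₐ[F] K),
    (∀ z : Z, Φ (algebraMap Z A z) = algebraMap K B (ψ z)) ∧
    (∀ x : A, Φ (σ x) = τ (Φ x)) ∧
    ∀ (s : σ.sym) (t : τ.sym), Φ (s : A) = (t : B) → ψ (f s) = g t

end Semitrace

/-! ### The Clifford algebra of an algebra with quadratic pair -/

section Clifford

variable {F A : Type u} [Field F] [Ring A] [Algebra F A]

/-- The sandwich map `Sand (a ⊗ b) x = a x b`. -/
def sand (F A : Type u) [Field F] [Ring A] [Algebra F A] : (A ⊗[F] A) →ₗ[F] A →ₗ[F] A :=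
  TensorProduct.lift (LinearMap.mk₂ F
    (fun a b => LinearMap.mulLeft F a ∘ₗ LinearMap.mulRight F b)
    (fun _ _ _ => by ext; simp [add_mul]) (fun _ _ _ => by ext; simp)
    (fun _ _ _ => by ext; simp [mul_add]) (fun _ _ _ => by ext; simp))

@[simp] theorem sand_tmul (a b x : A) : sand F A (a ⊗ₜ[F] b) x = a * (x * b) := rfl

/-- The inclusion of `A ⊗ A` in the tensor algebra of the vector space `A`. -/
def degTwo (F A : Type u) [Field F] [Ring A] [Algebra F A] :
    (A ⊗[F] A) →ₗ[F] TensorAlgebra F A :=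
  LinearMap.mul' F (TensorAlgebra F A) ∘ₗ
    TensorProduct.map (TensorAlgebra.ι F) (TensorAlgebra.ι F)

@[simp] theorem degTwo_tmul (a b : A) :
    degTwo F A (a ⊗ₜ[F] b) = TensorAlgebra.ι F a * TensorAlgebra.ι F b := rfl

/-- The relations of the Clifford algebra: `s = f(s)` for `s ∈ Sym(A, σ)`, and `u = Sand(u)(ℓ)` for
`u ∈ A ⊗ A` with `σ₂ u = u` and `ℓ` determining `f`. Here `σ₂` is defined by
`Sand(σ₂ u)(x) = Sand(u)(σ x)`, so that `σ₂ u = u` means `Sand(u)(x) = Sand(u)(σ x)` for all `x`. -/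
inductive CliffRel (σ : AlgInvolution F A) (f : σ.sym →ₗ[F] F) :
    TensorAlgebra F A → TensorAlgebra F A → Prop
  | sym (s : σ.sym) :
      CliffRel σ f (TensorAlgebra.ι F (s : A)) (algebraMap F (TensorAlgebra F A) (f s))
  | sandwich (t : A ⊗[F] A) (ht : ∀ x : A, sand F A t x = sand F A t (σ x))
      (l : A) (hl : Determines σ f l) :
      CliffRel σ f (degTwo F A t) (TensorAlgebra.ι F (sand F A t l))

/-- The Clifford algebra `C(A, σ, f)`. -/
def Cliff (σ : AlgInvolution F A) (f : σ.sym →ₗ[F] F) : Type u := RingQuot (CliffRel σ f)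

instance (σ : AlgInvolution F A) (f : σ.sym →ₗ[F] F) : Ring (Cliff σ f) :=
  inferInstanceAs (Ring (RingQuot (CliffRel σ f)))

instance (σ : AlgInvolution F A) (f : σ.sym →ₗ[F] F) : Algebra F (Cliff σ f) :=
  inferInstanceAs (Algebra F (RingQuot (CliffRel σ f)))

/-- The projection `T(A) → C(A, σ, f)`. -/
def cliffProj (σ : AlgInvolution F A) (f : σ.sym →ₗ[F] F) : TensorAlgebra F A →ₐ[F] Cliff σ f :=
  RingQuot.mkAlgHom F (CliffRel σ f)

theorem cliffProj_rel {σ : AlgInvolution F A} {f : σ.sym →ₗ[F] F} {x y : TensorAlgebra F A}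
    (h : CliffRel σ f x y) : cliffProj σ f x = cliffProj σ f y :=
  RingQuot.mkAlgHom_rel F h

/-- The canonical map `c : A → C(A, σ, f)`. -/
def cliffMap (σ : AlgInvolution F A) (f : σ.sym →ₗ[F] F) : A →ₗ[F] Cliff σ f :=
  (cliffProj σ f).toLinearMap ∘ₗ TensorAlgebra.ι F

theorem cliffMap_sym (σ : AlgInvolution F A) (f : σ.sym →ₗ[F] F) (s : σ.sym) :
    cliffMap σ f (s : A) = algebraMap F (Cliff σ f) (f s) := by
  have h := cliffProj_rel (CliffRel.sym (σ := σ) (f := f) s)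
  rw [AlgHom.commutes] at h
  exact h

/-- The map `A ⊗ A → A ⊗ A` sending `a ⊗ b` to `σ b ⊗ σ a`. -/
def revTensor (σ : AlgInvolution F A) : (A ⊗[F] A) →ₗ[F] (A ⊗[F] A) :=
  TensorProduct.map σ.toLinearMap σ.toLinearMap ∘ₗ (TensorProduct.comm F A A).toLinearMap

theorem sand_revTensor (σ : AlgInvolution F A) (t : A ⊗[F] A) (x : A) :
    sand F A (revTensor σ t) x = σ (sand F A t (σ x)) := by
  induction t using TensorProduct.induction_on with
  | zero => simp
  | add t₁ t₂ h₁ h₂ => simp only [map_add, LinearMap.add_apply, h₁, h₂]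
  | tmul a b => simp [revTensor, σ.map_mul', σ.apply_apply, mul_assoc]

/-- The homomorphism `T(A) → C(A, σ, f)ᵒᵖ` extending `c ∘ σ`. -/
def cliffRev (σ : AlgInvolution F A) (f : σ.sym →ₗ[F] F) :
    TensorAlgebra F A →ₐ[F] (Cliff σ f)ᵐᵒᵖ :=
  TensorAlgebra.lift F
    ((MulOpposite.opLinearEquiv F).toLinearMap ∘ₗ cliffMap σ f ∘ₗ σ.toLinearMap)

theorem cliffRev_ι (σ : AlgInvolution F A) (f : σ.sym →ₗ[F] F) (a : A) :
    cliffRev σ f (TensorAlgebra.ι F a) = MulOpposite.op (cliffMap σ f (σ a)) := by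
  simp [cliffRev]

theorem cliffRev_degTwo (σ : AlgInvolution F A) (f : σ.sym →ₗ[F] F) (t : A ⊗[F] A) :
    cliffRev σ f (degTwo F A t) =
      MulOpposite.op (cliffProj σ f (degTwo F A (revTensor σ t))) := by
  induction t using TensorProduct.induction_on with
  | zero => simp
  | add t₁ t₂ h₁ h₂ => simp only [map_add, h₁, h₂, MulOpposite.op_add]
  | tmul a b =>
    rw [degTwo_tmul, map_mul, cliffRev_ι, cliffRev_ι, ← MulOpposite.op_mul]
    simp [revTensor, cliffMap]

theorem cliffRev_rel (σ : AlgInvolution F A) (f : σ.sym →ₗ[F] F) ⦃x y : TensorAlgebra F A⦄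
    (h : CliffRel σ f x y) : cliffRev σ f x = cliffRev σ f y := by
  cases h with
  | sym s =>
    rw [cliffRev_ι, AlgHom.commutes, AlgInvolution.mem_sym.1 s.2, cliffMap_sym]
    rfl
  | sandwich t ht l hl =>
    have ht' : ∀ x : A, sand F A (revTensor σ t) x = sand F A (revTensor σ t) (σ x) := by
      intro x
      rw [sand_revTensor, sand_revTensor, ← ht (σ x)]
    have h := cliffProj_rel (CliffRel.sandwich (revTensor σ t) ht' l hl)
    rw [cliffRev_degTwo, cliffRev_ι, h, sand_revTensor, ← ht l]
    rfl

/-- The homomorphism `C(A, σ, f) → C(A, σ, f)ᵒᵖ` induced by `σ`. -/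
def cliffRevHom (σ : AlgInvolution F A) (f : σ.sym →ₗ[F] F) : Cliff σ f →ₐ[F] (Cliff σ f)ᵐᵒᵖ :=
  RingQuot.liftAlgHom F ⟨cliffRev σ f, cliffRev_rel σ f⟩

theorem cliffRevHom_cliffMap (σ : AlgInvolution F A) (f : σ.sym →ₗ[F] F) (a : A) :
    cliffRevHom σ f (cliffMap σ f a) = MulOpposite.op (cliffMap σ f (σ a)) := by
  rw [← cliffRev_ι]
  exact RingQuot.liftAlgHom_mkAlgHom_apply F _ _ _

theorem cliff_induction {σ : AlgInvolution F A} {f : σ.sym →ₗ[F] F} {P : Cliff σ f → Prop}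
    (hr : ∀ r, P (algebraMap F _ r)) (hc : ∀ a, P (cliffMap σ f a))
    (hm : ∀ x y, P x → P y → P (x * y)) (ha : ∀ x y, P x → P y → P (x + y)) (x : Cliff σ f) :
    P x := by
  obtain ⟨t, rfl⟩ : ∃ t, cliffProj σ f t = x := RingQuot.mkAlgHom_surjective F (CliffRel σ f) x
  induction t using TensorAlgebra.induction with
  | algebraMap r => rw [AlgHom.commutes]; exact hr r
  | ι a => exact hc a
  | mul x y hx hy => rw [map_mul]; exact hm _ _ hx hy
  | add x y hx hy => rw [map_add]; exact ha _ _ hx hy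

/-- The canonical involution of `C(A, σ, f)`, with
`c(a₁) ⋯ c(aᵣ) ↦ c(σ aᵣ) ⋯ c(σ a₁)`. -/
def cliffInvolution (σ : AlgInvolution F A) (f : σ.sym →ₗ[F] F) :
    AlgInvolution F (Cliff σ f) where
  toLinearMap := (MulOpposite.opLinearEquiv F).symm.toLinearMap ∘ₗ (cliffRevHom σ f).toLinearMap
  map_mul_rev x y := by simp
  involutive x := by
    change MulOpposite.unop (cliffRevHom σ f (MulOpposite.unop (cliffRevHom σ f x))) = x
    induction x using cliff_induction with
    | hr r => simp
    | hc a =>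
      rw [cliffRevHom_cliffMap, MulOpposite.unop_op, cliffRevHom_cliffMap, MulOpposite.unop_op,
        σ.apply_apply]
    | hm x y hx hy => simp only [map_mul, MulOpposite.unop_mul, hx, hy]
    | ha x y hx hy => simp only [map_add, MulOpposite.unop_add, hx, hy]

theorem cliffInvolution_cliffMap (σ : AlgInvolution F A) (f : σ.sym →ₗ[F] F) (a : A) :
    cliffInvolution σ f (cliffMap σ f a) = cliffMap σ f (σ a) :=
  congrArg MulOpposite.unop (cliffRevHom_cliffMap σ f a)

/-- The centre of `C(A, σ, f)`. -/
abbrev cliffCentre (σ : AlgInvolution F A) (f : σ.sym →ₗ[F] F) : Subalgebra F (Cliff σ f) :=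
  Subalgebra.center F (Cliff σ f)

/-- `C(A, σ, f)` as an algebra over its centre. -/
instance (σ : AlgInvolution F A) (f : σ.sym →ₗ[F] F) : Algebra (cliffCentre σ f) (Cliff σ f) where
  algebraMap := (cliffCentre σ f).val.toRingHom
  commutes' r x := (Subalgebra.mem_center_iff.1 r.2 x).symm
  smul_def' _ _ := rfl

/-- `g` is the canonical semi-trace of the Clifford algebra `C = C(A, σ, f)`: it takes its values
in the centre of `C`, and `g s = Trd_C (c(λ) s)` for every `λ ∈ A` with `Trd_A λ = 1`. -/
def IsCanonicalSemitrace (σ : AlgInvolution F A) (f : σ.sym →ₗ[F] F)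
    (g : (cliffInvolution σ f).sym →ₗ[F] cliffCentre σ f) : Prop :=
  ∃ T : A →ₗ[F] F, IsReducedTrace F A T ∧
    ∃ U : Cliff σ f →ₗ[cliffCentre σ f] cliffCentre σ f,
      IsReducedTrace (cliffCentre σ f) (Cliff σ f) U ∧
        ∀ l : A, T l = 1 → ∀ s : (cliffInvolution σ f).sym, g s = U (cliffMap σ f l * s)

end Clifford

/-! ### The adjoint quadratic pair of a quadratic form -/

section Adjoint

variable {F V : Type u} [Field F] [AddCommGroup V] [Module F V] [FiniteDimensional F V]

/-- The identification `φ_q : V ⊗ V ≃ End V`, `φ_q (x ⊗ y) z = b_q(y, z) x`. -/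
def phi (q : QuadraticForm F V) (hq : LinearMap.BilinForm.Nondegenerate q.polarBilin) :
    (V ⊗[F] V) ≃ₗ[F] Module.End F V :=
  TensorProduct.comm F V V ≪≫ₗ
    TensorProduct.congr (LinearMap.BilinForm.toDual q.polarBilin hq) (LinearEquiv.refl F V) ≪≫ₗ
      dualTensorHomEquiv F V V

theorem phi_tmul (q : QuadraticForm F V) (hq : LinearMap.BilinForm.Nondegenerate q.polarBilin)
    (x y z : V) : phi q hq (x ⊗ₜ y) z = QuadraticMap.polar q y z • x := by
  simp [phi, LinearMap.BilinForm.toDual_def]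

/-- The underlying linear map of the adjoint involution. -/
def adjLin (q : QuadraticForm F V) (hq : LinearMap.BilinForm.Nondegenerate q.polarBilin) :
    Module.End F V →ₗ[F] Module.End F V :=
  (LinearEquiv.conj (LinearMap.BilinForm.toDual q.polarBilin hq).symm).toLinearMap ∘ₗ
    Module.Dual.transpose

theorem polar_adjLin (q : QuadraticForm F V)
    (hq : LinearMap.BilinForm.Nondegenerate q.polarBilin) (g : Module.End F V) (x y : V) :
    QuadraticMap.polar q (adjLin q hq g x) y = QuadraticMap.polar q x (g y) := by
  have h : adjLin q hq g x = (LinearMap.BilinForm.toDual q.polarBilin hq).symm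
      (Module.Dual.transpose g (LinearMap.BilinForm.toDual q.polarBilin hq x)) := rfl
  rw [← QuadraticMap.polarBilin_apply_apply, h, LinearMap.BilinForm.apply_toDual_symm_apply,
    Module.Dual.transpose_apply, LinearMap.comp_apply, LinearMap.BilinForm.toDual_def,
    QuadraticMap.polarBilin_apply_apply]

theorem eq_of_polar (q : QuadraticForm F V)
    (hq : LinearMap.BilinForm.Nondegenerate q.polarBilin) {x y : V}
    (h : ∀ z, QuadraticMap.polar q x z = QuadraticMap.polar q y z) : x = y := by
  apply (LinearMap.BilinForm.toDual q.polarBilin hq).injective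
  ext z
  rw [LinearMap.BilinForm.toDual_def, LinearMap.BilinForm.toDual_def]
  exact h z

/-- The adjoint involution `σ_q` on `End V`: `b_q(σ_q(g) x, y) = b_q(x, g y)`. -/
def adjInvolution (q : QuadraticForm F V)
    (hq : LinearMap.BilinForm.Nondegenerate q.polarBilin) : AlgInvolution F (Module.End F V) where
  toLinearMap := adjLin q hq
  map_mul_rev g h := by
    change adjLin q hq (g * h) = adjLin q hq h * adjLin q hq g
    ext x
    apply eq_of_polar q hq
    intro y
    simp only [polar_adjLin, Module.End.mul_apply]
  involutive g := by
    change adjLin q hq (adjLin q hq g) = g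
    ext x
    apply eq_of_polar q hq
    intro y
    rw [polar_adjLin, QuadraticMap.polar_comm, polar_adjLin, QuadraticMap.polar_comm]

/-- A (not necessarily symmetric) bilinear form `β` with `β(x, x) = q(x)`. -/
theorem exists_bilin (q : QuadraticForm F V) :
    ∃ β : LinearMap.BilinForm F V, β.toQuadraticMap = q :=
  LinearMap.BilinMap.toQuadraticMap_surjective q

/-- The adjoint semi-trace `f_q` on `Sym(End V, σ_q)`: the linear form with
`f_q (φ_q (x ⊗ x)) = q x`. It is the restriction of `φ_q (x ⊗ y) ↦ β(x, y)` for any bilinear form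
`β` with `β(x, x) = q(x)`; on `Sym`, which corresponds to the symmetric tensors,
the choice of `β` does not matter. -/
def adjSemitrace (q : QuadraticForm F V)
    (hq : LinearMap.BilinForm.Nondegenerate q.polarBilin) : (adjInvolution q hq).sym →ₗ[F] F :=
  TensorProduct.lift (exists_bilin q).choose ∘ₗ (phi q hq).symm.toLinearMap ∘ₗ
    (adjInvolution q hq).sym.subtype

theorem adjInvolution_phi (q : QuadraticForm F V)
    (hq : LinearMap.BilinForm.Nondegenerate q.polarBilin) (x y : V) :
    adjInvolution q hq (phi q hq (x ⊗ₜ y)) = phi q hq (y ⊗ₜ x) := by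
  change adjLin q hq (phi q hq (x ⊗ₜ y)) = phi q hq (y ⊗ₜ x)
  ext z
  apply eq_of_polar q hq
  intro w
  rw [polar_adjLin, phi_tmul, phi_tmul, QuadraticMap.polar_smul_right,
    QuadraticMap.polar_smul_left, QuadraticMap.polar_comm q z x, smul_eq_mul, smul_eq_mul, mul_comm]

theorem adjSemitrace_phi (q : QuadraticForm F V)
    (hq : LinearMap.BilinForm.Nondegenerate q.polarBilin) (x : V) :
    adjSemitrace q hq ⟨phi q hq (x ⊗ₜ x), adjInvolution_phi q hq x x⟩ = q x := by
  have h : (exists_bilin q).choose.toQuadraticMap x = q x := by rw [(exists_bilin q).choose_spec]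
  simpa [adjSemitrace] using h

theorem adjSemitrace_phi_add (q : QuadraticForm F V)
    (hq : LinearMap.BilinForm.Nondegenerate q.polarBilin) (x y : V) :
    adjSemitrace q hq ⟨phi q hq (x ⊗ₜ y) + adjInvolution q hq (phi q hq (x ⊗ₜ y)),
      (adjInvolution q hq).add_mem_sym _⟩ = QuadraticMap.polar q x y := by
  have h : ∀ z, (exists_bilin q).choose z z = q z := fun z => by
    rw [← LinearMap.BilinMap.toQuadraticMap_apply, (exists_bilin q).choose_spec]
  have h2 := h (x + y)
  simp only [map_add, LinearMap.add_apply, h] at h2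
  simp only [adjSemitrace, LinearMap.comp_apply, Submodule.subtype_apply, adjInvolution_phi,
    LinearEquiv.coe_coe, map_add, LinearEquiv.symm_apply_apply, TensorProduct.lift.tmul,
    QuadraticMap.polar, ← h2]
  ring

end Adjoint

/-! ### Binary forms, quaternion algebras, the discriminant extension -/

section Forms

variable {F : Type u} [Field F]

/-- The binary quadratic form `[a, b] : (x, y) ↦ a x² + x y + b y²`. -/
def binaryForm (a b : F) : QuadraticForm F (F × F) :=
  a • (QuadraticMap.sq.comp (LinearMap.fst F F F)) +
    QuadraticMap.linMulLin (LinearMap.fst F F F) (LinearMap.snd F F F) +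
      b • (QuadraticMap.sq.comp (LinearMap.snd F F F))

theorem binaryForm_apply (a b : F) (p : F × F) :
    binaryForm a b p = a * p.1 ^ 2 + p.1 * p.2 + b * p.2 ^ 2 := by
  simp [binaryForm, QuadraticMap.sq, pow_two]

/-- The orthogonal sum `[a₁, b₁] ⟂ ⋯ ⟂ [a_m, b_m]`. -/
def orthSum {m : ℕ} (a b : Fin m → F) : QuadraticForm F (Fin m → F × F) :=
  QuadraticMap.pi fun i => binaryForm (a i) (b i)

theorem orthSum_apply {m : ℕ} (a b : Fin m → F) (x : Fin m → F × F) :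
    orthSum a b x =
      ∑ i, (a i * (x i).1 ^ 2 + (x i).1 * (x i).2 + b i * (x i).2 ^ 2) := by
  simp [orthSum, QuadraticMap.pi_apply, binaryForm_apply]

/-- The quaternion algebra `[a, b)`, with basis `1, u, v, uv` and
`u (1 - u) = a`, `v² = b`, `u v = v (1 - u)`. -/
abbrev Quat (a b : F) : Type u := ℍ[F, -a, 1, b]

/-- The defining relations of `[a, b)`. -/
theorem quat_rel (a b : F) (u v : Quat a b) (hu : u = ⟨0, 1, 0, 0⟩) (hv : v = ⟨0, 0, 1, 0⟩) :
    u * (1 - u) = algebraMap F _ a ∧ v * v = algebraMap F _ b ∧ u * v = v * (1 - u) ∧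
      u * v = ⟨0, 0, 0, 1⟩ := by
  subst hu hv
  refine ⟨?_, ?_, ?_, ?_⟩ <;> ext <;> simp [QuaternionAlgebra.algebraMap_eq]

/-- The canonical involution of `[a, b)`: `u ↦ 1 - u`, `v ↦ -v`. -/
def quatInvolution (a b : F) : AlgInvolution F (Quat a b) where
  toFun x := star x
  map_add' x y := star_add x y
  map_smul' r x := by ext <;> simp [mul_add]
  map_mul_rev x y := star_mul x y
  involutive x := star_star x

theorem quatInvolution_gens (a b : F) :
    quatInvolution a b ⟨0, 1, 0, 0⟩ = 1 - ⟨0, 1, 0, 0⟩ ∧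
      quatInvolution a b ⟨0, 0, 1, 0⟩ = -⟨0, 0, 1, 0⟩ := by
  constructor
  · change star (⟨0, 1, 0, 0⟩ : Quat a b) = _
    ext <;> simp
  · change star (⟨0, 0, 1, 0⟩ : Quat a b) = _
    ext <;> simp

/-- In characteristic two, the quadratic étale extension `F[X]/(X² + X + d)` attached to the
class of `d` in `F/℘(F)`, where `℘(F) = {x² + x}`. -/
abbrev EtaleExt (d : F) : Type u :=
  AdjoinRoot (Polynomial.X ^ 2 + Polynomial.X + Polynomial.C d : Polynomial F)

end Forms

end QuadPair

end

noncomputable section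

namespace QuadPair

/-! ### Uniqueness and transport of reduced traces -/

section ReducedTrace

/-! The Clifford algebra of `Ad_q` is the even Clifford algebra of `q`. Under `φ_q : V ⊗ V ≃ End V`
the element `c(φ_q(x ⊗ y))` is the product `xy`, and the defining relations amount to `xx = q(x)`
and `(xy)(yz) = q(y) xz` (`cliffPair_mul`, `evenHom_rel`). A homomorphism out of it is therefore the
same thing as a `CliffordAlgebra.EvenHom`.

Write `m = n + 1` and take a basis with `q(eᵢ) = aᵢ`, `q(fᵢ) = bᵢ`, `b_q(eᵢ, fᵢ) = 1`, all other
pairings being zero. For `i < m` the elements `uᵢ = eᵢfᵢ` and `vᵢ = eᵢe_m` satisfy the relations of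
`Qᵢ` and commute for distinct indices, while `z = ∑ eᵢfᵢ` commutes with all of them and `z² + z = ∑
aᵢbᵢ`. This gives a homomorphism from `K ⊗ Q₁ ⊗ ⋯ ⊗ Q_{m-1}` to the Clifford algebra. For the
inverse, `xy = a_m⁻¹ (x e_m)(e_m y)`, and both `x e_m` and `e_m y` can be written in terms of the
`uᵢ`, `vᵢ`, `z`. The resulting formula defines an even pairing in every algebra with such generators
(`Generators.evenHom`). The two maps are inverse on generators (`cliffEquiv`), so neither a
dimension count nor simplicity of the Clifford algebra is needed.

The canonical involution reverses `xy`; hence it sends `uᵢ` to `uᵢ + 1`, fixes `vᵢ`, and sends `z`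
to `z + m`, which is `z` because `m` is even (`cliffEquiv_involution`).

Both semi-traces turn out to be `s ↦ Trd(u₁ s)`. For the canonical one, `u₁ = c(λ)` with `λ` of
trace one, and the choice of `λ` is immaterial because `c(λ)` has the form `t + σ t` when `λ` has
trace zero (`map_cliffMap_eq_trace_smul`); this uses at least three hyperbolic planes. For the
tensor product, `σ u₁ = u₁ + 1` makes `Trd(u₁ s)` a semi-trace, and it vanishes on tensors of
symmetric quaternions because a second factor contributes a zero trace (`isTensorSemitrace_mul`).
Uniqueness rests on the uniqueness of reduced traces over a reduced centre and, for the tensor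
product, on the fact that symmetric elements are sums of elements `x + σ x` and of tensors of
symmetric quaternions. -/

theorem trace_matrixAlgEquiv {Ω : Type*} [Field Ω] {m n : ℕ}
    (e : Matrix (Fin m) (Fin m) Ω ≃ₐ[Ω] Matrix (Fin n) (Fin n) Ω) (x : Matrix (Fin m) (Fin m) Ω) :
    (e x).trace = x.trace := by
  -- Skolem–Noether: an isomorphism of matrix algebras is conjugation by a linear isomorphism, which
  -- preserves traces.
  obtain ⟨t, ht⟩ := AlgEquiv.eq_linearEquivConjAlgEquiv
    ((Matrix.toLinAlgEquiv'.symm.trans e).trans Matrix.toLinAlgEquiv')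
  have h := DFunLike.congr_fun ht (Matrix.toLinAlgEquiv' x)
  simp only [AlgEquiv.trans_apply, AlgEquiv.symm_apply_apply] at h
  have h1 : ∀ {k : ℕ} (y : Matrix (Fin k) (Fin k) Ω),
      LinearMap.trace Ω _ (Matrix.toLinAlgEquiv' y) = y.trace := fun y => by
    exact Matrix.trace_toLin'_eq y
  rw [← h1, h, ← h1 x]
  exact LinearMap.trace_conj' _ t

/-- A reduced trace over a reduced ring is unique. -/
theorem IsReducedTrace.unique {Z A : Type u} [CommRing Z] [IsReduced Z] [Ring A] [Algebra Z A]
    {T U : A →ₗ[Z] Z} (hT : IsReducedTrace Z A T) (hU : IsReducedTrace Z A U) : T = U := by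
  ext a
  -- In a reduced ring an element is zero as soon as it lies in every prime, so it suffices to
  -- compare the two traces over each residue field.
  rw [← sub_eq_zero, ← isNilpotent_iff_eq_zero, ← mem_nilradical, nilradical_eq_sInf,
    Ideal.mem_sInf]
  intro P (hP : P.IsPrime)
  let Ω := AlgebraicClosure (FractionRing (Z ⧸ P))
  let _ : Algebra Z Ω := ((algebraMap (FractionRing (Z ⧸ P)) Ω).comp
    ((algebraMap (Z ⧸ P) (FractionRing (Z ⧸ P))).comp (Ideal.Quotient.mk P))).toAlgebra
  obtain ⟨m, e, he⟩ := hT Ω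
  obtain ⟨n, e', he'⟩ := hU Ω
  have h := trace_matrixAlgEquiv (e.symm.trans e') (e (1 ⊗ₜ a))
  rw [AlgEquiv.trans_apply, AlgEquiv.symm_apply_apply, ← he, ← he', eq_comm, ← sub_eq_zero,
    ← map_sub] at h
  rw [← Ideal.Quotient.eq_zero_iff_mem]
  apply IsFractionRing.injective (Z ⧸ P) (FractionRing (Z ⧸ P))
  apply (algebraMap (FractionRing (Z ⧸ P)) Ω).injective
  rw [map_zero, map_zero]
  exact h

/-- Over the algebraic closure of each residue field of `Z` the form `T` becomes a matrix trace,
where the identity is known; reducedness of `Z` brings it back. -/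
theorem IsReducedTrace.mul_comm {Z A : Type u} [CommRing Z] [IsReduced Z] [Ring A] [Algebra Z A]
    {T : A →ₗ[Z] Z} (hT : IsReducedTrace Z A T) (x y : A) : T (x * y) = T (y * x) := by
  rw [← sub_eq_zero, ← isNilpotent_iff_eq_zero, ← mem_nilradical, nilradical_eq_sInf,
    Ideal.mem_sInf]
  intro P (hP : P.IsPrime)
  let Ω := AlgebraicClosure (FractionRing (Z ⧸ P))
  let _ : Algebra Z Ω := ((algebraMap (FractionRing (Z ⧸ P)) Ω).comp
    ((algebraMap (Z ⧸ P) (FractionRing (Z ⧸ P))).comp (Ideal.Quotient.mk P))).toAlgebra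
  obtain ⟨m, e, he⟩ := hT Ω
  have hm : ∀ x y : A, (1 : Ω) ⊗ₜ[Z] (x * y) = 1 ⊗ₜ x * 1 ⊗ₜ y := fun x y => by simp
  have h : algebraMap Z Ω (T (x * y) - T (y * x)) = 0 := by
    rw [map_sub, he, he, hm, hm, map_mul, map_mul, Matrix.trace_mul_comm, sub_self]
  rw [← Ideal.Quotient.eq_zero_iff_mem]
  apply IsFractionRing.injective (Z ⧸ P) (FractionRing (Z ⧸ P))
  apply (algebraMap (FractionRing (Z ⧸ P)) Ω).injective
  rw [map_zero, map_zero]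
  exact h

/-- The isomorphism `Ω ⊗[Z] A ≃ Ω ⊗[K] B` induced by compatible isomorphisms `Z ≃ K`, `A ≃ B`. -/
theorem exists_tensor_algEquiv {Z K A B Ω : Type*} [CommRing Z] [CommRing K] [Ring A] [Ring B]
    [CommRing Ω] [Algebra Z A] [Algebra K B] [Algebra Z Ω] [Algebra K Ω] (Φ : A ≃+* B)
    (ψ : Z ≃+* K) (h : ∀ z, Φ (algebraMap Z A z) = algebraMap K B (ψ z))
    (hΩ : ∀ z, algebraMap K Ω (ψ z) = algebraMap Z Ω z) :
    ∃ e : (Ω ⊗[Z] A) ≃ₐ[Ω] (Ω ⊗[K] B), ∀ a, e (1 ⊗ₜ a) = 1 ⊗ₜ Φ a := by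
  let f : A →ₐ[Z] (Ω ⊗[K] B) :=
    { (Algebra.TensorProduct.includeRight : B →ₐ[K] Ω ⊗[K] B).toRingHom.comp Φ.toRingHom with
      commutes' := fun z => by
        change (1 : Ω) ⊗ₜ[K] Φ (algebraMap Z A z) = (algebraMap Z Ω z) ⊗ₜ[K] (1 : B)
        rw [h, ← hΩ, Algebra.algebraMap_eq_smul_one, Algebra.algebraMap_eq_smul_one,
          TensorProduct.smul_tmul] }
  let g : B →ₐ[K] (Ω ⊗[Z] A) :=
    { (Algebra.TensorProduct.includeRight : A →ₐ[Z] Ω ⊗[Z] A).toRingHom.comp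
        Φ.symm.toRingHom with
      commutes' := fun k => by
        obtain ⟨z, rfl⟩ := ψ.surjective k
        change (1 : Ω) ⊗ₜ[Z] Φ.symm (algebraMap K B (ψ z)) = (algebraMap K Ω (ψ z)) ⊗ₜ[Z] (1 : A)
        rw [← h, RingEquiv.symm_apply_apply, hΩ, Algebra.algebraMap_eq_smul_one,
          Algebra.algebraMap_eq_smul_one, TensorProduct.smul_tmul] }
  have hf : ∀ a, f a = 1 ⊗ₜ Φ a := fun _ => rfl
  have hg : ∀ b, g b = 1 ⊗ₜ Φ.symm b := fun _ => rfl
  let F' := Algebra.TensorProduct.lift (Algebra.ofId Ω (Ω ⊗[K] B)) f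
    fun x y => Algebra.commutes _ _
  let G' := Algebra.TensorProduct.lift (Algebra.ofId Ω (Ω ⊗[Z] A)) g
    fun x y => Algebra.commutes _ _
  have hF : ∀ w a, F' (w ⊗ₜ a) = w ⊗ₜ Φ a := fun w a => by
    
    change algebraMap Ω (Ω ⊗[K] B) w * f a = _
    rw [hf, Algebra.TensorProduct.algebraMap_apply, Algebra.TensorProduct.tmul_mul_tmul, mul_one,
      one_mul]; rfl
  have hG : ∀ w b, G' (w ⊗ₜ b) = w ⊗ₜ Φ.symm b := fun w a => by
    
    change algebraMap Ω (Ω ⊗[Z] A) w * g a = _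
    rw [hg, Algebra.TensorProduct.algebraMap_apply, Algebra.TensorProduct.tmul_mul_tmul, mul_one,
      one_mul]; rfl
  refine ⟨AlgEquiv.ofAlgHom F' G' ?_ ?_, fun a => hF 1 a⟩
  · refine AlgHom.ext fun x => ?_
    induction x using TensorProduct.induction_on with
    | zero => simp
    | add x y hx hy => rw [map_add, hx, hy, map_add]
    | tmul w b => rw [AlgHom.comp_apply, hG, hF, RingEquiv.apply_symm_apply]; rfl
  · refine AlgHom.ext fun x => ?_
    induction x using TensorProduct.induction_on with
    | zero => simp
    | add x y hx hy => rw [map_add, hx, hy, map_add]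
    | tmul w b => rw [AlgHom.comp_apply, hF, hG, RingEquiv.symm_apply_apply]; rfl

theorem IsReducedTrace.of_ringEquiv {Z K A B : Type u} [CommRing Z] [CommRing K] [Ring A] [Ring B]
    [Algebra Z A] [Algebra K B] (Φ : A ≃+* B) (ψ : Z ≃+* K)
    (h : ∀ z, Φ (algebraMap Z A z) = algebraMap K B (ψ z))
    {T : B →ₗ[K] K} (hT : IsReducedTrace K B T) {U : A →ₗ[Z] Z} (hU : ∀ x, ψ (U x) = T (Φ x)) :
    IsReducedTrace Z A U := by
  intro Ω _ _ _
  -- An `Ω` over `Z` becomes one over `K` through `ψ⁻¹`, so that the splitting of `B` over `Ω` can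
  -- be pulled back.
  let _ : Algebra K Ω := ((algebraMap Z Ω).comp (ψ.symm : K →+* Z)).toAlgebra
  have hΩ : ∀ z, algebraMap K Ω (ψ z) = algebraMap Z Ω z := fun z =>
    congrArg (algebraMap Z Ω) (ψ.symm_apply_apply z)
  obtain ⟨n, e, he⟩ := hT Ω
  obtain ⟨e', he'⟩ := exists_tensor_algEquiv (Ω := Ω) Φ ψ h hΩ
  refine ⟨n, e'.trans e, fun a => ?_⟩
  rw [AlgEquiv.trans_apply, he', ← he, ← hU, hΩ]

/-- A splitting of `A` over `Ω` also splits `K ⊗ A`, because `Ω ⊗[K] (K ⊗[F] A)` is `Ω ⊗[F] A`. -/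
theorem IsReducedTrace.baseChange {F A : Type u} (K : Type u) [CommRing F] [CommRing K] [Ring A]
    [Algebra F A] [Algebra F K] {T : A →ₗ[F] F} (hT : IsReducedTrace F A T)
    {U : (K ⊗[F] A) →ₗ[K] K} (hU : ∀ a, U (1 ⊗ₜ a) = algebraMap F K (T a)) :
    IsReducedTrace K (K ⊗[F] A) U := by
  intro Ω _ _ _
  let _ : Algebra F Ω := ((algebraMap K Ω).comp (algebraMap F K)).toAlgebra
  have : IsScalarTower F K Ω := IsScalarTower.of_algebraMap_eq fun _ => rfl
  obtain ⟨n, e, he⟩ := hT Ω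
  let c : (Ω ⊗[F] A) ≃ₐ[Ω] (Ω ⊗[K] (K ⊗[F] A)) := AlgEquiv.ofLinearEquiv
    (TensorProduct.AlgebraTensorModule.cancelBaseChange F K Ω Ω A).symm
    (by simp [Algebra.TensorProduct.one_def]) <|
      LinearMap.map_mul_of_map_mul_tmul (fun _ _ _ _ ↦ by simp)
  let e' := c.symm.trans e
  have he' : ∀ w k a, e' (w ⊗ₜ[K] (k ⊗ₜ[F] a)) = (k • w) • e (1 ⊗ₜ a) := fun w k a => by
    have h : c.symm (w ⊗ₜ[K] (k ⊗ₜ[F] a)) = (k • w) ⊗ₜ a := rfl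
    rw [AlgEquiv.trans_apply, h, ← map_smul, TensorProduct.smul_tmul', smul_eq_mul, mul_one]
  refine ⟨n, e', fun x => ?_⟩
  induction x using TensorProduct.induction_on with
  | zero => simp
  | add x y hx hy => rw [map_add, map_add, hx, hy, TensorProduct.tmul_add, map_add,
      Matrix.trace_add]
  | tmul k a =>
    rw [he', Matrix.trace_smul, ← he, ← mul_one k, ← smul_eq_mul, ← TensorProduct.smul_tmul',
      map_smul, hU, smul_eq_mul, smul_eq_mul, map_mul, smul_eq_mul, mul_one, Algebra.smul_def,
      mul_one, ← IsScalarTower.algebraMap_apply]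

/-- A representation of `A` by matrices over an extension `Ω` that spans all matrices over `Ω` is
a splitting of `A`, if the dimensions agree. -/
theorem exists_splitting {F A Ω ι : Type*} [Field F] [Ring A] [Algebra F A] [FiniteDimensional F A]
    [Field Ω] [Algebra F Ω] [Fintype ι] [DecidableEq ι] (ρ : A →ₐ[F] Matrix ι ι Ω)
    (hdim : Module.finrank F A = Fintype.card ι * Fintype.card ι)
    (hspan : ∀ i j, Matrix.single i j 1 ∈ Submodule.span Ω (Set.range ρ)) :
    ∃ (n : ℕ) (e : (Ω ⊗[F] A) ≃ₐ[Ω] Matrix (Fin n) (Fin n) Ω),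
      ∀ a : A, (e (1 ⊗ₜ a)).trace = (ρ a).trace := by
  let R := Algebra.TensorProduct.lift (Algebra.ofId Ω (Matrix ι ι Ω)) ρ
    fun x y => Algebra.commutes _ _
  have hR : ∀ a, R (1 ⊗ₜ a) = ρ a := fun a => by
    change algebraMap Ω (Matrix ι ι Ω) 1 * ρ a = _
    rw [map_one, one_mul]
  have hsurj : Function.Surjective R.toLinearMap := by
    rw [← LinearMap.range_eq_top, eq_top_iff, ← (Matrix.stdBasis Ω ι ι).span_eq,
      Submodule.span_le]
    rintro _ ⟨⟨i, j⟩, rfl⟩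
    rw [Matrix.stdBasis_eq_single]
    refine (Submodule.span_le.2 ?_) (hspan i j)
    rintro _ ⟨a, rfl⟩
    exact ⟨1 ⊗ₜ a, hR a⟩
  -- A surjection between spaces of the same finite dimension is injective.
  have hinj : Function.Injective R.toLinearMap := by
    refine (LinearMap.injective_iff_surjective_of_finrank_eq_finrank ?_).2 hsurj
    rw [Module.finrank_baseChange, hdim, Module.finrank_matrix, Module.finrank_self, mul_one]
  refine ⟨Fintype.card ι, (AlgEquiv.ofBijective R ⟨hinj, hsurj⟩).trans
    (Matrix.reindexAlgEquiv Ω Ω (Fintype.equivFin ι)), fun a => ?_⟩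
  have h : AlgEquiv.ofBijective R ⟨hinj, hsurj⟩ (1 ⊗ₜ a) = ρ a := hR a
  rw [AlgEquiv.trans_apply, h, Matrix.coe_reindexAlgEquiv, Matrix.trace, Matrix.trace]
  exact Fintype.sum_equiv (Fintype.equivFin ι).symm _ _ fun i => rfl

theorem isReducedTrace_end (F V : Type u) [Field F] [AddCommGroup V] [Module F V]
    [FiniteDimensional F V] : IsReducedTrace F (Module.End F V) (LinearMap.trace F V) := by
  intro Ω _ _ _
  let b := Module.finBasis F V
  let ρ : Module.End F V →ₐ[F] Matrix _ _ Ω :=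
    ((Algebra.ofId F Ω).mapMatrix).comp (LinearMap.toMatrixAlgEquiv b).toAlgHom
  obtain ⟨n, e, he⟩ := exists_splitting ρ (by rw [Module.finrank_linearMap, Fintype.card_fin]) (by
    intro i j
    refine Submodule.subset_span ⟨(LinearMap.toMatrixAlgEquiv b).symm (Matrix.single i j 1), ?_⟩
    change (LinearMap.toMatrixAlgEquiv b ((LinearMap.toMatrixAlgEquiv b).symm _)).map
      (algebraMap F Ω) = _
    rw [AlgEquiv.apply_symm_apply, Matrix.map_single, map_one])
  refine ⟨n, e, fun x => ?_⟩
  rw [he, LinearMap.trace_eq_matrix_trace F b]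
  exact AddMonoidHom.map_trace (algebraMap F Ω : F →+ Ω) _

end ReducedTrace

/-! ### Invariants under a permutation of a basis -/

/-- In the expansion of `x` the terms at `k` and `π k` carry the same coefficient and cancel, while
terms at fixed points vanish by `h2`. This is the common engine for symmetric endomorphisms, for the
sandwich relation, and for symmetric elements of tensor products. -/
theorem map_eq_zero_of_repr_invariant {R M N κ : Type*} [CommRing R] [AddCommGroup M] [Module R M]
    [AddCommGroup N] [Module R N] [Fintype κ] (b : Module.Basis κ R M) (π : κ → κ)
    (hπ : Function.Involutive π) (D : M →ₗ[R] N) (h1 : ∀ k, D (b k) + D (b (π k)) = 0)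
    (h2 : ∀ k, π k = k → D (b k) = 0) {x : M} (hx : ∀ k, b.repr x (π k) = b.repr x k) :
    D x = 0 := by
  classical
  rw [← b.sum_repr x, map_sum]
  refine Finset.sum_involution (fun k _ => π k) (fun k _ => ?_) (fun k _ h h' => h ?_)
    (fun k _ => Finset.mem_univ _) fun k _ => hπ k
  · rw [map_smul, map_smul, hx, ← smul_add, h1, smul_zero]
  · rw [map_smul, h2 k h', smul_zero]

/-- Supplies the hypothesis of `map_eq_zero_of_repr_invariant` when an involution permutes the
basis. -/
theorem repr_invariant_of_fixed {R M κ : Type*} [CommRing R] [AddCommGroup M] [Module R M]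
    (b : Module.Basis κ R M) (π : κ → κ) (hπ : Function.Involutive π) (σ : M →ₗ[R] M)
    (hσ : ∀ k, σ (b k) = b (π k)) {x : M} (hx : σ x = x) (k : κ) :
    b.repr x (π k) = b.repr x k := by
  have h : b.coord (π k) ∘ₗ σ = b.coord k := b.ext fun j => by
    rw [LinearMap.comp_apply, hσ, Module.Basis.coord_apply, Module.Basis.coord_apply,
      Module.Basis.repr_self, Module.Basis.repr_self]
    classical
    simp only [Finsupp.single_apply, hπ.injective.eq_iff]
  have := LinearMap.congr_fun h x
  rwa [LinearMap.comp_apply, hx] at this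

/-! ### The quadratic pair on `End V` -/

section Adjoint

variable {F V : Type u} [Field F] [AddCommGroup V] [Module F V] [FiniteDimensional F V]
  (q : QuadraticForm F V) (hq : LinearMap.BilinForm.Nondegenerate q.polarBilin)

theorem trace_phi (x y : V) :
    LinearMap.trace F V (phi q hq (x ⊗ₜ y)) = QuadraticMap.polar q y x := by
  have h : phi q hq (x ⊗ₜ y) =
      dualTensorHom F V V (LinearMap.BilinForm.toDual q.polarBilin hq y ⊗ₜ x) := rfl
  rw [h, LinearMap.trace_eq_contract_apply, contractLeft_apply, LinearMap.BilinForm.toDual_def]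
  rfl

theorem mul_phi (g : Module.End F V) (x y : V) :
    g * phi q hq (x ⊗ₜ y) = phi q hq (g x ⊗ₜ y) := by
  ext z
  rw [Module.End.mul_apply, phi_tmul, phi_tmul, map_smul]

theorem phi_mul_phi (x y w z : V) :
    phi q hq (x ⊗ₜ y) * phi q hq (w ⊗ₜ z) = QuadraticMap.polar q y w • phi q hq (x ⊗ₜ z) := by
  rw [mul_phi, phi_tmul, ← TensorProduct.smul_tmul', map_smul]

/-- The scalar depends on the two middle vectors only. Since replacing `g` by `σ_q(g)` exchanges `y`
and `z` in it, `σ₂` is the exchange of the two middle vectors. -/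
theorem sand_phi (x y z w : V) (g : Module.End F V) :
    sand F (Module.End F V) (phi q hq (x ⊗ₜ y) ⊗ₜ phi q hq (z ⊗ₜ w)) g =
      QuadraticMap.polar q y (g z) • phi q hq (x ⊗ₜ w) := by
  rw [sand_tmul, mul_phi, phi_mul_phi]

theorem polar_adjInvolution (g : Module.End F V) (x y : V) :
    QuadraticMap.polar q x (adjInvolution q hq g y) = QuadraticMap.polar q y (g x) := by
  rw [QuadraticMap.polar_comm]
  exact polar_adjLin q hq g y x

/-- The basis `φ_q (bᵢ ⊗ bⱼ)` of `End V`. -/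
def phiBasis {ι : Type*} (b : Module.Basis ι F V) : Module.Basis (ι × ι) F (Module.End F V) :=
  (b.tensorProduct b).map (phi q hq)

theorem phiBasis_apply {ι : Type*} (b : Module.Basis ι F V) (i j : ι) :
    phiBasis q hq b (i, j) = phi q hq (b i ⊗ₜ b j) := by
  simp [phiBasis]

theorem span_phi : Submodule.span F {g | ∃ x y, g = phi q hq (x ⊗ₜ[F] y)} = ⊤ := by
  have h := congrArg (Submodule.map (phi q hq).toLinearMap) (TensorProduct.span_tmul_eq_top F V V)
  rw [Submodule.map_span, Submodule.map_top, LinearEquiv.range] at h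
  rw [← h]
  congr 1
  ext g
  constructor
  · rintro ⟨x, y, rfl⟩
    exact ⟨_, ⟨x, y, rfl⟩, rfl⟩
  · rintro ⟨_, ⟨x, y, rfl⟩, rfl⟩
    exact ⟨x, y, rfl⟩

/-- A linear map that vanishes on all `φ_q (x ⊗ x)` vanishes on `Sym(End V, σ_q)`. -/
theorem map_sym_eq_zero {N : Type*} [AddCommGroup N] [Module F N] (D : Module.End F V →ₗ[F] N)
    (hD : ∀ x, D (phi q hq (x ⊗ₜ x)) = 0) (s : (adjInvolution q hq).sym) : D s = 0 := by
  let b := Module.finBasis F V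
  refine map_eq_zero_of_repr_invariant (phiBasis q hq b) Prod.swap Prod.swap_swap D ?_ ?_
    (repr_invariant_of_fixed _ _ Prod.swap_swap (adjInvolution q hq).toLinearMap ?_ s.2)
  · rintro ⟨i, j⟩
    rw [Prod.swap_prod_mk, phiBasis_apply, phiBasis_apply]
    have h := hD (b i + b j)
    simp only [TensorProduct.tmul_add, TensorProduct.add_tmul, map_add, hD] at h
    simpa [add_comm] using h
  · rintro ⟨i, j⟩ h
    obtain rfl : j = i := congrArg Prod.fst h
    rw [phiBasis_apply, hD]
  · rintro ⟨i, j⟩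
    rw [Prod.swap_prod_mk, phiBasis_apply, phiBasis_apply]
    exact adjInvolution_phi q hq _ _

/-- The involution exchanging the two middle factors. -/
def swapMiddle {ι : Type*} (k : (ι × ι) × (ι × ι)) : (ι × ι) × (ι × ι) :=
  ((k.1.1, k.2.1), (k.1.2, k.2.2))

/-- A linear map that vanishes on all `φ_q (x ⊗ y) ⊗ φ_q (y ⊗ z)` vanishes on the elements fixed
under `σ₂`. -/
theorem map_sandwich_eq_zero {N : Type*} [AddCommGroup N] [Module F N]
    (D : (Module.End F V ⊗[F] Module.End F V) →ₗ[F] N)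
    (hD : ∀ x y z, D (phi q hq (x ⊗ₜ y) ⊗ₜ phi q hq (y ⊗ₜ z)) = 0)
    {t : Module.End F V ⊗[F] Module.End F V}
    (ht : ∀ g, sand F (Module.End F V) t g =
      sand F (Module.End F V) t (adjInvolution q hq g)) : D t = 0 := by
  classical
  let b := Module.finBasis F V
  -- Sandwiching `φ_q(d j ⊗ d k)` isolates the middle indices `j` and `k`, so the coordinates of `t`
  -- are read off from its values as a sandwich map. The adjoint involution exchanges `d j` and `d
  -- k`, hence invariance of `Sand(t)` becomes invariance of the coordinates under `swapMiddle`.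
  let d := LinearMap.BilinForm.dualBasis q.polarBilin hq b
  have hd : ∀ i j, QuadraticMap.polar q (b j) (d i) = if j = i then 1 else 0 := fun i j => by
    rw [QuadraticMap.polar_comm]
    exact LinearMap.BilinForm.apply_dualBasis_left hq b i j
  let bb := phiBasis q hq b
  have hc : ∀ i j k l, (bb.tensorProduct bb).repr t ((i, j), (k, l)) =
      bb.repr (sand F _ t (phi q hq (d j ⊗ₜ d k))) (i, l) := by
    intro i j k l
    have h : (bb.tensorProduct bb).coord ((i, j), (k, l)) =
        bb.coord (i, l) ∘ₗ LinearMap.applyₗ (phi q hq (d j ⊗ₜ d k)) ∘ₗ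
          sand F (Module.End F V) := by
      refine (bb.tensorProduct bb).ext ?_
      rintro ⟨⟨i', j'⟩, ⟨k', l'⟩⟩
      rw [Module.Basis.coord_apply, Module.Basis.repr_self, LinearMap.comp_apply,
        LinearMap.comp_apply, LinearMap.applyₗ_apply_apply, Module.Basis.tensorProduct_apply]
      simp only [bb, phiBasis_apply]
      rw [sand_phi, phi_tmul, QuadraticMap.polar_smul_right, hd, QuadraticMap.polar_comm, hd,
        ← phiBasis_apply, map_smul, Module.Basis.coord_apply, Module.Basis.repr_self]
      simp only [Finsupp.single_apply, Prod.mk.injEq, smul_eq_mul]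
      by_cases h1 : i' = i <;> by_cases h2 : j' = j <;> by_cases h3 : k' = k <;>
        by_cases h4 : l' = l <;> simp [h1, h2, h3, h4]
    exact LinearMap.congr_fun h t
  refine map_eq_zero_of_repr_invariant (bb.tensorProduct bb) swapMiddle (fun _ => rfl) D ?_ ?_ ?_
  · rintro ⟨⟨i, j⟩, ⟨k, l⟩⟩
    simp only [swapMiddle, Module.Basis.tensorProduct_apply, bb, phiBasis_apply]
    have h := hD (b i) (b j + b k) (b l)
    simp only [TensorProduct.tmul_add, TensorProduct.add_tmul, map_add, hD] at h
    simpa [add_comm] using h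
  · rintro ⟨⟨i, j⟩, ⟨k, l⟩⟩ h
    obtain rfl : k = j := congrArg (fun p => p.1.2) h
    rw [Module.Basis.tensorProduct_apply]
    simp only [bb, phiBasis_apply, hD]
  · rintro ⟨⟨i, j⟩, ⟨k, l⟩⟩
    simp only [swapMiddle]
    rw [hc, hc, ht, adjInvolution_phi]

/-- Evaluate `f_q(s) = Trd(ℓ s)` at `s = φ_q(y ⊗ y)`. This value is what the sandwich relation
produces from `φ_q(x ⊗ y) ⊗ φ_q(y ⊗ z)`. -/
theorem trace_determines {l : Module.End F V}
    (hl : Determines (adjInvolution q hq) (adjSemitrace q hq) l) (y : V) :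
    QuadraticMap.polar q y (l y) = q y := by
  obtain ⟨-, T, hT, h⟩ := hl
  obtain rfl := hT.unique (isReducedTrace_end F V)
  have h := h ⟨phi q hq (y ⊗ₜ y), adjInvolution_phi q hq y y⟩
  rw [adjSemitrace_phi, mul_phi, trace_phi] at h
  exact h.symm

/-- Take `ℓ` with `b_q(y, ℓ x) = β(x, y)`, where `β(x, x) = q(x)`; then `ℓ + σ_q(ℓ) = 1` says that
`β(x, y) + β(y, x) = b_q(x, y)`. Without such an `ℓ` the sandwich relations would be empty. -/
theorem exists_determines :
    ∃ l, Determines (adjInvolution q hq) (adjSemitrace q hq) l := by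
  let β := (exists_bilin q).choose
  have hβ : ∀ z, β z z = q z := fun z => by
    rw [← LinearMap.BilinMap.toQuadraticMap_apply, (exists_bilin q).choose_spec]
  let l : Module.End F V := (LinearMap.BilinForm.toDual q.polarBilin hq).symm.toLinearMap ∘ₗ β
  have hl : ∀ x y, QuadraticMap.polar q y (l x) = β x y := fun x y => by
    rw [QuadraticMap.polar_comm, ← QuadraticMap.polarBilin_apply_apply]
    exact LinearMap.BilinForm.apply_toDual_symm_apply (hB := hq) ..
  refine ⟨l, ?_, LinearMap.trace F V, isReducedTrace_end F V, fun s => ?_⟩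
  · ext x
    apply eq_of_polar q hq
    intro y
    rw [LinearMap.add_apply, QuadraticMap.polar_add_left, QuadraticMap.polar_comm, hl,
      QuadraticMap.polar_comm, polar_adjInvolution, hl, Module.End.one_apply]
    have h := hβ (x + y)
    simp only [map_add, LinearMap.add_apply, hβ] at h
    rw [QuadraticMap.polar, ← h]
    ring
  · have h : TensorProduct.lift β ∘ₗ (phi q hq).symm.toLinearMap =
        LinearMap.trace F V ∘ₗ LinearMap.mulLeft F l := by
      refine LinearMap.ext_on (span_phi q hq) ?_
      rintro _ ⟨x, y, rfl⟩
      rw [LinearMap.comp_apply, LinearMap.comp_apply, LinearMap.mulLeft_apply, mul_phi, trace_phi,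
        hl, LinearEquiv.coe_coe, LinearEquiv.symm_apply_apply, TensorProduct.lift.tmul]
    exact LinearMap.congr_fun h s

/-! ### The Clifford algebra of the adjoint quadratic pair -/

/-- The element `x · y` of the (even) Clifford algebra. -/
def cliffPair (x y : V) : Cliff (adjInvolution q hq) (adjSemitrace q hq) :=
  cliffMap _ _ (phi q hq (x ⊗ₜ y))

/-- This is the sandwich relation for `φ_q(x ⊗ y) ⊗ φ_q(y ⊗ z)`, which is fixed by `σ₂` because its
two middle vectors coincide. -/
theorem cliffPair_mul (x y z : V) :
    cliffPair q hq x y * cliffPair q hq y z = q y • cliffPair q hq x z := by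
  obtain ⟨l, hl⟩ := exists_determines q hq
  have h := cliffProj_rel (CliffRel.sandwich (σ := adjInvolution q hq) (f := adjSemitrace q hq)
    (phi q hq (x ⊗ₜ y) ⊗ₜ phi q hq (y ⊗ₜ z))
    (fun g => by rw [sand_phi, sand_phi, polar_adjInvolution]) l hl)
  rw [sand_phi, trace_determines q hq hl, degTwo_tmul, map_mul, map_smul, map_smul] at h
  exact h

/-- The pairing `(x, y) ↦ x · y` as an `EvenHom`. -/
def cliffEvenHom :
    CliffordAlgebra.EvenHom q (Cliff (adjInvolution q hq) (adjSemitrace q hq)) where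
  bilin := (TensorProduct.mk F V V).compr₂ (cliffMap _ _ ∘ₗ (phi q hq).toLinearMap)
  contract x := by
    have h := cliffMap_sym (adjInvolution q hq) (adjSemitrace q hq)
      ⟨phi q hq (x ⊗ₜ x), adjInvolution_phi q hq x x⟩
    rw [adjSemitrace_phi] at h
    exact h
  contract_mid x y z := cliffPair_mul q hq x y z

variable {B : Type*} [Ring B] [Algebra F B]

/-- Both families of relations are linear in `s` and `t`. By `map_sym_eq_zero` and
`map_sandwich_eq_zero` they need only be checked on `φ_q(x ⊗ x)` and `φ_q(x ⊗ y) ⊗ φ_q(y ⊗ z)`,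
where they are the two axioms of an `EvenHom`. -/
theorem evenHom_rel (G : CliffordAlgebra.EvenHom q B)
    ⦃x y : TensorAlgebra F (Module.End F V)⦄
    (h : CliffRel (adjInvolution q hq) (adjSemitrace q hq) x y) :
    TensorAlgebra.lift F (TensorProduct.lift G.bilin ∘ₗ (phi q hq).symm.toLinearMap) x =
      TensorAlgebra.lift F (TensorProduct.lift G.bilin ∘ₗ (phi q hq).symm.toLinearMap) y := by
  set g := TensorProduct.lift G.bilin ∘ₗ (phi q hq).symm.toLinearMap with hg
  have hgphi : ∀ x y, g (phi q hq (x ⊗ₜ y)) = G.bilin x y := fun x y => by simp [hg]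
  cases h with
  | sym s =>
    rw [TensorAlgebra.lift_ι_apply, AlgHom.commutes, ← sub_eq_zero]
    refine map_sym_eq_zero q hq (g - Algebra.linearMap F B ∘ₗ
      TensorProduct.lift (exists_bilin q).choose ∘ₗ (phi q hq).symm.toLinearMap) (fun x => ?_) s
    rw [LinearMap.sub_apply, hgphi, G.contract, sub_eq_zero]
    exact congrArg (algebraMap F B) (adjSemitrace_phi q hq x).symm
  | sandwich t ht l hl =>
    rw [TensorAlgebra.lift_ι_apply, ← sub_eq_zero]
    refine map_sandwich_eq_zero q hq ((TensorAlgebra.lift F g).toLinearMap ∘ₗ degTwo F _ -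
      g ∘ₗ LinearMap.applyₗ l ∘ₗ sand F _) (fun x y z => ?_) ht
    clear_value g
    rw [LinearMap.sub_apply, LinearMap.comp_apply, LinearMap.comp_apply, LinearMap.comp_apply,
      LinearMap.applyₗ_apply_apply, sand_phi, trace_determines q hq hl, map_smul, hgphi,
      degTwo_tmul, AlgHom.toLinearMap_apply, map_mul, TensorAlgebra.lift_ι_apply,
      TensorAlgebra.lift_ι_apply, hgphi, hgphi, G.contract_mid, sub_self]

/-- The universal property of the Clifford algebra. -/
def cliffLift (G : CliffordAlgebra.EvenHom q B) :
    Cliff (adjInvolution q hq) (adjSemitrace q hq) →ₐ[F] B :=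
  RingQuot.liftAlgHom F ⟨_, evenHom_rel q hq G⟩

theorem cliffLift_cliffPair (G : CliffordAlgebra.EvenHom q B) (x y : V) :
    cliffLift q hq G (cliffPair q hq x y) = G.bilin x y := by
  refine (RingQuot.liftAlgHom_mkAlgHom_apply F _ _ _).trans ?_
  rw [TensorAlgebra.lift_ι_apply]
  simp

/-- The Clifford algebra is generated by the products `x · y`. -/
theorem cliffMap_induction {P : Cliff (adjInvolution q hq) (adjSemitrace q hq) → Prop}
    (hr : ∀ r, P (algebraMap F _ r)) (hc : ∀ x y, P (cliffPair q hq x y))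
    (hm : ∀ x y, P x → P y → P (x * y)) (ha : ∀ x y, P x → P y → P (x + y))
    (x : Cliff (adjInvolution q hq) (adjSemitrace q hq)) : P x := by
  refine cliff_induction hr (fun g => ?_) hm ha x
  have hg : g ∈ Submodule.span F {g | ∃ x y, g = phi q hq (x ⊗ₜ[F] y)} := by
    rw [span_phi]; trivial
  induction hg using Submodule.span_induction with
  | mem g h => obtain ⟨x, y, rfl⟩ := h; exact hc x y
  | zero => rw [map_zero, ← map_zero (algebraMap F _)]; exact hr 0
  | add g g' _ _ h h' => rw [map_add]; exact ha _ _ h h'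
  | smul r g _ h => rw [map_smul, Algebra.smul_def]; exact hm _ _ (hr r) h

end Adjoint

/-! ### Computations in the Clifford algebra in characteristic two -/

theorem add_self_eq_zero_of_charTwo (F : Type*) {M : Type*} [Field F] [CharP F 2] [AddCommGroup M]
    [Module F M] (x : M) : x + x = 0 := by
  rw [← two_smul F, CharTwo.two_eq_zero, zero_smul]

theorem add_eq_zero_iff_of_charTwo (F : Type*) {M : Type*} [Field F] [CharP F 2] [AddCommGroup M]
    [Module F M] {x y : M} : x + y = 0 ↔ x = y := by
  rw [add_eq_zero_iff_eq_neg, neg_eq_of_add_eq_zero_right (add_self_eq_zero_of_charTwo F y)]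

theorem eq_add_iff_of_charTwo (F : Type*) {M : Type*} [Field F] [CharP F 2] [AddCommGroup M]
    [Module F M] {x y z : M} : x = y + z ↔ x + z = y := by
  rw [← add_eq_zero_iff_of_charTwo F, ← add_eq_zero_iff_of_charTwo F (x := x + z), add_assoc,
    add_comm y z]

section CliffPair

variable {F V : Type u} [Field F] [AddCommGroup V] [Module F V] [FiniteDimensional F V]
  (q : QuadraticForm F V) (hq : LinearMap.BilinForm.Nondegenerate q.polarBilin)

theorem cliffPair_add_left (x x' y : V) :
    cliffPair q hq (x + x') y = cliffPair q hq x y + cliffPair q hq x' y := by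
  rw [cliffPair, TensorProduct.add_tmul, map_add, map_add]; rfl

theorem cliffPair_add_right (x y y' : V) :
    cliffPair q hq x (y + y') = cliffPair q hq x y + cliffPair q hq x y' := by
  rw [cliffPair, TensorProduct.tmul_add, map_add, map_add]; rfl

theorem cliffPair_self (x : V) : cliffPair q hq x x = algebraMap F _ (q x) :=
  (cliffEvenHom q hq).contract x

theorem cliffPair_add_swap (x y : V) :
    cliffPair q hq x y + cliffPair q hq y x = algebraMap F _ (QuadraticMap.polar q x y) := by
  have h := cliffPair_self q hq (x + y)
  rw [cliffPair_add_left, cliffPair_add_right, cliffPair_add_right, cliffPair_self,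
    cliffPair_self] at h
  rw [QuadraticMap.polar, map_sub, map_sub, ← h]
  abel

/-- Polarisation of `(xy)(yz) = q(y) xz` in the middle vector; the relations between generators
below come from it. -/
theorem cliffPair_mul_add (x y w z : V) :
    cliffPair q hq x y * cliffPair q hq w z + cliffPair q hq x w * cliffPair q hq y z =
      QuadraticMap.polar q y w • cliffPair q hq x z := by
  have h := cliffPair_mul q hq x (y + w) z
  simp only [cliffPair_add_left, cliffPair_add_right, mul_add, add_mul, cliffPair_mul] at h
  rw [QuadraticMap.polar, sub_smul, sub_smul, ← h]
  abel

theorem cliffInvolution_cliffPair (x y : V) :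
    cliffInvolution (adjInvolution q hq) (adjSemitrace q hq) (cliffPair q hq x y) =
      cliffPair q hq y x := by
  rw [cliffPair, cliffInvolution_cliffMap, adjInvolution_phi]; rfl

variable [CharP F 2]

theorem cliffPair_comm {x y : V} (h : QuadraticMap.polar q x y = 0) :
    cliffPair q hq x y = cliffPair q hq y x := by
  have := cliffPair_add_swap q hq x y
  rwa [h, map_zero, add_eq_zero_iff_of_charTwo F] at this

theorem cliffPair_swap {x y : V} (h : QuadraticMap.polar q x y = 1) :
    cliffPair q hq y x = 1 + cliffPair q hq x y := by
  have := cliffPair_add_swap q hq y x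
  rw [QuadraticMap.polar_comm, h, map_one] at this
  rw [eq_add_iff_of_charTwo F, this]

theorem cliffPair_exchange {x y w z : V} (h : QuadraticMap.polar q y w = 0) :
    cliffPair q hq x y * cliffPair q hq w z = cliffPair q hq x w * cliffPair q hq y z := by
  have := cliffPair_mul_add q hq x y w z
  rwa [h, zero_smul, add_eq_zero_iff_of_charTwo F] at this

/-- In characteristic two orthogonal vectors commute, so `xyzw` is rearranged into `zwxy` by
exchanging neighbours. -/
theorem cliffPair_commute {x y z w : V} (h1 : QuadraticMap.polar q x z = 0)
    (h2 : QuadraticMap.polar q x w = 0) (h3 : QuadraticMap.polar q y z = 0)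
    (h4 : QuadraticMap.polar q y w = 0) :
    Commute (cliffPair q hq x y) (cliffPair q hq z w) := by
  rw [commute_iff_eq, cliffPair_exchange q hq h3, cliffPair_comm q hq h1, cliffPair_comm q hq h4,
    cliffPair_exchange q hq h2]

end CliffPair

/-! ### Adapted bases -/

/-- A basis `(eᵢ), (fᵢ)` in which `q` is the orthogonal sum of the `[aᵢ, bᵢ]`. -/
structure IsAdapted {F V ι : Type*} [Field F] [AddCommGroup V] [Module F V] [DecidableEq ι]
    (q : QuadraticForm F V) (a b : ι → F) (E : Module.Basis (ι ⊕ ι) F V) : Prop where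
  map_inl : ∀ i, q (E (.inl i)) = a i
  map_inr : ∀ i, q (E (.inr i)) = b i
  polar_inl_inr : ∀ i j, QuadraticMap.polar q (E (.inl i)) (E (.inr j)) = if i = j then 1 else 0
  polar_inl_inl : ∀ i j, QuadraticMap.polar q (E (.inl i)) (E (.inl j)) = 0
  polar_inr_inr : ∀ i j, QuadraticMap.polar q (E (.inr i)) (E (.inr j)) = 0

theorem IsAdapted.polar_inr_inl {F V ι : Type*} [Field F] [AddCommGroup V] [Module F V]
    [DecidableEq ι] {q : QuadraticForm F V} {a b : ι → F} {E : Module.Basis (ι ⊕ ι) F V}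
    (hE : IsAdapted q a b E) (i j : ι) :
    QuadraticMap.polar q (E (.inr i)) (E (.inl j)) = if i = j then 1 else 0 := by
  rw [QuadraticMap.polar_comm, hE.polar_inl_inr]
  simp only [eq_comm]

/-- The linear equivalence between `ι → F × F` and `ι ⊕ ι → F`. -/
def piProdEquiv (F ι : Type*) [Field F] : (ι → F × F) ≃ₗ[F] (ι ⊕ ι → F) where
  toFun x := Sum.elim (fun i => (x i).1) fun i => (x i).2
  invFun y i := (y (.inl i), y (.inr i))
  map_add' x y := by ext (i | i) <;> rfl
  map_smul' r x := by ext (i | i) <;> rfl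
  left_inv x := rfl
  right_inv y := by ext (i | i) <;> rfl

theorem exists_isAdapted {F V : Type u} [Field F] [CharP F 2] [AddCommGroup V] [Module F V]
    {m : ℕ} {a b : Fin m → F} {q : QuadraticForm F V}
    (h : QuadraticMap.Equivalent q (orthSum a b)) :
    ∃ E : Module.Basis (Fin m ⊕ Fin m) F V, IsAdapted q a b E := by
  obtain ⟨e⟩ := h
  let E := (Module.Basis.ofEquivFun (piProdEquiv F (Fin m))).map e.toLinearEquiv.symm
  have hq : ∀ y, q (e.toLinearEquiv.symm y) = orthSum a b y := fun y => by
    rw [← e.map_app]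
    exact congrArg _ (e.toLinearEquiv.apply_symm_apply y)
  -- The square terms polarise to `2 aᵢ` and `2 bᵢ` times products of coordinates and drop out in
  -- characteristic two.
  have hp : ∀ x y, QuadraticMap.polar q (e.toLinearEquiv.symm x) (e.toLinearEquiv.symm y) =
      ∑ i, ((x i).1 * (y i).2 + (x i).2 * (y i).1) := fun x y => by
    rw [QuadraticMap.polar, ← map_add, hq, hq, hq, orthSum_apply, orthSum_apply, orthSum_apply,
      ← Finset.sum_sub_distrib, ← Finset.sum_sub_distrib]
    refine Finset.sum_congr rfl fun i _ => ?_
    have h2 : (2 : F) = 0 := CharTwo.two_eq_zero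
    simp only [Pi.add_apply, Prod.fst_add, Prod.snd_add]
    linear_combination (a i * (x i).1 * (y i).1 + b i * (x i).2 * (y i).2) * h2
  have hl : ∀ i, E (.inl i) = e.toLinearEquiv.symm (Pi.single i (1, 0)) := fun i => by
    simp only [E, Module.Basis.map_apply, Module.Basis.coe_ofEquivFun]
    congr 1
    refine (LinearEquiv.symm_apply_eq _).2 (funext ?_)
    rintro (j | j)
    · change _ = ((Pi.single i (1, 0) : Fin m → F × F) j).1
      by_cases hj : j = i <;> simp [hj]
    · change _ = ((Pi.single i (1, 0) : Fin m → F × F) j).2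
      by_cases hj : j = i <;> simp [hj]
  have hr : ∀ i, E (.inr i) = e.toLinearEquiv.symm (Pi.single i (0, 1)) := fun i => by
    simp only [E, Module.Basis.map_apply, Module.Basis.coe_ofEquivFun]
    congr 1
    refine (LinearEquiv.symm_apply_eq _).2 (funext ?_)
    rintro (j | j)
    · change _ = ((Pi.single i (0, 1) : Fin m → F × F) j).1
      by_cases hj : j = i <;> simp [hj]
    · change _ = ((Pi.single i (0, 1) : Fin m → F × F) j).2
      by_cases hj : j = i <;> simp [hj]
  refine ⟨E, fun i => ?_, fun i => ?_, fun i j => ?_, fun i j => ?_, fun i j => ?_⟩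
  · rw [hl, hq, orthSum_apply, Finset.sum_eq_single i] <;> simp +contextual
  · rw [hr, hq, orthSum_apply, Finset.sum_eq_single i] <;> simp +contextual
  · rw [hl, hr, hp, Finset.sum_eq_single i] <;>
      simp +contextual [Pi.single_apply, apply_ite Prod.snd]
  · rw [hl, hl, hp]
    exact Finset.sum_eq_zero fun k _ => by simp [Pi.single_apply, apply_ite Prod.snd]
  · rw [hr, hr, hp]
    exact Finset.sum_eq_zero fun k _ => by simp [Pi.single_apply, apply_ite Prod.fst]

/-! ### Elements of trace zero -/

section Alternating

variable {F V : Type u} [Field F] [AddCommGroup V] [Module F V]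
  [FiniteDimensional F V] {q : QuadraticForm F V}
  (hq : LinearMap.BilinForm.Nondegenerate q.polarBilin)

theorem one_mem_alt {x y : V} (hxy : QuadraticMap.polar q x y = 1) :
    cliffPair q hq x y +
      cliffInvolution (adjInvolution q hq) (adjSemitrace q hq) (cliffPair q hq x y) = 1 := by
  rw [cliffInvolution_cliffPair, cliffPair_add_swap, hxy, map_one]

variable [CharP F 2]

/-- A pair `z, w` with `b_q(z, w) = 1`, orthogonal to `x` and `y`, gives `xy = xy (zw + wz)`, and
`xy · wz` is the image of `xy · zw` under the involution. -/
theorem cliffPair_mem_alt {x y z w : V} (hxy : QuadraticMap.polar q x y = 0)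
    (hzw : QuadraticMap.polar q z w = 1) (h1 : QuadraticMap.polar q x z = 0)
    (h2 : QuadraticMap.polar q x w = 0) (h3 : QuadraticMap.polar q y z = 0)
    (h4 : QuadraticMap.polar q y w = 0) :
    ∃ t, cliffPair q hq x y =
      t + cliffInvolution (adjInvolution q hq) (adjSemitrace q hq) t := by
  refine ⟨cliffPair q hq x y * cliffPair q hq z w, ?_⟩
  rw [AlgInvolution.map_mul', cliffInvolution_cliffPair, cliffInvolution_cliffPair,
    ← cliffPair_comm q hq hxy, ← (cliffPair_commute q hq h2 h1 h4 h3).eq, ← mul_add,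
    cliffPair_add_swap, hzw, map_one, mul_one]

theorem cliffPair_add_mem_alt {x y z w : V} (hxy : QuadraticMap.polar q x y = 1)
    (hzw : QuadraticMap.polar q z w = 1) (h1 : QuadraticMap.polar q x z = 0)
    (h2 : QuadraticMap.polar q x w = 0) (h3 : QuadraticMap.polar q y z = 0)
    (h4 : QuadraticMap.polar q y w = 0) :
    ∃ t, cliffPair q hq x y + cliffPair q hq z w =
      t + cliffInvolution (adjInvolution q hq) (adjSemitrace q hq) t := by
  -- With `p = xy` and `r = zw` the involution adds 1 to both, and `pr + (p + 1)(r + 1) = p + r +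
  -- 1`; the extra summand `p` contributes `p + (p + 1) = 1`, which removes the constant.
  refine ⟨cliffPair q hq x y * cliffPair q hq z w + cliffPair q hq x y, ?_⟩
  rw [map_add, AlgInvolution.map_mul', cliffInvolution_cliffPair, cliffInvolution_cliffPair,
    cliffPair_swap q hq hxy, cliffPair_swap q hq hzw, add_mul, mul_add, mul_add, one_mul, one_mul,
    mul_one, ← (cliffPair_commute q hq h1 h2 h3 h4).eq]
  have := add_self_eq_zero_of_charTwo F (cliffPair q hq x y * cliffPair q hq z w)
  have h' := add_self_eq_zero_of_charTwo F (cliffPair q hq x y)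
  have h'' := add_self_eq_zero_of_charTwo F
    (1 : Cliff (adjInvolution q hq) (adjSemitrace q hq))
  generalize cliffPair q hq x y * cliffPair q hq z w = s at *
  rw [← sub_eq_zero]
  calc _ = -(s + s) - (cliffPair q hq x y + cliffPair q hq x y) - (1 + 1) := by abel
    _ = 0 := by rw [this, h', h'']; simp

/-- A linear map that vanishes on the alternating elements `t + σ t` of the Clifford algebra takes
the same value on all `c(λ)` with `λ` of trace one. -/
theorem map_cliffMap_eq_trace_smul {ι : Type*} [Fintype ι] [DecidableEq ι]
    (hι : 3 ≤ Fintype.card ι) {a b : ι → F} {E : Module.Basis (ι ⊕ ι) F V} (hE : IsAdapted q a b E)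
    {N : Type*} [AddCommGroup N] [Module F N]
    (h : Cliff (adjInvolution q hq) (adjSemitrace q hq) →ₗ[F] N)
    (hh : ∀ t, h (t + cliffInvolution (adjInvolution q hq) (adjSemitrace q hq) t) = 0)
    (i₀ : ι) (l : Module.End F V) :
    h (cliffMap _ _ l) =
      LinearMap.trace F V l • h (cliffPair q hq (E (.inl i₀)) (E (.inr i₀))) := by
  set N₀ := h (cliffPair q hq (E (.inl i₀)) (E (.inr i₀))) with hN₀
  suffices h ∘ₗ cliffMap _ _ = (LinearMap.trace F V).smulRight N₀ from LinearMap.congr_fun this l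
  -- All `eᵢfᵢ` have the same image, since the sum of two of them is alternating.
  have hdiag : ∀ i, h (cliffPair q hq (E (.inl i)) (E (.inr i))) = N₀ := by
    intro i
    by_cases hi : i = i₀
    · rw [hi]
    · obtain ⟨t, ht⟩ := cliffPair_add_mem_alt hq (x := E (.inl i)) (y := E (.inr i))
        (z := E (.inl i₀)) (w := E (.inr i₀)) (by simp [hE.polar_inl_inr])
        (by simp [hE.polar_inl_inr]) (hE.polar_inl_inl _ _) (by simp [hE.polar_inl_inr, hi])
        (by simp [hE.polar_inr_inl, hi]) (hE.polar_inr_inr _ _)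
      rw [← add_eq_zero_iff_of_charTwo F, hN₀, ← map_add, ht, hh]
  have hone : h 1 = 0 := by
    rw [← one_mem_alt hq (x := E (.inl i₀)) (y := E (.inr i₀)) (by simp [hE.polar_inl_inr]), hh]
  have hzero : ∀ p r, QuadraticMap.polar q (E p) (E r) = 0 →
      h (cliffPair q hq (E p) (E r)) = 0 := by
    intro p r hpr
    let idx : ι ⊕ ι → ι := Sum.elim id id
    -- Two basis vectors meet at most two of the hyperbolic planes; a third plane provides the
    -- orthogonal pair required by `cliffPair_mem_alt`.
    obtain ⟨k, hk⟩ : ∃ k, k ∉ ({idx p, idx r} : Finset ι) := by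
      by_contra! hall
      have := Finset.card_le_card (s := Finset.univ) (t := {idx p, idx r}) fun k _ => hall k
      have h2 : Finset.card {idx p, idx r} ≤ 2 := Finset.card_le_two
      rw [Finset.card_univ] at this
      omega
    have hl : ∀ p, idx p ≠ k → QuadraticMap.polar q (E p) (E (.inl k)) = 0 := by
      rintro (i | i) hi
      · exact hE.polar_inl_inl _ _
      · exact (hE.polar_inr_inl _ _).trans (if_neg hi)
    have hr : ∀ p, idx p ≠ k → QuadraticMap.polar q (E p) (E (.inr k)) = 0 := by
      rintro (i | i) hi
      · exact (hE.polar_inl_inr _ _).trans (if_neg hi)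
      · exact hE.polar_inr_inr _ _
    simp only [Finset.mem_insert, Finset.mem_singleton, not_or] at hk
    obtain ⟨t, ht⟩ := cliffPair_mem_alt hq hpr (z := E (.inl k)) (w := E (.inr k))
      (by simp [hE.polar_inl_inr]) (hl p (Ne.symm hk.1)) (hr p (Ne.symm hk.1))
      (hl r (Ne.symm hk.2)) (hr r (Ne.symm hk.2))
    rw [ht, hh]
  refine (phiBasis q hq E).ext ?_
  rintro ⟨p, r⟩
  rw [phiBasis_apply, LinearMap.comp_apply, LinearMap.smulRight_apply, trace_phi]
  change h (cliffPair q hq (E p) (E r)) = _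
  rw [QuadraticMap.polar_comm]
  by_cases hpr : QuadraticMap.polar q (E p) (E r) = 0
  · rw [hzero p r hpr, hpr, zero_smul]
  · rcases p with i | i <;> rcases r with j | j
    · exact absurd (hE.polar_inl_inl i j) hpr
    · rw [hE.polar_inl_inr] at hpr ⊢
      obtain rfl : i = j := by by_contra hij; exact hpr (if_neg hij)
      rw [if_pos rfl, one_smul, hdiag]
    · rw [hE.polar_inr_inl] at hpr ⊢
      obtain rfl : i = j := by by_contra hij; exact hpr (if_neg hij)
      -- `fᵢeᵢ = 1 + eᵢfᵢ`, and 1 is itself alternating, so its image is zero.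
      rw [if_pos rfl, one_smul, cliffPair_swap q hq (by simp [hE.polar_inl_inr]), map_add, hone,
        zero_add, hdiag]
    · exact absurd (hE.polar_inr_inr i j) hpr

end Alternating

/-! ### Generators of the even Clifford algebra -/

theorem sum_mul_of_commute_ne {R ι : Type*} [Ring R] [Fintype ι] {x : ι → R} {y : R} {i : ι}
    (hi : x i * y = y * x i + y) (h : ∀ j, j ≠ i → Commute (x j) y) :
    (∑ j, x j) * y = y * (∑ j, x j) + y := by
  classical
  rw [Finset.sum_mul, Finset.mul_sum, ← Finset.add_sum_erase _ _ (Finset.mem_univ i),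
    ← Finset.add_sum_erase (a := i) _ _ (Finset.mem_univ i), hi,
    Finset.sum_congr rfl fun j hj => (h j (Finset.ne_of_mem_erase hj)).eq]
  abel

/-- For commuting elements `x ↦ x² + x` is additive in characteristic two. -/
theorem sum_mul_sum_of_commute {F C ι : Type*} [Field F] [CharP F 2] [Ring C] [Algebra F C]
    [Fintype ι] {x : ι → C} {c : ι → F} (hx : ∀ i, x i * x i = x i + algebraMap F C (c i))
    (h : ∀ i j, Commute (x i) (x j)) :
    (∑ i, x i) * ∑ i, x i = ∑ i, x i + algebraMap F C (∑ i, c i) := by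
  classical
  generalize (Finset.univ : Finset ι) = s
  induction s using Finset.induction_on with
  | empty => simp
  | insert i s hi ih =>
    rw [Finset.sum_insert hi, Finset.sum_insert hi, map_add, add_mul, mul_add, mul_add, ih,
      hx, (Commute.sum_right s _ _ fun j _ => h i j).eq]
    have := add_self_eq_zero_of_charTwo F ((∑ i ∈ s, x i) * x i)
    rw [← sub_eq_zero, ← this]
    abel

theorem mul_add_mul_eq_zero_of_commute (F : Type*) {C : Type*} [Field F] [CharP F 2] [Ring C]
    [Algebra F C] {x y : C} (h : Commute x y) : x * y + y * x = 0 := by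
  rw [h.eq, add_self_eq_zero_of_charTwo F]

/-- Elements `uᵢ`, `vᵢ` and `z` of an algebra that satisfy the relations of
`[a₁b₁, a₁a_m) ⊗ ⋯ ⊗ [a_{m-1}b_{m-1}, a_{m-1}a_m) ⊗ F[z]`, with `z² + z = ∑ aᵢbᵢ`. -/
@[ext]
structure Generators {F : Type*} [Field F] {n : ℕ} (a b : Fin (n + 1) → F) (C : Type*) [Ring C]
    [Algebra F C] where
  u : Fin n → C
  v : Fin n → C
  z : C
  u_mul_u : ∀ i, u i * u i = u i + algebraMap F C (a i.castSucc * b i.castSucc)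
  v_mul_v : ∀ i, v i * v i = algebraMap F C (a i.castSucc * a (Fin.last n))
  u_mul_v : ∀ i, u i * v i = v i * u i + v i
  commute_u_u : ∀ i j, Commute (u i) (u j)
  commute_v_v : ∀ i j, Commute (v i) (v j)
  commute_u_v : ∀ i j, i ≠ j → Commute (u i) (v j)
  commute_z_u : ∀ i, Commute z (u i)
  commute_z_v : ∀ i, Commute z (v i)
  z_mul_z : z * z = z + algebraMap F C (∑ i, a i * b i)

namespace Generators

variable {F : Type*} [Field F] {n : ℕ} {a b : Fin (n + 1) → F} {C : Type*}
  [Ring C] [Algebra F C]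

/-- The image under a homomorphism. -/
@[simps u v z]
def map {D : Type*} [Ring D] [Algebra F D] (G : Generators a b C) (f : C →ₐ[F] D) :
    Generators a b D where
  u i := f (G.u i)
  v i := f (G.v i)
  z := f G.z
  u_mul_u i := by rw [← map_mul, G.u_mul_u, map_add, AlgHom.commutes]
  v_mul_v i := by rw [← map_mul, G.v_mul_v, AlgHom.commutes]
  u_mul_v i := by rw [← map_mul, G.u_mul_v, map_add, map_mul]
  commute_u_u i j := (G.commute_u_u i j).map f
  commute_v_v i j := (G.commute_v_v i j).map f
  commute_u_v i j h := (G.commute_u_v i j h).map f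
  commute_z_u i := (G.commute_z_u i).map f
  commute_z_v i := (G.commute_z_v i).map f
  z_mul_z := by rw [← map_mul, G.z_mul_z, map_add, AlgHom.commutes]

/-- The element `w = z + ∑ uᵢ`, which plays the role of `u_m`. -/
def w (G : Generators a b C) : C := G.z + ∑ i, G.u i

/-- The element `aᵢ⁻¹ vᵢ uᵢ`, which plays the role of `fᵢ e_m`. -/
def g (G : Generators a b C) (i : Fin n) : C := (a i.castSucc)⁻¹ • (G.v i * G.u i)

theorem commute_w_u (G : Generators a b C) (i : Fin n) : Commute G.w (G.u i) :=
  (G.commute_z_u i).add_left (Commute.sum_left _ _ _ fun j _ => G.commute_u_u j i)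

/-- Among the summands of `w` only `uᵢ` fails to commute with `vᵢ`. -/
theorem w_mul_v (G : Generators a b C) (i : Fin n) : G.w * G.v i = G.v i * G.w + G.v i := by
  rw [w, add_mul, mul_add, (G.commute_z_v i).eq, add_assoc,
    sum_mul_of_commute_ne (G.u_mul_v i) fun j hj => G.commute_u_v j i hj]

theorem w_mul_g (G : Generators a b C) (i : Fin n) : G.w * G.g i = G.g i * G.w + G.g i := by
  rw [g, mul_smul_comm, ← mul_assoc, w_mul_v, add_mul, mul_assoc, (G.commute_w_u i).eq,
    ← mul_assoc, smul_add, smul_mul_assoc]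

theorem commute_v_g (G : Generators a b C) {i j : Fin n} (h : i ≠ j) : Commute (G.v i) (G.g j) :=
  ((G.commute_v_v i j).mul_right (G.commute_u_v j i h.symm).symm).smul_right _

theorem commute_g_g (G : Generators a b C) {i j : Fin n} (h : i ≠ j) : Commute (G.g i) (G.g j) :=
  (((G.commute_v_g h).mul_left ((G.commute_u_v i j h).mul_right
    (G.commute_u_u i j) |>.smul_right _))).smul_left _

/-- The images of the basis vectors `x` under `x ↦ x e_m` or `x ↦ e_m x`, where `t` is the image
of `f_m`. -/
def fam (G : Generators a b C) (t : C) : Fin (n + 1) ⊕ Fin (n + 1) → C :=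
  Sum.elim (Fin.snoc (α := fun _ => C) G.v (algebraMap F C (a (Fin.last n))))
    (Fin.snoc (α := fun _ => C) G.g t)

@[simp] theorem fam_inl_castSucc (G : Generators a b C) (t : C) (i : Fin n) :
    G.fam t (.inl i.castSucc) = G.v i := by simp [fam]

@[simp] theorem fam_inl_last (G : Generators a b C) (t : C) :
    G.fam t (.inl (Fin.last n)) = algebraMap F C (a (Fin.last n)) := by simp [fam]

@[simp] theorem fam_inr_castSucc (G : Generators a b C) (t : C) (i : Fin n) :
    G.fam t (.inr i.castSucc) = G.g i := by simp [fam]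

@[simp] theorem fam_inr_last (G : Generators a b C) (t : C) :
    G.fam t (.inr (Fin.last n)) = t := by simp [fam]

/-- The linear extension of `fam`. -/
def lin {V : Type*} [AddCommGroup V] [Module F V] (G : Generators a b C)
    (E : Module.Basis (Fin (n + 1) ⊕ Fin (n + 1)) F V) (t : C) : V →ₗ[F] C := E.constr F (G.fam t)

theorem lin_basis {V : Type*} [AddCommGroup V] [Module F V] (G : Generators a b C)
    (E : Module.Basis (Fin (n + 1) ⊕ Fin (n + 1)) F V) (t : C)
    (p : Fin (n + 1) ⊕ Fin (n + 1)) : G.lin E t (E p) = G.fam t p := by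
  rw [lin, Module.Basis.constr_basis]

variable [CharP F 2]

/-- The constant of `z² + z` runs over all indices and that of `(∑ uᵢ)² + ∑ uᵢ` over all but the
last; only `a_m b_m` survives their sum. -/
theorem w_mul_w (G : Generators a b C) :
    G.w * G.w = G.w + algebraMap F C (a (Fin.last n) * b (Fin.last n)) := by
  rw [w, add_mul, mul_add, mul_add, sum_mul_sum_of_commute G.u_mul_u G.commute_u_u, G.z_mul_z,
    Fin.sum_univ_castSucc, map_add,
    (Commute.sum_right Finset.univ _ _ fun j _ => G.commute_z_u j).eq]
  have h1 := add_self_eq_zero_of_charTwo F ((∑ i, G.u i) * G.z)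
  have h2 := add_self_eq_zero_of_charTwo F
    (algebraMap F C (∑ i : Fin n, a i.castSucc * b i.castSucc))
  rw [← sub_eq_zero]
  calc _ = ((∑ i, G.u i) * G.z + (∑ i, G.u i) * G.z) +
      (algebraMap F C (∑ i : Fin n, a i.castSucc * b i.castSucc) +
        algebraMap F C (∑ i : Fin n, a i.castSucc * b i.castSucc)) := by abel
    _ = 0 := by rw [h1, h2, add_zero]

/-- Replace `z` by `z + 1`. -/
@[simps u z]
def shift (G : Generators a b C) : Generators a b C where
  __ := G
  z := G.z + 1
  commute_z_u i := (G.commute_z_u i).add_left (Commute.one_left _)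
  commute_z_v i := (G.commute_z_v i).add_left (Commute.one_left _)
  z_mul_z := by
    rw [add_mul, mul_add, G.z_mul_z, one_mul, mul_one, ← sub_eq_zero]
    refine Eq.trans ?_ (add_self_eq_zero_of_charTwo F G.z)
    abel

theorem shift_w (G : Generators a b C) : G.shift.w = G.w + 1 := by
  simp only [w, shift_z, shift_u]
  abel

variable (ha : ∀ i, a i ≠ 0)
include ha

/-- The counterpart of `(fᵢe_m)(e_m fᵢ) = a_m bᵢ`: moving `u` past `v` gives `vuvu = v²(u² + u)`. -/
theorem g_mul_g (G : Generators a b C) (i : Fin n) :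
    G.g i * G.g i = algebraMap F C (a (Fin.last n) * b i.castSucc) := by
  have h : G.v i * G.u i * (G.v i * G.u i) =
      algebraMap F C (a i.castSucc * a (Fin.last n) * (a i.castSucc * b i.castSucc)) := by
    rw [mul_assoc, ← mul_assoc (G.u i), G.u_mul_v, add_mul, mul_assoc, G.u_mul_u, ← mul_add,
      ← mul_assoc, G.v_mul_v, map_mul _ (a i.castSucc * a (Fin.last n))]
    congr 1
    rw [add_right_comm, add_self_eq_zero_of_charTwo F, zero_add]
  rw [g, smul_mul_smul_comm, h, Algebra.smul_def, ← map_mul]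
  congr 1
  have := ha i.castSucc
  field_simp

/-- The counterpart of `(eᵢe_m)(e_m fᵢ) + (fᵢe_m)(e_m eᵢ) = a_m b_q(eᵢ, fᵢ)`. -/
theorem v_mul_g_add (G : Generators a b C) (i : Fin n) :
    G.v i * G.g i + G.g i * G.v i = algebraMap F C (a (Fin.last n)) := by
  have h : G.v i * (G.v i * G.u i) + G.v i * G.u i * G.v i =
      algebraMap F C (a i.castSucc * a (Fin.last n)) := by
    rw [mul_assoc (G.v i) (G.u i), ← mul_add, G.u_mul_v, ← add_assoc,
      add_self_eq_zero_of_charTwo F, zero_add, G.v_mul_v]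
  rw [g, mul_smul_comm, smul_mul_assoc, ← smul_add, h, Algebra.smul_def, ← map_mul]
  congr 1
  have := ha i.castSucc
  field_simp

omit ha

theorem fam_inr_mul_fam_inr (G : Generators a b C) (i j : Fin (n + 1)) :
    G.fam (G.w + 1) (.inr i) * G.fam G.w (.inr j) +
      G.fam (G.w + 1) (.inr j) * G.fam G.w (.inr i) = 0 := by
  have hlast : ∀ i : Fin n, G.g i * G.w + (G.w + 1) * G.g i = 0 := fun i => by
    rw [add_mul, w_mul_g, one_mul, add_assoc, add_self_eq_zero_of_charTwo F, add_zero,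
      add_self_eq_zero_of_charTwo F]
  by_cases hij : i = j
  · subst hij
    exact add_self_eq_zero_of_charTwo F _
  induction i using Fin.lastCases with
  | last =>
    induction j using Fin.lastCases with
    | last => exact absurd rfl hij
    | cast j =>
      simp only [fam_inr_castSucc, fam_inr_last]
      rw [add_comm, hlast]
  | cast i =>
    induction j using Fin.lastCases with
    | last =>
      simp only [fam_inr_castSucc, fam_inr_last]
      exact hlast i
    | cast j =>
      simp only [fam_inr_castSucc]
      exact mul_add_mul_eq_zero_of_commute F
        (G.commute_g_g fun h => hij (congrArg Fin.castSucc h))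

/-! ### The quadratic relations for the images of the basis vectors. -/

section Vectors

variable {V : Type*} [AddCommGroup V] [Module F V] {q : QuadraticForm F V}
  {E : Module.Basis (Fin (n + 1) ⊕ Fin (n + 1)) F V} (hE : IsAdapted q a b E)

-- The identity `(x e_m)(e_m x) = a_m q(x)` for `x` in the basis. The parameter `w + 1` stands for
-- `f_m e_m` and `w` for `e_m f_m`.
include ha hE in
theorem fam_mul_fam (G : Generators a b C) (p : Fin (n + 1) ⊕ Fin (n + 1)) :
    G.fam (G.w + 1) p * G.fam G.w p = algebraMap F C (a (Fin.last n) * q (E p)) := by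
  rcases p with i | i
  · rw [hE.map_inl]
    induction i using Fin.lastCases with
    | last => rw [fam_inl_last, fam_inl_last, map_mul]
    | cast i => rw [fam_inl_castSucc, fam_inl_castSucc, G.v_mul_v, mul_comm]
  · rw [hE.map_inr]
    induction i using Fin.lastCases with
    | last =>
      rw [fam_inr_last, fam_inr_last, add_mul, w_mul_w, one_mul, add_right_comm,
        add_self_eq_zero_of_charTwo F, zero_add]
    | cast i => rw [fam_inr_castSucc, fam_inr_castSucc, G.g_mul_g ha]

omit [CharP F 2] in
theorem commute_fam_inl (G : Generators a b C) (t t' : C) (i j : Fin (n + 1)) :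
    Commute (G.fam t (.inl i)) (G.fam t' (.inl j)) := by
  induction i using Fin.lastCases with
  | last => rw [fam_inl_last]; exact Algebra.commutes _ _
  | cast i =>
    induction j using Fin.lastCases with
    | last => rw [fam_inl_last]; exact (Algebra.commutes _ _).symm
    | cast j => rw [fam_inl_castSucc, fam_inl_castSucc]; exact G.commute_v_v i j

include ha hE

theorem fam_inl_mul_fam_inr (G : Generators a b C) (i j : Fin (n + 1)) :
    G.fam (G.w + 1) (.inl i) * G.fam G.w (.inr j) + G.fam (G.w + 1) (.inr j) * G.fam G.w (.inl i) =
      algebraMap F C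
        (a (Fin.last n) * QuadraticMap.polar q (E (.inl i)) (E (.inr j))) := by
  rw [hE.polar_inl_inr]
  induction i using Fin.lastCases with
  | last =>
    induction j using Fin.lastCases with
    | last =>
      simp only [fam_inl_last, fam_inr_last, if_true, mul_one]
      rw [← Algebra.commutes, mul_add, ← add_assoc, add_self_eq_zero_of_charTwo F, zero_add,
        mul_one]
    | cast j =>
      rw [if_neg (Fin.castSucc_lt_last j).ne', mul_zero, map_zero, fam_inl_last, fam_inl_last,
        fam_inr_castSucc, fam_inr_castSucc]
      exact mul_add_mul_eq_zero_of_commute F (Algebra.commutes _ _)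
  | cast i =>
    induction j using Fin.lastCases with
    | last =>
      rw [if_neg (Fin.castSucc_lt_last i).ne, mul_zero, map_zero]
      simp only [fam_inl_castSucc, fam_inr_last]
      rw [add_mul, w_mul_v, one_mul, add_assoc, add_self_eq_zero_of_charTwo F, add_zero,
        add_self_eq_zero_of_charTwo F]
    | cast j =>
      simp only [fam_inl_castSucc, fam_inr_castSucc]
      by_cases h : i = j
      · subst h
        rw [if_pos rfl, mul_one, G.v_mul_g_add ha]
      · rw [if_neg (fun h' => h (Fin.castSucc_injective _ h')), mul_zero, map_zero]
        exact mul_add_mul_eq_zero_of_commute F (G.commute_v_g h)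

/-- The polar form of `fam_mul_fam` on pairs of basis vectors; the two statements together determine
the identity on all of `V`. -/
theorem fam_polar (G : Generators a b C) (p r : Fin (n + 1) ⊕ Fin (n + 1)) :
    G.fam (G.w + 1) p * G.fam G.w r + G.fam (G.w + 1) r * G.fam G.w p =
      algebraMap F C (a (Fin.last n) * QuadraticMap.polar q (E p) (E r)) := by
  rcases p with i | i <;> rcases r with j | j
  · rw [hE.polar_inl_inl, mul_zero, map_zero, (G.commute_fam_inl _ _ i j).eq]
    have h : ∀ t t' k, G.fam t (.inl k) = G.fam t' (.inl k) := fun _ _ _ => rfl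
    rw [h (G.w + 1) G.w, h (G.w + 1) G.w]
    exact add_self_eq_zero_of_charTwo F _
  · exact G.fam_inl_mul_fam_inr ha hE i j
  · rw [add_comm, QuadraticMap.polar_comm]
    exact G.fam_inl_mul_fam_inr ha hE j i
  · rw [hE.polar_inr_inr, mul_zero, map_zero]
    exact G.fam_inr_mul_fam_inr i j

end Vectors

end Generators

/-- A bilinear map that is alternating on a basis is alternating. -/
theorem bilin_self_eq_zero {R M N κ : Type*} [CommRing R] [AddCommGroup M] [Module R M]
    [AddCommGroup N] [Module R N] [Fintype κ] (b : Module.Basis κ R M) (D : M →ₗ[R] M →ₗ[R] N)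
    (h1 : ∀ i j, D (b i) (b j) + D (b j) (b i) = 0) (h2 : ∀ i, D (b i) (b i) = 0) (x : M) :
    D x x = 0 := by
  change TensorProduct.lift D (x ⊗ₜ x) = 0
  refine map_eq_zero_of_repr_invariant (b.tensorProduct b) Prod.swap Prod.swap_swap _ ?_ ?_ ?_
  · rintro ⟨i, j⟩
    simpa [Module.Basis.tensorProduct_apply] using h1 i j
  · rintro ⟨i, j⟩ h
    obtain rfl : j = i := congrArg Prod.fst h
    simpa [Module.Basis.tensorProduct_apply] using h2 j
  · rintro ⟨i, j⟩
    simp [mul_comm]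

/-! ### The even pairing attached to a system of generators. -/

namespace Generators

variable {F : Type*} [Field F] [CharP F 2] {n : ℕ} {a b : Fin (n + 1) → F} {C : Type*}
  [Ring C] [Algebra F C] {V : Type*} [AddCommGroup V] [Module F V] {q : QuadraticForm F V}
  {E : Module.Basis (Fin (n + 1) ⊕ Fin (n + 1)) F V} (hE : IsAdapted q a b E)
  (ha : ∀ i, a i ≠ 0)

-- With `β(x, x) = q(x)`, the difference of `(x e_m)(e_m y)` and `a_m β(x, y)` is a bilinear map
-- that is alternating on the basis, hence everywhere.
include ha hE in
theorem lin_mul_lin (G : Generators a b C) (x : V) :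
    G.lin E (G.w + 1) x * G.lin E G.w x = algebraMap F C (a (Fin.last n) * q x) := by
  obtain ⟨β, hβ⟩ := LinearMap.BilinMap.toQuadraticMap_surjective q
  have hβ' : ∀ x, β x x = q x := fun x => by rw [← hβ]; rfl
  have hβp : ∀ x y, β x y + β y x = QuadraticMap.polar q x y := fun x y => by
    have h := hβ' (x + y)
    simp only [map_add, LinearMap.add_apply, hβ'] at h
    rw [QuadraticMap.polar, ← h]
    ring
  have h := bilin_self_eq_zero E ((LinearMap.mul F C).compl₁₂ (G.lin E (G.w + 1)) (G.lin E G.w) -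
    (a (Fin.last n) • β).compr₂ (Algebra.linearMap F C)) ?_ ?_ x
  · rw [← hβ', ← sub_eq_zero]
    exact h
  · intro p r
    rw [← sub_eq_zero.2 (G.fam_polar ha hE p r), ← hβp, mul_add, map_add, ← lin_basis (E := E),
      ← lin_basis (E := E), ← lin_basis (E := E), ← lin_basis (E := E)]
    change _ - algebraMap F C (a (Fin.last n) * β _ _) +
      (_ - algebraMap F C (a (Fin.last n) * β _ _)) = _
    simp only [LinearMap.compl₁₂_apply, LinearMap.mul_apply']
    abel
  · intro p
    rw [← sub_eq_zero.2 (G.fam_mul_fam ha hE p), ← hβ', ← lin_basis (E := E),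
      ← lin_basis (E := E)]
    rfl

-- Replacing `z` by `z + 1` again gives generators and interchanges `w` and `w + 1`, so the identity
-- in the opposite order is `lin_mul_lin` for the shifted system.
include ha hE in
theorem lin_mul_lin' (G : Generators a b C) (x : V) :
    G.lin E G.w x * G.lin E (G.w + 1) x = algebraMap F C (a (Fin.last n) * q x) := by
  have h := G.shift.lin_mul_lin hE ha x
  rw [shift_w, add_assoc, add_self_eq_zero_of_charTwo F, add_zero] at h
  exact h

/-- The pairing `(x, y) ↦ x y = a_m⁻¹ (x e_m) (e_m y)` defined by generators. -/
def evenHom (G : Generators a b C) : CliffordAlgebra.EvenHom q C where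
  bilin := (a (Fin.last n))⁻¹ •
    (LinearMap.mul F C).compl₁₂ (G.lin E (G.w + 1)) (G.lin E G.w)
  contract x := by
    change (a (Fin.last n))⁻¹ • (G.lin E (G.w + 1) x * G.lin E G.w x) = _
    rw [G.lin_mul_lin hE ha, Algebra.smul_def, ← map_mul, inv_mul_cancel_left₀ (ha _)]
  contract_mid x y z := by
    change (a (Fin.last n))⁻¹ • (G.lin E (G.w + 1) x * G.lin E G.w y) *
      (a (Fin.last n))⁻¹ • (G.lin E (G.w + 1) y * G.lin E G.w z) =
        q y • (a (Fin.last n))⁻¹ • (G.lin E (G.w + 1) x * G.lin E G.w z)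
    -- The inner product `(e_m y)(y e_m)` is the scalar `a_m q(y)`, and this `a_m` cancels one of
    -- the two factors `a_m⁻¹`.
    rw [smul_mul_smul_comm, mul_assoc, ← mul_assoc (G.lin E G.w y), G.lin_mul_lin' hE ha,
      ← Algebra.smul_def, mul_smul_comm, smul_smul, smul_smul]
    congr 1
    have := ha (Fin.last n)
    field_simp

theorem evenHom_apply (G : Generators a b C) (x y : V) :
    (G.evenHom hE ha).bilin x y =
      (a (Fin.last n))⁻¹ • (G.lin E (G.w + 1) x * G.lin E G.w y) := rfl

theorem evenHom_inl_inr (G : Generators a b C) (i : Fin n) :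
    (G.evenHom hE ha).bilin (E (.inl i.castSucc)) (E (.inr i.castSucc)) = G.u i := by
  rw [evenHom_apply, lin_basis, lin_basis, fam_inl_castSucc, fam_inr_castSucc, g, mul_smul_comm,
    ← mul_assoc, G.v_mul_v, ← Algebra.smul_def, smul_smul, smul_smul]
  have h1 := ha (Fin.last n)
  have h2 := ha i.castSucc
  rw [show (a (Fin.last n))⁻¹ * (a i.castSucc)⁻¹ * (a i.castSucc * a (Fin.last n)) = 1 by
    field_simp, one_smul]

theorem evenHom_inl_last (G : Generators a b C) (i : Fin n) :
    (G.evenHom hE ha).bilin (E (.inl i.castSucc)) (E (.inl (Fin.last n))) = G.v i := by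
  rw [evenHom_apply, lin_basis, lin_basis, fam_inl_castSucc, fam_inl_last, ← Algebra.commutes,
    ← Algebra.smul_def, smul_smul, inv_mul_cancel₀ (ha _), one_smul]

theorem evenHom_last_last (G : Generators a b C) :
    (G.evenHom hE ha).bilin (E (.inl (Fin.last n))) (E (.inr (Fin.last n))) = G.w := by
  rw [evenHom_apply, lin_basis, lin_basis, fam_inr_last, fam_inl_last,
    ← Algebra.smul_def, smul_smul, inv_mul_cancel₀ (ha _), one_smul]

omit [CharP F 2] in
theorem map_w {D : Type*} [Ring D] [Algebra F D] (G : Generators a b C) (f : C →ₐ[F] D) :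
    (G.map f).w = f G.w := by
  simp [w]

omit [CharP F 2] in
theorem map_lin {D : Type*} [Ring D] [Algebra F D] (G : Generators a b C) (f : C →ₐ[F] D) (t : C)
    (x : V) : f (G.lin E t x) = (G.map f).lin E (f t) x := by
  suffices f.toLinearMap ∘ₗ G.lin E t = (G.map f).lin E (f t) from LinearMap.congr_fun this x
  refine E.ext fun p => ?_
  rw [LinearMap.comp_apply, lin_basis, lin_basis]
  rcases p with i | i <;> induction i using Fin.lastCases <;> simp [g]

end Generators

/-! ### The generators of the Clifford algebra -/

section CliffGenerators

variable {F V : Type u} [Field F] [CharP F 2] [AddCommGroup V] [Module F V]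
  [FiniteDimensional F V] {q : QuadraticForm F V}
  (hq : LinearMap.BilinForm.Nondegenerate q.polarBilin) {n : ℕ} {a b : Fin (n + 1) → F}
  {E : Module.Basis (Fin (n + 1) ⊕ Fin (n + 1)) F V} (hE : IsAdapted q a b E)

include hE

theorem cliffPair_mul_self (i : Fin (n + 1)) :
    cliffPair q hq (E (.inl i)) (E (.inr i)) * cliffPair q hq (E (.inl i)) (E (.inr i)) =
      cliffPair q hq (E (.inl i)) (E (.inr i)) + algebraMap F _ (a i * b i) := by
  have h := cliffPair_mul_add q hq (E (.inl i)) (E (.inr i)) (E (.inl i)) (E (.inr i))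
  rw [hE.polar_inr_inl, if_pos rfl, one_smul, cliffPair_self, cliffPair_self, hE.map_inl,
    hE.map_inr, ← map_mul] at h
  rw [eq_add_iff_of_charTwo F, h]

theorem commute_cliffPair_of_ne {i j : Fin (n + 1)} (hij : i ≠ j) :
    Commute (cliffPair q hq (E (.inl i)) (E (.inr i)))
      (cliffPair q hq (E (.inl j)) (E (.inr j))) :=
  cliffPair_commute q hq (hE.polar_inl_inl _ _) ((hE.polar_inl_inr _ _).trans (if_neg hij))
    ((hE.polar_inr_inl _ _).trans (if_neg hij)) (hE.polar_inr_inr _ _)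

/-- The quaternion relation `uv = vu + v`: moving `eᵢ` past `fᵢ` costs `b_q(eᵢ, fᵢ) = 1`, while
`e_k` is orthogonal to both. -/
theorem cliffPair_mul_inl_inl {i k : Fin (n + 1)} (hk : i ≠ k) :
    cliffPair q hq (E (.inl i)) (E (.inr i)) * cliffPair q hq (E (.inl i)) (E (.inl k)) =
      cliffPair q hq (E (.inl i)) (E (.inl k)) * cliffPair q hq (E (.inl i)) (E (.inr i)) +
        cliffPair q hq (E (.inl i)) (E (.inl k)) := by
  have h := cliffPair_mul_add q hq (E (.inl i)) (E (.inr i)) (E (.inl i)) (E (.inl k))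
  have h' := cliffPair_exchange q hq (x := E (.inl i)) (y := E (.inl k)) (w := E (.inl i))
    (z := E (.inr i)) (hE.polar_inl_inl _ _)
  rw [hE.polar_inr_inl, if_pos rfl, one_smul] at h
  rw [h', cliffPair_comm q hq (x := E (.inl k)) (y := E (.inr i))
    ((hE.polar_inl_inr _ _).trans (if_neg hk.symm))]
  exact ((eq_add_iff_of_charTwo F).2 h).trans (add_comm _ _)

/-- The generators `uᵢ = eᵢ fᵢ`, `vᵢ = eᵢ e_m`, `z = ∑ eᵢ fᵢ` of the Clifford algebra. -/
def cliffGenerators :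
    Generators a b (Cliff (adjInvolution q hq) (adjSemitrace q hq)) where
  u i := cliffPair q hq (E (.inl i.castSucc)) (E (.inr i.castSucc))
  v i := cliffPair q hq (E (.inl i.castSucc)) (E (.inl (Fin.last n)))
  z := ∑ i, cliffPair q hq (E (.inl i)) (E (.inr i))
  u_mul_u i := cliffPair_mul_self hq hE _
  v_mul_v i := by
    have h := cliffPair_mul q hq (E (.inl i.castSucc)) (E (.inl (Fin.last n)))
      (E (.inl i.castSucc))
    rw [cliffPair_comm q hq (hE.polar_inl_inl (Fin.last n) i.castSucc), cliffPair_self, hE.map_inl,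
      hE.map_inl, Algebra.smul_def, ← map_mul, mul_comm (a _)] at h
    exact h
  u_mul_v i := cliffPair_mul_inl_inl hq hE (Fin.castSucc_lt_last i).ne
  commute_u_u i j := by
    by_cases h : i = j
    · rw [h]
    · exact commute_cliffPair_of_ne hq hE fun h' => h (Fin.castSucc_injective _ h')
  commute_v_v i j := cliffPair_commute q hq (hE.polar_inl_inl _ _) (hE.polar_inl_inl _ _)
    (hE.polar_inl_inl _ _) (hE.polar_inl_inl _ _)
  commute_u_v i j h := cliffPair_commute q hq (hE.polar_inl_inl _ _) (hE.polar_inl_inl _ _)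
    ((hE.polar_inr_inl _ _).trans (if_neg fun h' => h (Fin.castSucc_injective _ h')))
    ((hE.polar_inr_inl _ _).trans (if_neg (Fin.castSucc_lt_last i).ne))
  commute_z_u i := by
    refine Commute.sum_left _ _ _ fun j _ => ?_
    by_cases h : j = i.castSucc
    · rw [h]
    · exact commute_cliffPair_of_ne hq hE h
  commute_z_v i := by
    -- Exactly two summands of `z`, those of indices `i` and `m`, fail to commute with `eᵢe_m`. Each
    -- contributes one extra `vᵢ`, and the two cancel.
    have h1 := cliffPair_mul_inl_inl hq hE (Fin.castSucc_lt_last i).ne'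
    rw [cliffPair_comm q hq (hE.polar_inl_inl (Fin.last n) i.castSucc)] at h1
    have h2 := sum_mul_of_commute_ne
      (x := fun j : Fin n => cliffPair q hq (E (.inl j.castSucc)) (E (.inr j.castSucc)))
      (y := cliffPair q hq (E (.inl i.castSucc)) (E (.inl (Fin.last n)))) (i := i)
      (cliffPair_mul_inl_inl hq hE (Fin.castSucc_lt_last i).ne)
      fun j hj => cliffPair_commute q hq (hE.polar_inl_inl _ _) (hE.polar_inl_inl _ _)
        ((hE.polar_inr_inl _ _).trans (if_neg fun h' => hj (Fin.castSucc_injective _ h')))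
        ((hE.polar_inr_inl _ _).trans (if_neg (Fin.castSucc_lt_last j).ne))
    rw [commute_iff_eq, Fin.sum_univ_castSucc, add_mul, h1, h2, add_add_add_comm,
      add_self_eq_zero_of_charTwo F, add_zero, mul_add]
  z_mul_z := sum_mul_sum_of_commute (fun i => cliffPair_mul_self hq hE i) fun i j => by
    by_cases h : i = j
    · rw [h]
    · exact commute_cliffPair_of_ne hq hE h

end CliffGenerators

/-! ### Homomorphisms from a tensor product of algebras -/

section LiftCommuting

/-- Makes the ordered product over the tensor factors multiplicative, as `liftCommuting` requires.
-/
theorem prod_ofFn_mul {C : Type*} [Monoid C] : ∀ {n : ℕ} (x y : Fin n → C),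
    (∀ i j, i ≠ j → Commute (x i) (y j)) →
    (List.ofFn fun i => x i * y i).prod = (List.ofFn x).prod * (List.ofFn y).prod
  | 0, x, y, _ => by simp
  | n + 1, x, y, h => by
    rw [List.ofFn_succ, List.ofFn_succ, List.ofFn_succ, List.prod_cons, List.prod_cons,
      List.prod_cons, prod_ofFn_mul _ _ fun i j hij => h _ _ (by simpa using hij)]
    have hc : Commute (y 0) (List.ofFn fun i : Fin n => x i.succ).prod :=
      Commute.list_prod_right _ _ fun c hc => by
        obtain ⟨i, rfl⟩ := List.mem_ofFn.1 hc
        exact (h i.succ 0 (Fin.succ_ne_zero i)).symm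
    rw [mul_assoc, mul_assoc, ← mul_assoc (y 0), hc.eq, mul_assoc]

theorem prod_ofFn_eq_of_eq_one {C : Type*} [Monoid C] : ∀ {n : ℕ} (x : Fin n → C) (i : Fin n),
    (∀ j, j ≠ i → x j = 1) → (List.ofFn x).prod = x i
  | 0, _, i, _ => i.elim0
  | n + 1, x, i, h => by
    rw [List.ofFn_succ, List.prod_cons]
    induction i using Fin.cases with
    | zero =>
      have : (fun i : Fin n => x i.succ) = fun _ => 1 := funext fun j => h _ (Fin.succ_ne_zero j)
      rw [this]
      simp
    | succ i =>
      rw [h 0 (Fin.succ_ne_zero i).symm, one_mul,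
        prod_ofFn_eq_of_eq_one _ i fun j hj => h _ (by simpa using hj)]

variable {F C : Type*} [Field F] [Ring C] [Algebra F C] {n : ℕ} {A : Fin n → Type*}
  [∀ i, Ring (A i)] [∀ i, Algebra F (A i)]

/-- The homomorphism from `⨂ Aᵢ` given by homomorphisms with commuting images. -/
def liftCommuting (φ : ∀ i, A i →ₐ[F] C)
    (h : ∀ i j, i ≠ j → ∀ x y, Commute (φ i x) (φ j y)) : (⨂[F] i, A i) →ₐ[F] C :=
  PiTensorProduct.liftAlgHom
    ((MultilinearMap.mkPiAlgebraFin F n C).compLinearMap fun i => (φ i).toLinearMap)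
    (by simp)
    fun x y => by
      simp only [MultilinearMap.compLinearMap_apply, MultilinearMap.mkPiAlgebraFin_apply,
        Pi.mul_apply, AlgHom.toLinearMap_apply, map_mul]
      exact prod_ofFn_mul _ _ fun i j hij => h i j hij _ _

theorem liftCommuting_tprod (φ : ∀ i, A i →ₐ[F] C)
    (h : ∀ i j, i ≠ j → ∀ x y, Commute (φ i x) (φ j y)) (x : ∀ i, A i) :
    liftCommuting φ h (PiTensorProduct.tprod F x) = (List.ofFn fun i => φ i (x i)).prod := by
  rw [liftCommuting, PiTensorProduct.liftAlgHom_apply, PiTensorProduct.lift.tprod]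
  simp

theorem liftCommuting_single (φ : ∀ i, A i →ₐ[F] C)
    (h : ∀ i j, i ≠ j → ∀ x y, Commute (φ i x) (φ j y)) (i : Fin n) (x : A i) :
    liftCommuting φ h (PiTensorProduct.singleAlgHom i x) = φ i x := by
  rw [PiTensorProduct.singleAlgHom_apply, liftCommuting_tprod,
    prod_ofFn_eq_of_eq_one _ i fun j hj => ?_]
  · simp
  · simp [Pi.mulSingle_eq_of_ne hj]

theorem piTensor_single (σ : ∀ i, AlgInvolution F (A i)) (i : Fin n) (x : A i) :
    AlgInvolution.piTensor σ (PiTensorProduct.singleAlgHom i x) =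
      PiTensorProduct.singleAlgHom i (σ i x) := by
  rw [PiTensorProduct.singleAlgHom_apply, PiTensorProduct.singleAlgHom_apply]
  refine (PiTensorProduct.map_tprod _ _).trans ?_
  congr 1
  funext j
  by_cases h : j = i
  · subst h; simp
  · simp only [MonoidHom.mulSingle_apply, Pi.mulSingle_eq_of_ne h]
    exact (σ j).map_one'

theorem commute_single {i j : Fin n} (hij : i ≠ j) (x : A i) (y : A j) :
    Commute (PiTensorProduct.singleAlgHom (R := F) (A := A) i x)
      (PiTensorProduct.singleAlgHom j y) := by
  rw [PiTensorProduct.singleAlgHom_apply, PiTensorProduct.singleAlgHom_apply]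
  refine Commute.tprod ?_
  exact Pi.mulSingle_commute hij x y

end LiftCommuting

/-! ### The étale extension -/

section EtaleExt

variable {F : Type u} [Field F] (d : F)

/-- The generator `α` of `F[X]/(X² + X + d)`. -/
def etaleRoot : EtaleExt d := AdjoinRoot.root _

variable {d}

theorem etale_eval {C : Type*} [Ring C] [Algebra F C] (z : C) :
    Polynomial.aeval z (Polynomial.X ^ 2 + Polynomial.X + Polynomial.C d : Polynomial F) =
      z * z + z + algebraMap F C d := by
  simp [pow_two]

/-- The homomorphism from `F[X]/(X² + X + d)` determined by the image of the generator. -/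
def etaleLift {C : Type*} [Ring C] [Algebra F C] (z : C) (hz : z * z + z + algebraMap F C d = 0) :
    EtaleExt d →ₐ[F] C :=
  Ideal.Quotient.liftₐ _ (Polynomial.aeval z) fun p hp => by
    obtain ⟨r, rfl⟩ := Ideal.mem_span_singleton'.1 hp
    rw [map_mul, etale_eval, hz, mul_zero]

theorem etaleLift_mk {C : Type*} [Ring C] [Algebra F C] (z : C)
    (hz : z * z + z + algebraMap F C d = 0) (p : Polynomial F) :
    etaleLift z hz (AdjoinRoot.mk _ p) = Polynomial.aeval z p := rfl

theorem etaleLift_root {C : Type*} [Ring C] [Algebra F C] (z : C)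
    (hz : z * z + z + algebraMap F C d = 0) : etaleLift z hz (etaleRoot d) = z := by
  rw [etaleRoot, ← AdjoinRoot.mk_X, etaleLift_mk, Polynomial.aeval_X]

theorem commute_etaleLift {C : Type*} [Ring C] [Algebra F C] (z : C)
    (hz : z * z + z + algebraMap F C d = 0) {y : C} (hy : Commute z y) (x : EtaleExt d) :
    Commute (etaleLift z hz x) y := by
  induction x using AdjoinRoot.induction_on with
  | ih p =>
    rw [etaleLift_mk]
    have h : Algebra.adjoin F {z} ≤ Subalgebra.centralizer F {y} := by
      rw [Algebra.adjoin_le_iff]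
      rintro _ rfl _ rfl
      exact hy.eq.symm
    exact (h (Polynomial.aeval_mem_adjoin_singleton F z) y rfl).symm

theorem etaleRoot_mul_self : etaleRoot d * etaleRoot d + etaleRoot d + algebraMap F _ d = 0 := by
  rw [← etale_eval]
  exact (AdjoinRoot.aeval_eq _).trans AdjoinRoot.mk_self

theorem etale_natDegree :
    (Polynomial.X ^ 2 + Polynomial.X + Polynomial.C d : Polynomial F).natDegree = 2 := by
  have : (Polynomial.X ^ 2 + Polynomial.X + Polynomial.C d : Polynomial F) =
    Polynomial.C 1 * Polynomial.X ^ 2 + Polynomial.C 1 * Polynomial.X + Polynomial.C d := by simp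
  rw [this, Polynomial.natDegree_quadratic one_ne_zero]

theorem etale_monic :
    (Polynomial.X ^ 2 + Polynomial.X + Polynomial.C d : Polynomial F).Monic := by
  rw [Polynomial.Monic, Polynomial.leadingCoeff, etale_natDegree]
  simp [Polynomial.coeff_X]

/-- The basis `1, α` of the étale extension. -/
def etaleBasis (d : F) : Module.Basis (Fin 2) F (EtaleExt d) :=
  (AdjoinRoot.powerBasis' (etale_monic (d := d))).basis.reindex
    (finCongr etale_natDegree)

theorem etaleBasis_zero : etaleBasis d 0 = 1 := by
  simp only [etaleBasis, Module.Basis.reindex_apply, PowerBasis.basis_eq_pow]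
  exact pow_zero _

theorem etaleBasis_one : etaleBasis d 1 = etaleRoot d := by
  simp only [etaleBasis, Module.Basis.reindex_apply, PowerBasis.basis_eq_pow]
  exact pow_one _

/-- For `x = r + s α` one has `x² = (r² + s² d) + s² α`, so `x² = 0` forces `s = 0` and then `r =
0`. The split case is included; reducedness is what makes the reduced trace over `K` unique. -/
instance etale_isReduced [CharP F 2] : IsReduced (EtaleExt d) := by
  rw [isReduced_iff_pow_one_lt 2 one_lt_two]
  intro x hx
  have h2 : (2 : EtaleExt d) = 0 := by
    have h := add_self_eq_zero_of_charTwo F (1 : EtaleExt d)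
    rwa [one_add_one_eq_two] at h
  have hxr := (etaleBasis d).sum_repr x
  rw [Fin.sum_univ_two, etaleBasis_zero, etaleBasis_one] at hxr
  set r := (etaleBasis d).repr x 0
  set s := (etaleBasis d).repr x 1
  have h : (r ^ 2 + s ^ 2 * d) • etaleBasis d 0 + (s ^ 2) • etaleBasis d 1 = 0 := by
    rw [← hx, ← hxr, etaleBasis_zero, etaleBasis_one]
    have := etaleRoot_mul_self (d := d)
    simp only [Algebra.smul_def, map_add, map_mul, map_pow, mul_one]
    linear_combination (- algebraMap F (EtaleExt d) s ^ 2) * this +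
      (algebraMap F (EtaleExt d) s ^ 2 * (algebraMap F (EtaleExt d) d + etaleRoot d) -
        algebraMap F (EtaleExt d) r * algebraMap F (EtaleExt d) s * etaleRoot d) * h2
  have hli := Fintype.linearIndependent_iff.1 (etaleBasis d).linearIndependent
    ![r ^ 2 + s ^ 2 * d, s ^ 2] (by simpa [Fin.sum_univ_two] using h)
  have hs : s = 0 := by simpa using hli 1
  have hr : r = 0 := by simpa [hs] using hli 0
  rw [← hxr, hr, hs, zero_smul, zero_smul, add_zero]

end EtaleExt

/-! ### Quaternion algebras -/

section Quat

variable {F : Type*} [Field F] [CharP F 2]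

/-- The homomorphism from `[c, d)` determined by the images of `u` and `v`. -/
def quatLift {C : Type*} [Ring C] [Algebra F C] {c d : F} {u v : C}
    (hu : u * u = u + algebraMap F C c) (hv : v * v = algebraMap F C d)
    (huv : u * v = v * u + v) : Quat c d →ₐ[F] C :=
  QuaternionAlgebra.Basis.liftHom
    { i := u
      j := v
      k := u * v
      i_mul_i := by
        rw [hu, one_smul, neg_smul, ← Algebra.algebraMap_eq_smul_one, add_comm,
          neg_eq_of_add_eq_zero_right (add_self_eq_zero_of_charTwo F _)]
      j_mul_j := by rw [hv, Algebra.algebraMap_eq_smul_one]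
      i_mul_j := rfl
      j_mul_i := by
        rw [one_smul, sub_eq_add_neg,
          neg_eq_of_add_eq_zero_right (add_self_eq_zero_of_charTwo F (u * v)), huv, add_comm,
          add_assoc, add_self_eq_zero_of_charTwo F, add_zero] }

section

variable {C : Type*} [Ring C] [Algebra F C] {c d : F} {u v : C}
    (hu : u * u = u + algebraMap F C c) (hv : v * v = algebraMap F C d)
    (huv : u * v = v * u + v)

theorem quatLift_apply (x : Quat c d) : quatLift hu hv huv x =
    algebraMap F C x.re + x.imI • u + x.imJ • v + x.imK • (u * v) := rfl

theorem commute_quatLift {y : C} (h1 : Commute u y) (h2 : Commute v y) (x : Quat c d) :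
    Commute (quatLift hu hv huv x) y := by
  rw [quatLift_apply]
  exact (((show Commute _ y from Algebra.commutes _ _).add_left (h1.smul_left _)).add_left
    (h2.smul_left _)).add_left ((h1.mul_left h2).smul_left _)

end

/-- The generator `u` of `[c, d)`. -/
def quatU (c d : F) : Quat c d := ⟨0, 1, 0, 0⟩

/-- The generator `v` of `[c, d)`. -/
def quatV (c d : F) : Quat c d := ⟨0, 0, 1, 0⟩

section

variable {C : Type*} [Ring C] [Algebra F C] {c d : F} {u v : C}
    (hu : u * u = u + algebraMap F C c) (hv : v * v = algebraMap F C d)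
    (huv : u * v = v * u + v)

theorem quatLift_u : quatLift hu hv huv (quatU c d) = u := by
  simp [quatLift_apply, quatU]

theorem quatLift_v : quatLift hu hv huv (quatV c d) = v := by
  simp [quatLift_apply, quatV]

end

variable (c d : F)

theorem quatU_mul_self : quatU c d * quatU c d = quatU c d + algebraMap F _ c := by
  ext <;> simp [quatU, QuaternionAlgebra.algebraMap_eq, CharTwo.neg_eq]

omit [CharP F 2] in
theorem quatV_mul_self : quatV c d * quatV c d = algebraMap F _ d := by
  ext <;> simp [quatV, QuaternionAlgebra.algebraMap_eq]

theorem quatU_mul_quatV : quatU c d * quatV c d = quatV c d * quatU c d + quatV c d := by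
  ext <;> simp [quatU, quatV, CharTwo.neg_eq, CharTwo.add_self_eq_zero]

theorem quatInvolution_u : quatInvolution c d (quatU c d) = quatU c d + 1 := by
  change star (quatU c d) = _
  ext <;> simp [quatU, CharTwo.neg_eq]

theorem quatInvolution_v : quatInvolution c d (quatV c d) = quatV c d := by
  change star (quatV c d) = _
  ext <;> simp [quatV, CharTwo.neg_eq]

end Quat

/-! ### Tensor products of quaternion algebras -/

section QuatTensor

variable {F : Type u} [Field F] {n : ℕ} (c d : Fin n → F)

/-- The tensor product of the quaternion algebras `[cᵢ, dᵢ)`. -/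
abbrev QuatTensor : Type u := ⨂[F] i, Quat (c i) (d i)

/-- The tensor product of the canonical involutions. -/
abbrev quatTensorInvolution : AlgInvolution F (QuatTensor c d) :=
  AlgInvolution.piTensor fun i => quatInvolution (c i) (d i)

/-- The embedding of the `i`-th factor. -/
abbrev quatSlot (i : Fin n) : Quat (c i) (d i) →ₐ[F] QuatTensor c d :=
  PiTensorProduct.singleAlgHom (R := F) (A := fun i => Quat (c i) (d i)) i

/-- The reduced trace of the tensor product. -/
def quatTensorTrace : QuatTensor c d →ₗ[F] F :=
  PiTensorProduct.lift ((MultilinearMap.mkPiAlgebra F (Fin n) F).compLinearMap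
    fun i => QuaternionAlgebra.imIₗ (-(c i)) 1 (d i))

theorem quatTensorTrace_tprod (x : ∀ i, Quat (c i) (d i)) :
    quatTensorTrace c d (PiTensorProduct.tprod F x) = ∏ i, (x i).imI := by
  rw [quatTensorTrace, PiTensorProduct.lift.tprod]
  simp [QuaternionAlgebra.imIₗ]

theorem finrank_quatTensor :
    Module.finrank F (QuatTensor c d) =
      Fintype.card (Fin n → Fin 2) * Fintype.card (Fin n → Fin 2) := by
  rw [Module.finrank_eq_card_basis (Basis.piTensorProduct fun i =>
    QuaternionAlgebra.basisOneIJK (-(c i)) 1 (d i))]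
  simp only [Fintype.card_pi, Fintype.card_fin, Finset.prod_const]
  rw [← mul_pow]
  norm_num

instance : FiniteDimensional F (QuatTensor c d) :=
  Module.Finite.of_basis (Basis.piTensorProduct fun i =>
    QuaternionAlgebra.basisOneIJK (-(c i)) 1 (d i))

variable {c d}

/-- The Kronecker product of a family of `2 × 2` matrices. -/
def kronecker (Ω : Type*) [Field Ω] (n : ℕ) :
    MultilinearMap Ω (fun _ : Fin n => Matrix (Fin 2) (Fin 2) Ω)
      (Matrix (Fin n → Fin 2) (Fin n → Fin 2) Ω) :=
  MultilinearMap.pi fun s => MultilinearMap.pi fun t =>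
    (MultilinearMap.mkPiAlgebra Ω (Fin n) Ω).compLinearMap
      fun i => Matrix.entryLinearMap Ω Ω (s i) (t i)

theorem kronecker_apply (Ω : Type*) [Field Ω] (n : ℕ) (x : Fin n → Matrix (Fin 2) (Fin 2) Ω)
    (s t : Fin n → Fin 2) : kronecker Ω n x s t = ∏ i, x i (s i) (t i) := by
  exact MultilinearMap.mkPiAlgebra_apply (R := Ω) fun i => x i (s i) (t i)

theorem kronecker_mul (Ω : Type*) [Field Ω] (n : ℕ) (x y : Fin n → Matrix (Fin 2) (Fin 2) Ω) :
    kronecker Ω n (x * y) = kronecker Ω n x * kronecker Ω n y := by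
  ext s t
  simp only [Matrix.mul_apply, kronecker_apply, Pi.mul_apply, ← Finset.prod_mul_distrib]
  rw [Finset.prod_univ_sum, Fintype.piFinset_univ]

theorem kronecker_single (Ω : Type*) [Field Ω] (n : ℕ) (s t : Fin n → Fin 2) :
    kronecker Ω n (fun i => Matrix.single (s i) (t i) 1) = Matrix.single s t 1 := by
  ext s' t'
  rw [kronecker_apply]
  simp only [Matrix.single_apply, Finset.prod_ite_zero, Finset.prod_const_one, funext_iff,
    ← forall_and, Finset.mem_univ, true_imp_iff]

theorem kronecker_one (Ω : Type*) [Field Ω] (n : ℕ) : kronecker Ω n 1 = 1 := by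
  ext s t
  rw [kronecker_apply]
  simp only [Pi.one_apply, Matrix.one_apply, Finset.prod_ite_zero, Finset.prod_const_one,
    funext_iff, Finset.mem_univ, true_imp_iff]

theorem trace_kronecker (Ω : Type*) [Field Ω] (n : ℕ) (x : Fin n → Matrix (Fin 2) (Fin 2) Ω) :
    (kronecker Ω n x).trace = ∏ i, (x i).trace := by
  simp only [Matrix.trace, Matrix.diag_apply, kronecker_apply]
  rw [Finset.prod_univ_sum, Fintype.piFinset_univ]

variable [CharP F 2]

/-! ### Splitting of the quaternion algebras and of their tensor product by matrices. -/

section Splitting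

variable {Ω : Type*} [Field Ω] [Algebra F Ω]

theorem algebra_add_self (F : Type*) [Field F] [CharP F 2] {Ω : Type*} [Field Ω] [Algebra F Ω] :
    (2 : Ω) = 0 := by
  have h := add_self_eq_zero_of_charTwo F (1 : Ω)
  rwa [one_add_one_eq_two] at h

/-- The representation of `[c, d)` by matrices, for a root `r` of `X² + X + c`. -/
def quatMatrix {c d : F} (r : Ω) (hr : r * r = r + algebraMap F Ω c) :
    Quat c d →ₐ[F] Matrix (Fin 2) (Fin 2) Ω :=
  quatLift (u := !![r, 0; 0, r + 1]) (v := !![0, algebraMap F Ω d; 1, 0])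
    (by
      have h2 := algebra_add_self F (Ω := Ω)
      ext i j
      fin_cases i <;> fin_cases j <;>
        simp [Matrix.mul_apply, Fin.sum_univ_two, Matrix.algebraMap_matrix_apply, hr]
      linear_combination hr + r * h2)
    (by
      ext i j
      fin_cases i <;> fin_cases j <;>
        simp [Matrix.mul_apply, Fin.sum_univ_two, Matrix.algebraMap_matrix_apply])
    (by
      have h2 := algebra_add_self F (Ω := Ω)
      ext i j
      fin_cases i <;> fin_cases j <;>
        simp [Matrix.mul_apply, Fin.sum_univ_two, Algebra.smul_def]
      linear_combination (- algebraMap F Ω d) * h2)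

/-- In characteristic two the trace of 1 is 0, that of `u` is `2r + 1 = 1`, and `v` and `uv` have
trace 0. This is why the reduced trace is the coefficient of `u`. -/
theorem trace_quatMatrix {c d : F} (r : Ω) (hr : r * r = r + algebraMap F Ω c) (x : Quat c d) :
    (quatMatrix r hr x).trace = algebraMap F Ω x.imI := by
  have h2 := algebra_add_self F (Ω := Ω)
  rw [quatMatrix, quatLift_apply]
  simp [Matrix.trace, Fin.sum_univ_two, Matrix.mul_apply, Matrix.algebraMap_matrix_apply,
    Algebra.smul_def]
  linear_combination (algebraMap F Ω x.re + algebraMap F Ω x.imI * r) * h2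

/-- The diagonal units are `u + r + 1` and `u + r`; multiplying them on the right by `v`, and the
first also by `d⁻¹`, gives the off-diagonal ones. -/
theorem exists_single_eq_sum {c d : F} (hd : d ≠ 0) (r : Ω) (hr : r * r = r + algebraMap F Ω c)
    (i j : Fin 2) : ∃ k : Fin 4 → Ω, Matrix.single i j 1 = ∑ l, k l •
      quatMatrix r hr (QuaternionAlgebra.basisOneIJK (-c) 1 d l) := by
  have h2 := algebra_add_self F (Ω := Ω)
  have hd' : algebraMap F Ω d ≠ 0 := by simpa using hd
  have h := QuaternionAlgebra.coe_basisOneIJK_repr (R := F) (-c) 1 d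
  have hb : ∀ l (y : Quat c d),
      ![y.re, y.imI, y.imJ, y.imK] = Pi.single l 1 →
      QuaternionAlgebra.basisOneIJK (-c) 1 d l = y := fun l y hy => by
    apply (QuaternionAlgebra.basisOneIJK (-c) 1 d).repr.injective
    rw [← h] at hy
    rw [Module.Basis.repr_self]
    ext k
    rw [hy]
    simp [Finsupp.single_apply, Pi.single_apply, eq_comm]
  have h0 := hb 0 ⟨1, 0, 0, 0⟩ (by ext k; fin_cases k <;> rfl)
  have h1 := hb 1 ⟨0, 1, 0, 0⟩ (by ext k; fin_cases k <;> rfl)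
  have h2' := hb 2 ⟨0, 0, 1, 0⟩ (by ext k; fin_cases k <;> rfl)
  have h3 := hb 3 ⟨0, 0, 0, 1⟩ (by ext k; fin_cases k <;> rfl)
  simp only [Fin.sum_univ_four, h0, h1, h2', h3, quatMatrix, quatLift_apply]
  fin_cases i <;> fin_cases j
  · refine ⟨![r + 1, 1, 0, 0], ?_⟩
    ext i j
    fin_cases i <;> fin_cases j <;> simp
    · linear_combination (-r) * h2
    · linear_combination (-r - 1) * h2
  · refine ⟨![0, 0, (algebraMap F Ω d)⁻¹ * (r + 1), (algebraMap F Ω d)⁻¹], ?_⟩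
    ext i j
    fin_cases i <;> fin_cases j <;> simp
    · field_simp
      linear_combination (-r) * h2
    · field_simp
      linear_combination (-r - 1) * h2
  · refine ⟨![0, 0, r, 1], ?_⟩
    ext i j
    fin_cases i <;> fin_cases j <;> simp
    · linear_combination (-r * algebraMap F Ω d) * h2
    · linear_combination (-r) * h2
  · refine ⟨![r, 1, 0, 0], ?_⟩
    ext i j
    fin_cases i <;> fin_cases j <;> simp
    · linear_combination (-r) * h2
    · linear_combination (-r) * h2

/-- The representation of the tensor product by Kronecker products of matrices. -/
def quatTensorMatrix (r : Fin n → Ω) (hr : ∀ i, r i * r i = r i + algebraMap F Ω (c i)) :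
    QuatTensor c d →ₐ[F] Matrix (Fin n → Fin 2) (Fin n → Fin 2) Ω :=
  PiTensorProduct.liftAlgHom (((kronecker Ω n).restrictScalars F).compLinearMap
    fun i => (quatMatrix (d := d i) (r i) (hr i)).toLinearMap)
    (by
      rw [← kronecker_one]
      simp only [MultilinearMap.compLinearMap_apply, Pi.one_apply, AlgHom.toLinearMap_apply,
        map_one]
      rfl)
    (fun x y => by
      simp only [MultilinearMap.compLinearMap_apply, Pi.mul_apply, AlgHom.toLinearMap_apply,
        map_mul]
      exact kronecker_mul Ω n _ _)

theorem quatTensorMatrix_tprod (r : Fin n → Ω)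
    (hr : ∀ i, r i * r i = r i + algebraMap F Ω (c i)) (x : ∀ i, Quat (c i) (d i)) :
    quatTensorMatrix r hr (PiTensorProduct.tprod F x) =
      kronecker Ω n fun i => quatMatrix (r i) (hr i) (x i) := by
  rw [quatTensorMatrix, PiTensorProduct.liftAlgHom_apply, PiTensorProduct.lift.tprod]
  rfl

theorem trace_quatTensorMatrix (r : Fin n → Ω)
    (hr : ∀ i, r i * r i = r i + algebraMap F Ω (c i)) (x : QuatTensor c d) :
    (quatTensorMatrix r hr x).trace = algebraMap F Ω (quatTensorTrace c d x) := by
  induction x using PiTensorProduct.induction_on with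
  | smul_tprod s x =>
    rw [map_smul, map_smul, Matrix.trace_smul, quatTensorMatrix_tprod, trace_kronecker,
      quatTensorTrace_tprod, smul_eq_mul, map_mul, Algebra.smul_def, map_prod]
    simp only [trace_quatMatrix]
  | add x y hx hy => rw [map_add, map_add, Matrix.trace_add, hx, hy, map_add]

theorem single_mem_span_quatTensorMatrix (hd : ∀ i, d i ≠ 0) (r : Fin n → Ω)
    (hr : ∀ i, r i * r i = r i + algebraMap F Ω (c i)) (s t : Fin n → Fin 2) :
    Matrix.single s t 1 ∈ Submodule.span Ω (Set.range (quatTensorMatrix (d := d) r hr)) := by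
  choose k hk using fun i => exists_single_eq_sum (hd i) (r i) (hr i) (s i) (t i)
  rw [← kronecker_single]
  simp only [hk]
  rw [MultilinearMap.map_sum]
  refine Submodule.sum_mem _ fun l _ => ?_
  rw [MultilinearMap.map_smul_univ]
  refine Submodule.smul_mem _ _ (Submodule.subset_span ⟨_, quatTensorMatrix_tprod r hr _⟩)

end Splitting

/-- Over an algebraically closed `Ω` each `X² + X + cᵢ` has a root. The Kronecker product of the
resulting representations reaches all matrix units, and the dimensions `4ⁿ` agree. -/
theorem isReducedTrace_quatTensorTrace (hd : ∀ i, d i ≠ 0) :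
    IsReducedTrace F (QuatTensor c d) (quatTensorTrace c d) := by
  intro Ω _ _ _
  have h : ∀ i, ∃ r : Ω, r * r = r + algebraMap F Ω (c i) := fun i => by
    obtain ⟨r, hr⟩ := IsAlgClosed.exists_root
      (Polynomial.X ^ 2 + Polynomial.X + Polynomial.C (algebraMap F Ω (c i)) : Polynomial Ω)
      (by
        rw [Polynomial.degree_eq_natDegree (etale_monic).ne_zero, etale_natDegree]
        decide)
    refine ⟨r, ?_⟩
    have h2 := algebra_add_self F (Ω := Ω)
    simp only [Polynomial.IsRoot, Polynomial.eval_add, Polynomial.eval_pow, Polynomial.eval_X,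
      Polynomial.eval_C] at hr
    linear_combination hr - (r + algebraMap F Ω (c i)) * h2
  choose r hr using h
  obtain ⟨m, e, he⟩ := exists_splitting (quatTensorMatrix (d := d) r hr) (finrank_quatTensor c d)
    (single_mem_span_quatTensorMatrix hd r hr)
  exact ⟨m, e, fun a => by rw [he, trace_quatTensorMatrix]⟩

end QuatTensor

/-! ### Centres -/

/-- An algebra with a reduced trace is central. -/
theorem IsReducedTrace.mem_center {F A : Type u} [Field F] [Ring A] [Nontrivial A] [Algebra F A]
    {T : A →ₗ[F] F} (hT : IsReducedTrace F A T) {x : A} (hx : ∀ y, Commute x y) :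
    ∃ r : F, x = algebraMap F A r := by
  let Ω := AlgebraicClosure F
  obtain ⟨n, e, -⟩ := hT Ω
  have hc : ∀ y : Ω ⊗[F] A, y * 1 ⊗ₜ x = 1 ⊗ₜ x * y := fun y => by
    induction y using TensorProduct.induction_on with
    | zero => simp
    | add y z hy hz => rw [add_mul, mul_add, hy, hz]
    | tmul w a => simp [(hx a).eq]
  have he : e (1 ⊗ₜ x) ∈ Subalgebra.center Ω (Matrix (Fin n) (Fin n) Ω) := by
    rw [Subalgebra.mem_center_iff]
    intro y
    obtain ⟨y, rfl⟩ := e.surjective y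
    rw [← map_mul, ← map_mul, hc]
  obtain ⟨w, hw⟩ := Algebra.IsCentral.out he
  have hw' : (w ⊗ₜ[F] (1 : A) : Ω ⊗[F] A) = 1 ⊗ₜ x := e.injective (by
    rw [← hw]
    exact e.commutes w)
  -- A linear form on `A` with value 1 at 1 shows that the scalar `w` in `w ⊗ 1 = 1 ⊗ x` comes from
  -- `F`.
  obtain ⟨f, hf⟩ := Module.Projective.exists_dual_eq_one F (one_ne_zero : (1 : A) ≠ 0)
  refine ⟨f x, ?_⟩
  have h := congrArg ((TensorProduct.rid F Ω).toLinearMap ∘ₗ TensorProduct.map LinearMap.id f) hw'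
  simp only [LinearMap.comp_apply, TensorProduct.map_tmul, LinearMap.id_apply, hf,
    LinearEquiv.coe_coe, TensorProduct.rid_tmul, one_smul] at h
  rw [h, ← TensorProduct.smul_tmul'] at hw'
  refine Algebra.TensorProduct.includeRight_injective
    (algebraMap F Ω).injective (B := A) (A := Ω) ?_
  simp only [Algebra.TensorProduct.includeRight_apply]
  rw [← hw', Algebra.algebraMap_eq_smul_one, TensorProduct.tmul_smul]

/-! ### Coefficients and linear forms on a scalar extension `K ⊗ A`. -/

section BaseChange

variable {F A K ι : Type*} [Field F] [Ring A] [Algebra F A] [CommRing K] [Algebra F K]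
  (b : Module.Basis ι F K)

/-- The coefficients in `A` of an element of `K ⊗ A` with respect to a basis of `K`. -/
def tensorCoeff (i : ι) : K ⊗[F] A →ₗ[F] A :=
  (TensorProduct.lid F A).toLinearMap ∘ₗ TensorProduct.map (b.coord i) LinearMap.id

theorem tensorCoeff_tmul (i : ι) (k : K) (a : A) :
    tensorCoeff b i (k ⊗ₜ a) = b.repr k i • a := rfl

theorem sum_tensorCoeff [Fintype ι] (t : K ⊗[F] A) : ∑ i, b i ⊗ₜ[F] tensorCoeff b i t = t := by
  induction t using TensorProduct.induction_on with
  | zero => simp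
  | add x y hx hy => simp only [map_add, TensorProduct.tmul_add, Finset.sum_add_distrib, hx, hy]
  | tmul k a =>
    simp only [tensorCoeff_tmul, ← TensorProduct.smul_tmul]
    rw [← TensorProduct.sum_tmul, b.sum_repr]

theorem commute_tensorCoeff {t : K ⊗[F] A} {a : A} (h : Commute t (1 ⊗ₜ a)) (i : ι) :
    Commute (tensorCoeff b i t) a := by
  have h1 : ∀ t : K ⊗[F] A, tensorCoeff b i (t * 1 ⊗ₜ a) = tensorCoeff b i t * a := fun t => by
    induction t using TensorProduct.induction_on with
    | zero => simp
    | add x y hx hy => rw [add_mul, map_add, hx, hy, map_add, add_mul]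
    | tmul k x => simp [tensorCoeff_tmul]
  have h2 : ∀ t : K ⊗[F] A, tensorCoeff b i (1 ⊗ₜ a * t) = a * tensorCoeff b i t := fun t => by
    induction t using TensorProduct.induction_on with
    | zero => simp
    | add x y hx hy => rw [mul_add, map_add, hx, hy, map_add, mul_add]
    | tmul k x => simp [tensorCoeff_tmul]
  rw [commute_iff_eq, ← h1, ← h2, h.eq]

theorem tensorCoeff_baseChange (σ : AlgInvolution F A) (i : ι) (t : K ⊗[F] A) :
    tensorCoeff b i (σ.baseChange K t) = σ (tensorCoeff b i t) := by
  induction t using TensorProduct.induction_on with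
  | zero => simp
  | add x y hx hy => rw [map_add, map_add, hx, hy, map_add, map_add]
  | tmul k a =>
    rw [tensorCoeff_tmul, map_smul]
    rfl

end BaseChange

section BaseChange

variable {F A K : Type u} [Field F] [Ring A] [Algebra F A] [CommRing K] [Algebra F K]

/-- The centre of `K ⊗ A` is `K` if `A` has a reduced trace. -/
theorem IsReducedTrace.mem_center_tensor [Nontrivial A] [FiniteDimensional F K] {T : A →ₗ[F] F}
    (hT : IsReducedTrace F A T) {t : K ⊗[F] A} (ht : ∀ y, Commute t y) :
    ∃ k : K, t = algebraMap K (K ⊗[F] A) k := by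
  let b := Module.finBasis F K
  choose r hr using fun i => hT.mem_center fun y => commute_tensorCoeff b (ht (1 ⊗ₜ y)) i
  refine ⟨∑ i, r i • b i, ?_⟩
  rw [← sum_tensorCoeff b t, map_sum]
  refine Finset.sum_congr rfl fun i _ => ?_
  rw [hr, Algebra.algebraMap_eq_smul_one, ← TensorProduct.smul_tmul]
  rfl

/-- A symmetric `t` has symmetric coefficients in any basis of `K`, so it is a sum of tensors `k ⊗
s` with `s` symmetric, on which both sides are known. This frees `extendScalars` from its arbitrary
choice of an extension. -/
theorem extendScalars_apply [FiniteDimensional F K] (σ : AlgInvolution F A) (f : σ.sym →ₗ[F] F)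
    (D : K ⊗[F] A →ₗ[F] K) (h : ∀ (k : K) (s : σ.sym), D (k ⊗ₜ (s : A)) = f s • k)
    (t : (σ.baseChange K).sym) : extendScalars K σ f t = D t := by
  let b := Module.finBasis F K
  have hs : ∀ i, tensorCoeff b i (t : K ⊗[F] A) ∈ σ.sym := fun i => by
    rw [AlgInvolution.mem_sym, ← tensorCoeff_baseChange, AlgInvolution.mem_sym.1 t.2]
  have ht : t = ∑ i, ⟨b i ⊗ₜ[F] tensorCoeff b i (t : K ⊗[F] A),
      tmul_mem_sym K σ (b i) ⟨_, hs i⟩⟩ := by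
    ext
    rw [Submodule.coe_sum]
    exact (sum_tensorCoeff b _).symm
  have hD : D t = ∑ i, D (b i ⊗ₜ[F] tensorCoeff b i (t : K ⊗[F] A)) := by
    rw [← map_sum, sum_tensorCoeff]
  rw [hD]
  conv_lhs => rw [ht]
  rw [map_sum]
  exact Finset.sum_congr rfl fun i _ =>
    (extendScalars_tmul K σ f (b i) ⟨_, hs i⟩).trans (h _ ⟨_, hs i⟩).symm

variable (K) in
/-- The `K`-linear extension of a linear form. -/
def extendForm (T : A →ₗ[F] F) : K ⊗[F] A →ₗ[K] K :=
  (TensorProduct.AlgebraTensorModule.rid F K K).toLinearMap ∘ₗ T.baseChange K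

theorem extendForm_tmul (T : A →ₗ[F] F) (k : K) (a : A) :
    extendForm K T (k ⊗ₜ a) = T a • k := by
  simp [extendForm]

theorem extendForm_baseChange {T : A →ₗ[F] F} {σ : AlgInvolution F A} (h : ∀ x, T (σ x) = T x)
    (t : K ⊗[F] A) : extendForm K T (σ.baseChange K t) = extendForm K T t := by
  induction t using TensorProduct.induction_on with
  | zero => simp
  | add x y hx hy => rw [map_add, map_add, hx, hy, map_add]
  | tmul k a =>
    refine (extendForm_tmul T k (σ a)).trans ?_
    rw [h, extendForm_tmul]

theorem IsReducedTrace.extendForm {T : A →ₗ[F] F} (hT : IsReducedTrace F A T) :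
    IsReducedTrace K (K ⊗[F] A) (extendForm K T) :=
  hT.baseChange K fun a => by
    rw [extendForm_tmul, Algebra.algebraMap_eq_smul_one]

end BaseChange

/-! ### The semi-trace of a tensor product of quaternion algebras -/

section TensorSemitrace

variable {F : Type u} [Field F] [CharP F 2]

/-- The basis `u, 1 + u, v, uv` of `[c, d)`, which the canonical involution permutes. -/
def quatBasis (c d : F) : Module.Basis (Fin 4) F (Quat c d) :=
  Module.Basis.ofEquivFun
    { toFun x := ![x.re + x.imI, x.re, x.imJ, x.imK]
      invFun y := ⟨y 1, y 0 + y 1, y 2, y 3⟩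
      map_add' x y := by
        ext i
        fin_cases i
        · exact add_add_add_comm _ _ _ _
        all_goals rfl
      map_smul' r x := by
        ext i
        fin_cases i
        · exact (mul_add _ _ _).symm
        all_goals rfl
      left_inv x := by
        ext
        · rfl
        · change x.re + x.imI + x.re = x.imI
          rw [add_right_comm, CharTwo.add_self_eq_zero, zero_add]
        all_goals rfl
      right_inv y := by
        ext i
        fin_cases i
        · change y 1 + (y 0 + y 1) = y 0
          rw [add_left_comm, CharTwo.add_self_eq_zero, add_zero]
        all_goals rfl }

theorem quatInvolution_quatBasis (c d : F) (i : Fin 4) :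
    quatInvolution c d (quatBasis c d i) = quatBasis c d (Equiv.swap 0 1 i) := by
  simp only [quatBasis, Module.Basis.coe_ofEquivFun]
  change star _ = _
  have h2 : Equiv.swap 0 1 (2 : Fin 4) = 2 := by decide
  have h3 : Equiv.swap 0 1 (3 : Fin 4) = 3 := by decide
  fin_cases i <;> ext <;> simp [h2, h3, CharTwo.neg_eq, CharTwo.add_self_eq_zero]

omit [CharP F 2] in
theorem imI_eq_zero_of_mem_sym {c d : F} {x : Quat c d} (hx : x ∈ (quatInvolution c d).sym) :
    x.imI = 0 := by
  have h : star x = x := hx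
  simpa using congrArg QuaternionAlgebra.re h

theorem imI_quatInvolution {c d : F} (x : Quat c d) : (quatInvolution c d x).imI = x.imI := by
  change (star x).imI = _
  simp [CharTwo.neg_eq]

variable {n : ℕ} (c d : Fin n → F)

theorem quatTensorTrace_involution (x : QuatTensor c d) :
    quatTensorTrace c d (quatTensorInvolution c d x) = quatTensorTrace c d x := by
  induction x using PiTensorProduct.induction_on with
  | add x y hx hy => rw [map_add, map_add, hx, hy, map_add]
  | smul_tprod r x =>
    rw [map_smul, map_smul, map_smul]
    congr 1
    refine (congrArg _ (PiTensorProduct.map_tprod _ _)).trans ?_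
    rw [quatTensorTrace_tprod, quatTensorTrace_tprod]
    exact Finset.prod_congr rfl fun i _ => imI_quatInvolution _

/-- A linear map vanishing on the alternating elements and on the tensors of symmetric elements
vanishes on the symmetric elements. -/
theorem map_eq_zero_of_symTensors {N : Type*} [AddCommGroup N] [Module F N]
    (D : QuatTensor c d →ₗ[F] N) (h1 : ∀ x, D (x + quatTensorInvolution c d x) = 0)
    (h2 : ∀ s ∈ symTensors (fun i => quatInvolution (c i) (d i)), D s = 0)
    {x : QuatTensor c d} (hx : quatTensorInvolution c d x = x) : D x = 0 := by
  let b := Basis.piTensorProduct fun i => quatBasis (c i) (d i)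
  let π : (Fin n → Fin 4) → (Fin n → Fin 4) := fun k i => Equiv.swap 0 1 (k i)
  have hb : ∀ k, b k = PiTensorProduct.tprod F fun i => quatBasis (c i) (d i) (k i) := fun k =>
    Basis.piTensorProduct_apply _ _
  have hπ : Function.Involutive π := fun k => funext fun i => Equiv.swap_apply_self 0 1 (k i)
  have hσ : ∀ k, quatTensorInvolution c d (b k) = b (π k) := fun k => by
    rw [hb, hb]
    refine (PiTensorProduct.map_tprod _ _).trans (congrArg _ (funext fun i => ?_))
    exact quatInvolution_quatBasis _ _ _
  refine map_eq_zero_of_repr_invariant b π hπ D (fun k => ?_) (fun k hk => ?_)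
    (repr_invariant_of_fixed b π hπ _ hσ hx)
  · rw [← map_add, ← hσ, h1]
  -- A basis tensor fixed by `π` has all its factors fixed by the canonical involutions; it is a
  -- tensor of symmetric elements.
  · refine h2 _ (Submodule.subset_span ⟨_, fun i => ?_, hb k⟩)
    have := quatInvolution_quatBasis (c i) (d i) (k i)
    rwa [show Equiv.swap 0 1 (k i) = k i from congrFun hk i] at this

variable {c d}

/-- The difference of two such semi-traces kills all `x + σ x`, the reduced trace being unique, and
all tensors of symmetric elements; these exhaust the symmetric elements. -/
theorem IsTensorSemitrace.unique
    {g g' : (quatTensorInvolution c d).sym →ₗ[F] F}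
    (hg : IsTensorSemitrace (fun i => quatInvolution (c i) (d i)) g)
    (hg' : IsTensorSemitrace (fun i => quatInvolution (c i) (d i)) g') : g = g' := by
  obtain ⟨⟨T, hT, h1⟩, h2⟩ := hg
  obtain ⟨⟨T', hT', h1'⟩, h2'⟩ := hg'
  obtain rfl := hT.unique hT'
  obtain ⟨D, hD⟩ := (g - g').exists_extend
  have hD' : ∀ s : (quatTensorInvolution c d).sym, D s = g s - g' s := fun s =>
    LinearMap.congr_fun hD s
  ext s
  rw [← sub_eq_zero, ← hD']
  refine map_eq_zero_of_symTensors c d D (fun x => ?_) (fun t ht => ?_) s.2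
  · rw [hD' ⟨_, AlgInvolution.add_mem_sym _ x⟩, h1, h1', sub_self]
  · have hts : t ∈ (quatTensorInvolution c d).sym := by
      refine Submodule.span_le.2 ?_ ht
      rintro _ ⟨x, hx, rfl⟩
      exact (PiTensorProduct.map_tprod _ _).trans (congrArg _ (funext fun i => hx i))
    rw [hD' ⟨t, hts⟩, h2 ⟨t, hts⟩ ht, h2' ⟨t, hts⟩ ht, sub_self]

/-- The canonical semi-trace is `s ↦ Trd (u s)`, where `u` is the generator of one of the
quaternion algebras. -/
theorem isTensorSemitrace_mul (hd : ∀ i, d i ≠ 0) {i j : Fin n} (hij : j ≠ i) :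
    IsTensorSemitrace (fun i => quatInvolution (c i) (d i))
      (quatTensorTrace c d ∘ₗ
        Algebra.lmul F (QuatTensor c d) (quatSlot c d i (quatU (c i) (d i))) ∘ₗ
        (quatTensorInvolution c d).sym.subtype) := by
  have hT := isReducedTrace_quatTensorTrace (c := c) hd
  set U := quatSlot c d i (quatU (c i) (d i)) with hU
  have hσ : quatTensorInvolution c d U = U + 1 := by
    rw [hU, piTensor_single, quatInvolution_u, map_add, map_one]
  refine ⟨⟨_, hT, fun x => ?_⟩, fun s hs => ?_⟩
  · change quatTensorTrace c d (U * (x + quatTensorInvolution c d x)) = _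
    -- `Trd(U σ(x)) = Trd(x σ(U)) = Trd(xU) + Trd(x)`, since `Trd` is invariant under `σ` and `σ(U)
    -- = U + 1`.
    rw [mul_add, map_add, ← quatTensorTrace_involution c d (U * quatTensorInvolution c d x),
      AlgInvolution.map_mul', AlgInvolution.apply_apply, hσ, hT.mul_comm U x, ← map_add, mul_add,
      mul_one, ← add_assoc, add_self_eq_zero_of_charTwo F, zero_add]
  · suffices h : symTensors (fun i => quatInvolution (c i) (d i)) ≤
        LinearMap.ker (quatTensorTrace c d ∘ₗ Algebra.lmul F (QuatTensor c d) U) from h hs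
    refine Submodule.span_le.2 ?_
    rintro _ ⟨x, hx, rfl⟩
    change quatTensorTrace c d (U * PiTensorProduct.tprod F x) = 0
    rw [hU, PiTensorProduct.singleAlgHom_apply, PiTensorProduct.tprod_mul_tprod,
      quatTensorTrace_tprod]
    -- Multiplication by `U` leaves the factor with index `j ≠ i` untouched, and a symmetric
    -- quaternion has trace zero.
    refine Finset.prod_eq_zero (Finset.mem_univ j) ?_
    rw [Pi.mul_apply, MonoidHom.mulSingle_apply, Pi.mulSingle_eq_of_ne hij, one_mul,
      imI_eq_zero_of_mem_sym (hx j)]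

end TensorSemitrace

/-! ### The algebra presented by generators -/

section QuatSlot

variable {F : Type u} [Field F] {n : ℕ} (c d : Fin n → F)

theorem commute_quatSlot {i j : Fin n} (hij : i ≠ j) (x : Quat (c i) (d i))
    (y : Quat (c j) (d j)) : Commute (quatSlot c d i x) (quatSlot c d j y) :=
  commute_single (A := fun i => Quat (c i) (d i)) hij x y

theorem quatTensorInvolution_quatSlot (i : Fin n) (x : Quat (c i) (d i)) :
    quatTensorInvolution c d (quatSlot c d i x) = quatSlot c d i (quatInvolution _ _ x) :=
  piTensor_single (A := fun i => Quat (c i) (d i)) (fun i => quatInvolution (c i) (d i)) i x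

end QuatSlot

section Model

variable {F : Type u} [Field F] {n : ℕ} (a b : Fin (n + 1) → F)

/-- The algebra `K ⊗ Q₁ ⊗ ⋯ ⊗ Q_{m-1}`. -/
def Model : Type u :=
  EtaleExt (∑ i, a i * b i) ⊗[F] QuatTensor (fun i : Fin n => a i.castSucc * b i.castSucc)
    fun i => a i.castSucc * a (Fin.last n)

instance : Ring (Model a b) :=
  inferInstanceAs (Ring (EtaleExt (∑ i, a i * b i) ⊗[F] QuatTensor
    (fun i : Fin n => a i.castSucc * b i.castSucc) fun i => a i.castSucc * a (Fin.last n)))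

instance : Algebra F (Model a b) :=
  inferInstanceAs (Algebra F (EtaleExt (∑ i, a i * b i) ⊗[F] QuatTensor
    (fun i : Fin n => a i.castSucc * b i.castSucc) fun i => a i.castSucc * a (Fin.last n)))

/-- The embedding of `K` in `K ⊗ Q₁ ⊗ ⋯ ⊗ Q_{m-1}`. -/
def modelCentre : EtaleExt (∑ i, a i * b i) →ₐ[F] Model a b :=
  Algebra.TensorProduct.includeLeft

/-- The embedding of `Qᵢ` in `K ⊗ Q₁ ⊗ ⋯ ⊗ Q_{m-1}`. -/
def modelSlot (i : Fin n) :
    Quat (a i.castSucc * b i.castSucc) (a i.castSucc * a (Fin.last n)) →ₐ[F] Model a b :=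
  Algebra.TensorProduct.includeRight.comp
    (quatSlot (fun i : Fin n => a i.castSucc * b i.castSucc)
      (fun i => a i.castSucc * a (Fin.last n)) i)

theorem commute_modelSlot {i j : Fin n} (hij : i ≠ j)
    (x : Quat (a i.castSucc * b i.castSucc) (a i.castSucc * a (Fin.last n)))
    (y : Quat (a j.castSucc * b j.castSucc) (a j.castSucc * a (Fin.last n))) :
    Commute (modelSlot a b i x) (modelSlot a b j y) :=
  (commute_quatSlot (fun i : Fin n => a i.castSucc * b i.castSucc)
    (fun i => a i.castSucc * a (Fin.last n)) hij x y).map Algebra.TensorProduct.includeRight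

theorem commute_modelCentre_modelSlot (k : EtaleExt (∑ i, a i * b i)) (i : Fin n)
    (x : Quat (a i.castSucc * b i.castSucc) (a i.castSucc * a (Fin.last n))) :
    Commute (modelCentre a b k) (modelSlot a b i x) := by
  refine (Algebra.TensorProduct.tmul_mul_tmul _ _ _ _).trans
    (Eq.trans ?_ (Algebra.TensorProduct.tmul_mul_tmul _ _ _ _).symm)
  rw [mul_one, one_mul, mul_one, one_mul]

/-- The involution of `K ⊗ Q₁ ⊗ ⋯ ⊗ Q_{m-1}`. -/
def modelInvolution : AlgInvolution F (Model a b) :=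
  (quatTensorInvolution (fun i : Fin n => a i.castSucc * b i.castSucc)
    fun i => a i.castSucc * a (Fin.last n)).baseChange (EtaleExt (∑ i, a i * b i))

theorem modelInvolution_modelSlot (i : Fin n)
    (x : Quat (a i.castSucc * b i.castSucc) (a i.castSucc * a (Fin.last n))) :
    modelInvolution a b (modelSlot a b i x) = modelSlot a b i (quatInvolution _ _ x) := by
  refine (TensorProduct.map_tmul _ _ _ _).trans ?_
  exact congrArg (TensorProduct.tmul F 1)
    (quatTensorInvolution_quatSlot (fun i : Fin n => a i.castSucc * b i.castSucc)
      (fun i => a i.castSucc * a (Fin.last n)) i x)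

theorem modelInvolution_modelCentre (k : EtaleExt (∑ i, a i * b i)) :
    modelInvolution a b (modelCentre a b k) = modelCentre a b k := by
  refine (TensorProduct.map_tmul _ _ _ _).trans ?_
  exact congrArg (TensorProduct.tmul F k) (AlgInvolution.map_one' _)

variable [CharP F 2]

/-- The standard generators of `K ⊗ Q₁ ⊗ ⋯ ⊗ Q_{m-1}`. -/
@[simps]
def modelGenerators : Generators a b (Model a b) where
  u i := modelSlot a b i (quatU _ _)
  v i := modelSlot a b i (quatV _ _)
  z := modelCentre a b (etaleRoot _)
  u_mul_u i := by rw [← map_mul, quatU_mul_self, map_add, AlgHom.commutes]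
  v_mul_v i := by rw [← map_mul, quatV_mul_self, AlgHom.commutes]
  u_mul_v i := by rw [← map_mul, quatU_mul_quatV, map_add, map_mul]
  commute_u_u i j := by
    by_cases h : i = j
    · subst h; exact Commute.refl _
    · exact commute_modelSlot a b h _ _
  commute_v_v i j := by
    by_cases h : i = j
    · subst h; exact Commute.refl _
    · exact commute_modelSlot a b h _ _
  commute_u_v i j h := commute_modelSlot a b h _ _
  commute_z_u i := commute_modelCentre_modelSlot a b _ _ _
  commute_z_v i := commute_modelCentre_modelSlot a b _ _ _
  z_mul_z := by
    have h := (add_eq_zero_iff_of_charTwo F).1 ((add_assoc _ _ _).symm.trans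
      (etaleRoot_mul_self (d := ∑ i, a i * b i)))
    rw [← map_mul, h, map_add, AlgHom.commutes]

variable {a b} {C : Type*} [Ring C] [Algebra F C]

/-- The homomorphism determined by the images of the generators. -/
def Generators.lift (G : Generators a b C) : Model a b →ₐ[F] C :=
  Algebra.TensorProduct.lift
    (etaleLift G.z (by
      rw [add_assoc, add_eq_zero_iff_of_charTwo F]
      exact G.z_mul_z))
    (liftCommuting (fun i => quatLift (G.u_mul_u i) (G.v_mul_v i) (G.u_mul_v i))
      fun i j hij x y => commute_quatLift _ _ _
        (commute_quatLift _ _ _ (G.commute_u_u j i) (G.commute_u_v i j hij).symm y).symm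
        (commute_quatLift _ _ _ (G.commute_u_v j i hij.symm) (G.commute_v_v j i) y).symm x)
    fun k x => by
      induction x using PiTensorProduct.induction_on with
      | add x y hx hy => rw [map_add]; exact hx.add_right hy
      | smul_tprod r x =>
        rw [map_smul, liftCommuting_tprod]
        refine (Commute.list_prod_right _ _ fun y hy => ?_).smul_right r
        obtain ⟨i, rfl⟩ := List.mem_ofFn.1 hy
        exact commute_etaleLift _ _
          (commute_quatLift _ _ _ (G.commute_z_u i).symm (G.commute_z_v i).symm _).symm _

theorem Generators.lift_modelSlot (G : Generators a b C) (i : Fin n)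
    (x : Quat (a i.castSucc * b i.castSucc) (a i.castSucc * a (Fin.last n))) :
    G.lift (modelSlot a b i x) = quatLift (G.u_mul_u i) (G.v_mul_v i) (G.u_mul_v i) x := by
  refine (Algebra.TensorProduct.lift_tmul _ _ _ _ _).trans ?_
  rw [map_one, one_mul]
  exact liftCommuting_single
    (A := fun i : Fin n => Quat (a i.castSucc * b i.castSucc) (a i.castSucc * a (Fin.last n)))
    _ _ i x

theorem Generators.map_lift (G : Generators a b C) : (modelGenerators a b).map G.lift = G := by
  ext
  · rw [map_u, modelGenerators_u, lift_modelSlot, quatLift_u]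
  · rw [map_v, modelGenerators_v, lift_modelSlot, quatLift_v]
  · rw [map_z, modelGenerators_z]
    refine (Algebra.TensorProduct.lift_tmul _ _ _ _ _).trans ?_
    rw [map_one, mul_one, etaleLift_root]

theorem Model.algHom_ext {f g : Model a b →ₐ[F] C}
    (h : (modelGenerators a b).map f = (modelGenerators a b).map g) : f = g := by
  refine Algebra.TensorProduct.ext ?_ ?_
  · refine AdjoinRoot.algHom_ext ?_
    exact congrArg Generators.z h
  · refine PiTensorProduct.algHom_ext fun i => ?_
    refine QuaternionAlgebra.hom_ext ?_ ?_
    · exact congrFun (congrArg Generators.u h) i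
    · exact congrFun (congrArg Generators.v h) i

end Model

/-! ### Involutions on generators -/

/-- Such a `τ` fixes `gᵢ = aᵢ⁻¹ vᵢuᵢ`, because `τ(vu) = (u + 1)v = vu`. Only the parameter `t`, the
image of `f_m`, can move. -/
theorem Generators.involution_lin {F : Type*} [Field F] [CharP F 2] {n : ℕ}
    {a b : Fin (n + 1) → F} {C : Type*} [Ring C] [Algebra F C] (G : Generators a b C)
    (τ : AlgInvolution F C) (hu : ∀ i, τ (G.u i) = G.u i + 1) (hv : ∀ i, τ (G.v i) = G.v i)
    {V : Type*} [AddCommGroup V] [Module F V]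
    (E : Module.Basis (Fin (n + 1) ⊕ Fin (n + 1)) F V) (t : C) (x : V) :
    τ (G.lin E t x) = G.lin E (τ t) x := by
  suffices τ.toLinearMap ∘ₗ G.lin E t = G.lin E (τ t) from LinearMap.congr_fun this x
  have h1 : ∀ r, τ (algebraMap F C r) = algebraMap F C r := fun r => by
    rw [Algebra.algebraMap_eq_smul_one, map_smul, τ.map_one']
  have hg : ∀ i, τ (G.g i) = G.g i := fun i => by
    rw [g, map_smul, τ.map_mul', hu, hv, add_mul, one_mul, G.u_mul_v, add_assoc,
      add_self_eq_zero_of_charTwo F, add_zero]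
  refine E.ext fun p => ?_
  rw [LinearMap.comp_apply, lin_basis, lin_basis]
  rcases p with i | i <;> induction i using Fin.lastCases <;> simp [h1, hg, hv]

/-- The `n` summands `uᵢ` each contribute 1, and `n` is odd. This is where the evenness of `m`
enters; it makes `τ` exchange `x e_m` and `e_m x`. -/
theorem Generators.involution_w {F : Type*} [Field F] [CharP F 2] {n : ℕ}
    {a b : Fin (n + 1) → F} {C : Type*} [Ring C] [Algebra F C] (G : Generators a b C)
    (τ : AlgInvolution F C) (hu : ∀ i, τ (G.u i) = G.u i + 1) (hz : τ G.z = G.z)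
    (hn : Even (n + 1)) : τ G.w = G.w + 1 := by
  obtain ⟨k, hk⟩ := hn
  have h : (n : C) = 1 := by
    rw [← add_eq_zero_iff_of_charTwo F, ← Nat.cast_succ, Nat.succ_eq_add_one, hk, Nat.cast_add,
      add_self_eq_zero_of_charTwo F]
  rw [w, map_add, map_sum, hz]
  simp only [hu, Finset.sum_add_distrib, Finset.sum_const, Finset.card_univ, Fintype.card_fin,
    nsmul_eq_mul, mul_one, h, add_assoc]

/-! ### The structure of the Clifford algebra -/

section CliffEquiv

variable {F V : Type u} [Field F] [CharP F 2] [AddCommGroup V] [Module F V]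
  [FiniteDimensional F V] {q : QuadraticForm F V}
  (hq : LinearMap.BilinForm.Nondegenerate q.polarBilin) {n : ℕ} {a b : Fin (n + 1) → F}
  {E : Module.Basis (Fin (n + 1) ⊕ Fin (n + 1)) F V} (hE : IsAdapted q a b E)

theorem cliffGenerators_w :
    (cliffGenerators hq hE).w =
      cliffPair q hq (E (.inl (Fin.last n))) (E (.inr (Fin.last n))) := by
  change ∑ i, cliffPair q hq (E (.inl i)) (E (.inr i)) +
    ∑ i : Fin n, cliffPair q hq (E (.inl i.castSucc)) (E (.inr i.castSucc)) = _
  rw [Fin.sum_univ_castSucc, add_right_comm, add_self_eq_zero_of_charTwo F, zero_add]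

variable (ha : ∀ i, a i ≠ 0)
include ha

theorem cliffGenerators_g (i : Fin n) :
    (cliffGenerators hq hE).g i =
      cliffPair q hq (E (.inl (Fin.last n))) (E (.inr i.castSucc)) := by
  change (a i.castSucc)⁻¹ • (cliffPair q hq (E (.inl i.castSucc)) (E (.inl (Fin.last n))) *
    cliffPair q hq (E (.inl i.castSucc)) (E (.inr i.castSucc))) = _
  rw [cliffPair_comm q hq (hE.polar_inl_inl i.castSucc (Fin.last n)), cliffPair_mul, hE.map_inl,
    inv_smul_smul₀ (ha _)]

/-- In the Clifford algebra the formal family is the actual product `e_m x`; with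
`cliffGenerators_lin_right` for `x e_m`, this justifies the formula behind `Generators.evenHom`. -/
theorem cliffGenerators_lin_left (x : V) :
    (cliffGenerators hq hE).lin E (cliffGenerators hq hE).w x =
      cliffPair q hq (E (.inl (Fin.last n))) x := by
  suffices (cliffGenerators hq hE).lin E (cliffGenerators hq hE).w =
    (cliffEvenHom q hq).bilin (E (.inl (Fin.last n))) from LinearMap.congr_fun this x
  refine E.ext fun p => (Generators.lin_basis _ _ _ p).trans ?_
  change _ = cliffPair q hq (E (.inl (Fin.last n))) (E p)
  rcases p with i | i <;> induction i using Fin.lastCases with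
  | last => ?_
  | cast i => ?_
  · rw [Generators.fam_inl_last, cliffPair_self, hE.map_inl]
  · rw [Generators.fam_inl_castSucc, cliffPair_comm q hq (hE.polar_inl_inl (Fin.last n) _)]
    rfl
  · rw [Generators.fam_inr_last, cliffGenerators_w]
  · rw [Generators.fam_inr_castSucc, cliffGenerators_g hq hE ha]

theorem cliffGenerators_lin_right (x : V) :
    (cliffGenerators hq hE).lin E ((cliffGenerators hq hE).w + 1) x =
      cliffPair q hq x (E (.inl (Fin.last n))) := by
  suffices (cliffGenerators hq hE).lin E ((cliffGenerators hq hE).w + 1) =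
    (cliffEvenHom q hq).bilin.flip (E (.inl (Fin.last n))) from LinearMap.congr_fun this x
  refine E.ext fun p => (Generators.lin_basis _ _ _ p).trans ?_
  change _ = cliffPair q hq (E p) (E (.inl (Fin.last n)))
  rcases p with i | i <;> induction i using Fin.lastCases with
  | last => ?_
  | cast i => ?_
  · rw [Generators.fam_inl_last, cliffPair_self, hE.map_inl]
  · rw [Generators.fam_inl_castSucc]
    rfl
  · rw [Generators.fam_inr_last, cliffGenerators_w,
      cliffPair_swap q hq ((hE.polar_inl_inr _ _).trans (if_pos rfl)), add_comm]
  · rw [Generators.fam_inr_castSucc, cliffGenerators_g hq hE ha,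
      cliffPair_comm q hq ((hE.polar_inl_inr _ _).trans (if_neg (Fin.castSucc_lt_last i).ne'))]

/-- The homomorphism from the Clifford algebra to `K ⊗ Q₁ ⊗ ⋯ ⊗ Q_{m-1}`. -/
def cliffHom : Cliff (adjInvolution q hq) (adjSemitrace q hq) →ₐ[F] Model a b :=
  cliffLift q hq ((modelGenerators a b).evenHom hE ha)

theorem cliffGenerators_map_cliffHom :
    (cliffGenerators hq hE).map (cliffHom hq hE ha) = modelGenerators a b := by
  ext
  · exact (cliffLift_cliffPair q hq _ _ _).trans (Generators.evenHom_inl_inr hE ha _ _)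
  · exact (cliffLift_cliffPair q hq _ _ _).trans (Generators.evenHom_inl_last hE ha _ _)
  · rw [Generators.map_z]
    change cliffHom hq hE ha (∑ i, cliffPair q hq (E (.inl i)) (E (.inr i))) = _
    rw [map_sum]
    simp only [cliffHom, cliffLift_cliffPair]
    rw [Fin.sum_univ_castSucc, Generators.evenHom_last_last]
    simp only [Generators.evenHom_inl_inr]
    -- The image of `e_m f_m` is `w = z + ∑ uᵢ`, so adding the images `uᵢ` of the other `eᵢfᵢ`
    -- leaves `z`.
    rw [Generators.w, add_left_comm, add_self_eq_zero_of_charTwo F, add_zero]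

theorem lift_cliffHom (x : Cliff (adjInvolution q hq) (adjSemitrace q hq)) :
    (cliffGenerators hq hE).lift (cliffHom hq hE ha x) = x := by
  induction x using cliffMap_induction with
  | hr r => rw [AlgHom.commutes, AlgHom.commutes]
  | hm x y hx hy => rw [map_mul, map_mul, hx, hy]
  | ha x y hx hy => rw [map_add, map_add, hx, hy]
  | hc x y =>
    -- The image of `xy` returns as `a_m⁻¹ (x e_m)(e_m y)`, which is `xy` since `q(e_m) = a_m`.
    rw [cliffHom, cliffLift_cliffPair, Generators.evenHom_apply, map_smul, map_mul,
      Generators.map_lin, Generators.map_lin, map_add, map_one, ← Generators.map_w,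
      Generators.map_lift, cliffGenerators_lin_left hq hE ha, cliffGenerators_lin_right hq hE ha,
      cliffPair_mul, hE.map_inl, inv_smul_smul₀ (ha _)]

/-- The isomorphism from the Clifford algebra to `K ⊗ Q₁ ⊗ ⋯ ⊗ Q_{m-1}`. -/
def cliffEquiv : Cliff (adjInvolution q hq) (adjSemitrace q hq) ≃ₐ[F] Model a b :=
  AlgEquiv.ofAlgHom (cliffHom hq hE ha) (cliffGenerators hq hE).lift
    (Model.algHom_ext (by
      have h : ((modelGenerators a b).map (cliffGenerators hq hE).lift).map (cliffHom hq hE ha) =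
          modelGenerators a b := by
        rw [Generators.map_lift, cliffGenerators_map_cliffHom]
      exact h))
    (AlgHom.ext (lift_cliffHom hq hE ha))

theorem cliffEquiv_cliffPair (x y : V) :
    cliffEquiv hq hE ha (cliffPair q hq x y) = ((modelGenerators a b).evenHom hE ha).bilin x y :=
  cliffLift_cliffPair q hq _ x y

theorem cliffEquiv_involution (hn : Even (n + 1))
    (x : Cliff (adjInvolution q hq) (adjSemitrace q hq)) :
    cliffEquiv hq hE ha (cliffInvolution _ _ x) = modelInvolution a b (cliffEquiv hq hE ha x) := by
  have h1 : ∀ r, modelInvolution a b (algebraMap F _ r) = algebraMap F _ r := fun r => by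
    rw [Algebra.algebraMap_eq_smul_one, map_smul, AlgInvolution.map_one']
  have h2 : ∀ r, cliffInvolution (adjInvolution q hq) (adjSemitrace q hq) (algebraMap F _ r) =
      algebraMap F _ r := fun r => by
    rw [Algebra.algebraMap_eq_smul_one, map_smul, AlgInvolution.map_one']
  have hu : ∀ i, modelInvolution a b ((modelGenerators a b).u i) =
      (modelGenerators a b).u i + 1 := fun i => by
    rw [modelGenerators_u, modelInvolution_modelSlot, quatInvolution_u, map_add, map_one]
  have hv : ∀ i, modelInvolution a b ((modelGenerators a b).v i) =
      (modelGenerators a b).v i := fun i => by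
    rw [modelGenerators_v, modelInvolution_modelSlot, quatInvolution_v]
  have hw := (modelGenerators a b).involution_w _ hu (modelInvolution_modelCentre a b _) hn
  induction x using cliffMap_induction with
  | hr r => rw [h2, AlgEquiv.commutes, h1]
  | hm x y hx hy => rw [AlgInvolution.map_mul', map_mul, hx, hy, map_mul, AlgInvolution.map_mul']
  | ha x y hx hy => rw [map_add, map_add, hx, hy, map_add, map_add]
  | hc x y =>
    -- The model involution reverses `(x e_m)(e_m y)` and exchanges `w` and `w + 1`, which turns it
    -- into `(y e_m)(e_m x)`.
    rw [cliffInvolution_cliffPair, cliffEquiv_cliffPair, cliffEquiv_cliffPair,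
      Generators.evenHom_apply, Generators.evenHom_apply, map_smul, AlgInvolution.map_mul',
      Generators.involution_lin _ _ hu hv, Generators.involution_lin _ _ hu hv, hw, map_add,
      AlgInvolution.map_one', hw, add_assoc, add_self_eq_zero_of_charTwo F, add_zero]

end CliffEquiv

/-! ### The canonical semi-trace -/

section CentreEquiv

variable {F C K B : Type*} [Field F] [Ring C] [Algebra F C] [CommRing K] [Algebra F K] [Ring B]
  [Algebra F B] [Algebra K B] [IsScalarTower F K B] (Φ : C ≃ₐ[F] B)
  (hK : Function.Injective (algebraMap K B))
  (hB : ∀ t : B, (∀ y, Commute t y) → ∃ k : K, t = algebraMap K B k)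

-- `hB` says that the centre of `B` is contained in the image of `K`, and `hK` that `K` embeds; the
-- centre of `C` is carried along by `Φ`.
include hK hB in
theorem exists_centre_equiv :
    ∃ ψ : Subalgebra.center F C ≃ₐ[F] K,
      ∀ z : Subalgebra.center F C, Φ (z : C) = algebraMap K B (ψ z) := by
  let θ : K →ₐ[F] Subalgebra.center F C :=
    (Φ.symm.toAlgHom.comp (IsScalarTower.toAlgHom F K B)).codRestrict _ fun k =>
      Subalgebra.mem_center_iff.2 fun x => Φ.injective (by
        rw [map_mul, map_mul]
        exact (Φ.apply_symm_apply (algebraMap K B k)).symm ▸ (Algebra.commutes k (Φ x)).symm)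
  have hθ : ∀ k, Φ (θ k : C) = algebraMap K B k := fun k => Φ.apply_symm_apply _
  have hb : Function.Bijective θ := by
    refine ⟨fun k l h => hK ?_, fun z => ?_⟩
    · rw [← hθ, h, hθ]
    · obtain ⟨k, hk⟩ := hB (Φ z) fun y => by
        have h := congrArg Φ (Subalgebra.mem_center_iff.1 z.2 (Φ.symm y))
        rw [map_mul, map_mul, Φ.apply_symm_apply] at h
        exact h.symm
      refine ⟨k, Subtype.ext (Φ.injective ?_)⟩
      rw [hθ, hk]
  refine ⟨(AlgEquiv.ofBijective θ hb).symm, fun z => ?_⟩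
  rw [← hθ]
  exact congrArg (fun z : Subalgebra.center F C => Φ (z : C))
    ((AlgEquiv.ofBijective θ hb).apply_symm_apply z).symm

end CentreEquiv

/-! ### The reduced trace of the Clifford algebra and its canonical semi-trace. -/

section CanonicalSemitrace

variable {F V : Type u} [Field F] [AddCommGroup V] [Module F V]
  [FiniteDimensional F V] {q : QuadraticForm F V}
  {hq : LinearMap.BilinForm.Nondegenerate q.polarBilin}
  {K A : Type u} [CommRing K] [Algebra F K] [Ring A] [Algebra F A]
  {T : A →ₗ[F] F} (hT : IsReducedTrace F A T)
  (Φ : Cliff (adjInvolution q hq) (adjSemitrace q hq) ≃ₐ[F] K ⊗[F] A)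
  (ψ : cliffCentre (adjInvolution q hq) (adjSemitrace q hq) ≃ₐ[F] K)
  (hψ : ∀ z : cliffCentre (adjInvolution q hq) (adjSemitrace q hq),
    Φ (algebraMap _ _ z) = algebraMap K (K ⊗[F] A) (ψ z))

/-- The reduced trace of the Clifford algebra, transported from `K ⊗ A`. -/
def cliffTrace : Cliff (adjInvolution q hq) (adjSemitrace q hq)
    →ₗ[cliffCentre (adjInvolution q hq) (adjSemitrace q hq)]
      cliffCentre (adjInvolution q hq) (adjSemitrace q hq) where
  toFun x := ψ.symm (extendForm K T (Φ x))
  map_add' x y := by rw [map_add, map_add, map_add]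
  map_smul' z x := by
    apply ψ.injective
    rw [RingHom.id_apply, smul_eq_mul, map_mul, ψ.apply_symm_apply, ψ.apply_symm_apply,
      Algebra.smul_def, map_mul, hψ, ← Algebra.smul_def, map_smul, smul_eq_mul]

theorem apply_cliffTrace (x : Cliff (adjInvolution q hq) (adjSemitrace q hq)) :
    ψ (cliffTrace (T := T) Φ ψ hψ x) = extendForm K T (Φ x) :=
  ψ.apply_symm_apply _

include hT in
theorem isReducedTrace_cliffTrace : IsReducedTrace _ _ (cliffTrace (T := T) Φ ψ hψ) :=
  IsReducedTrace.of_ringEquiv Φ.toRingEquiv ψ.toRingEquiv hψ hT.extendForm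
    (apply_cliffTrace Φ ψ hψ)

variable [IsReduced K] [CharP F 2]

-- The endomorphism `φ_q(x ⊗ y)` has trace `b_q(y, x) = 1`, so it may serve as `λ`; the reduced
-- traces in the definition are the known ones by uniqueness. In particular the canonical semi-trace
-- is determined.
omit [CharP F 2] in
include hT hψ in
theorem IsCanonicalSemitrace.apply {f : (cliffInvolution (adjInvolution q hq)
      (adjSemitrace q hq)).sym →ₗ[F] cliffCentre (adjInvolution q hq) (adjSemitrace q hq)}
    (hf : IsCanonicalSemitrace (adjInvolution q hq) (adjSemitrace q hq) f)
    {x y : V} (hxy : QuadraticMap.polar q y x = 1)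
    (s : (cliffInvolution (adjInvolution q hq) (adjSemitrace q hq)).sym) :
    ψ (f s) = extendForm K T (Φ (cliffPair q hq x y) * Φ s) := by
  obtain ⟨T', hT', U, hU, h⟩ := hf
  have : IsReduced (cliffCentre (adjInvolution q hq) (adjSemitrace q hq)) :=
    isReduced_of_injective ψ ψ.injective
  obtain rfl := hT'.unique (isReducedTrace_end F V)
  obtain rfl := hU.unique (isReducedTrace_cliffTrace hT Φ ψ hψ)
  rw [h (phi q hq (x ⊗ₜ y)) (by rw [trace_phi, hxy]), apply_cliffTrace, map_mul]
  rfl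

include hT hψ in
theorem exists_isCanonicalSemitrace {σ : AlgInvolution F A}
    (hσ : ∀ x, Φ (cliffInvolution _ _ x) = σ.baseChange K (Φ x)) (hTσ : ∀ x, T (σ x) = T x)
    {ι : Type*} [Fintype ι] [DecidableEq ι] (hι : 3 ≤ Fintype.card ι) {a b : ι → F}
    {E : Module.Basis (ι ⊕ ι) F V} (hE : IsAdapted q a b E) :
    ∃ f, IsCanonicalSemitrace (adjInvolution q hq) (adjSemitrace q hq) f := by
  have : IsReduced (cliffCentre (adjInvolution q hq) (adjSemitrace q hq)) :=
    isReduced_of_injective ψ ψ.injective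
  have hU := isReducedTrace_cliffTrace hT Φ ψ hψ
  set U := cliffTrace (T := T) Φ ψ hψ 
  have hUσ : ∀ x, U (cliffInvolution _ _ x) = U x := fun x => ψ.injective (by
    rw [apply_cliffTrace, apply_cliffTrace, hσ, extendForm_baseChange hTσ])
  obtain ⟨i₀⟩ : Nonempty ι := Fintype.card_pos_iff.1 (by omega)
  let U' : Cliff (adjInvolution q hq) (adjSemitrace q hq) →ₗ[F]
      cliffCentre (adjInvolution q hq) (adjSemitrace q hq) :=
    { toFun := U
      map_add' := U.map_add
      map_smul' r x := ψ.injective (by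
        rw [apply_cliffTrace, RingHom.id_apply, map_smul, LinearMap.map_smul_of_tower, map_smul,
          apply_cliffTrace]) }
  refine ⟨U' ∘ₗ LinearMap.mulLeft F (cliffPair q hq (E (.inl i₀)) (E (.inr i₀))) ∘ₗ
    (cliffInvolution _ _).sym.subtype, _, isReducedTrace_end F V, U, hU, fun l hl s => ?_⟩
  -- For symmetric `s`, `U(σ(t) s) = U(σ(s t)) = U(s t) = U(t s)`, so `x ↦ U(x s)` kills all `t + σ
  -- t`. By `map_cliffMap_eq_trace_smul`, `U(c(λ) s)` then depends only on the trace of `λ`.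
  have hs : ∀ t, (U' ∘ₗ LinearMap.mulRight F (s : Cliff (adjInvolution q hq) (adjSemitrace q hq)))
      (t + cliffInvolution (adjInvolution q hq) (adjSemitrace q hq) t) = 0 := fun t => by
    change U ((t + _) * s) = 0
    have h := hUσ (s * t)
    rw [AlgInvolution.map_mul', AlgInvolution.mem_sym.1 s.2, hU.mul_comm s] at h
    rw [add_mul, map_add, h, add_self_eq_zero_of_charTwo F]
  have := map_cliffMap_eq_trace_smul hq hι hE _ hs i₀ l
  rw [hl, one_smul] at this
  exact this.symm

end CanonicalSemitrace

end QuadPair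

end

/-! ### The main theorem: both semi-traces are `s ↦ Trd(u₁ s)`. -/

theorem mainTheorem7 {F V : Type u} [Field F] [CharP F 2]
    [AddCommGroup V] [Module F V] [FiniteDimensional F V]
    (n : ℕ) (hn : 4 ≤ n + 1) (hm : Even (n + 1))
    (a b : Fin (n + 1) → F) (ha : ∀ i, a i ≠ 0)
    (q : QuadraticForm F V) (hq : LinearMap.BilinForm.Nondegenerate q.polarBilin)
    (hiso : QuadraticMap.Equivalent q (QuadPair.orthSum a b)) :
    (∃! f, QuadPair.IsCanonicalSemitrace
        (QuadPair.adjInvolution q hq) (QuadPair.adjSemitrace q hq) f) ∧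
    (∃! g, QuadPair.IsTensorSemitrace
        (fun i : Fin n => QuadPair.quatInvolution (a i.castSucc * b i.castSucc)
          (a i.castSucc * a (Fin.last n))) g) ∧
    ∀ f g,
      QuadPair.IsCanonicalSemitrace
        (QuadPair.adjInvolution q hq) (QuadPair.adjSemitrace q hq) f →
      QuadPair.IsTensorSemitrace
        (fun i : Fin n => QuadPair.quatInvolution (a i.castSucc * b i.castSucc)
          (a i.castSucc * a (Fin.last n))) g →
      QuadPair.QuadPairIso
        (QuadPair.cliffInvolution (QuadPair.adjInvolution q hq) (QuadPair.adjSemitrace q hq)) f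
        (QuadPair.AlgInvolution.baseChange (QuadPair.EtaleExt (∑ i, a i * b i))
          (QuadPair.AlgInvolution.piTensor
            (fun i : Fin n => QuadPair.quatInvolution (a i.castSucc * b i.castSucc)
              (a i.castSucc * a (Fin.last n)))))
        (QuadPair.extendScalars (QuadPair.EtaleExt (∑ i, a i * b i)) _ g) := by
  obtain ⟨E, hE⟩ := QuadPair.exists_isAdapted hiso
  let c : Fin n → F := fun i => a i.castSucc * b i.castSucc
  let d : Fin n → F := fun i => a i.castSucc * a (Fin.last n)
  let K := QuadPair.EtaleExt (∑ i, a i * b i)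
  have hd : ∀ i, d i ≠ 0 := fun i => mul_ne_zero (ha _) (ha _)
  have hT := QuadPair.isReducedTrace_quatTensorTrace (c := c) hd
  let Φ : QuadPair.Cliff (QuadPair.adjInvolution q hq) (QuadPair.adjSemitrace q hq) ≃ₐ[F]
    K ⊗[F] QuadPair.QuatTensor c d := QuadPair.cliffEquiv hq hE ha
  have hσ : ∀ x, Φ (QuadPair.cliffInvolution _ _ x) =
      (QuadPair.quatTensorInvolution c d).baseChange K (Φ x) :=
    QuadPair.cliffEquiv_involution hq hE ha hm
  have : Nontrivial (QuadPair.QuatTensor c d) :=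
    Module.nontrivial_of_finrank_pos (R := F) (by
      rw [QuadPair.finrank_quatTensor]
      exact Nat.mul_pos Fintype.card_pos Fintype.card_pos)
  have : FiniteDimensional F K := Module.Finite.of_basis (QuadPair.etaleBasis _)
  obtain ⟨ψ, hψ⟩ := QuadPair.exists_centre_equiv Φ
    (Algebra.TensorProduct.includeLeft_injective (S := F)
      (algebraMap F (QuadPair.QuatTensor c d)).injective) fun t ht => hT.mem_center_tensor ht
  -- Two distinct quaternion factors: `i₀` supplies the element `u`, and `j₀` makes `Trd(u s)`
  -- vanish on tensors of symmetric elements.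
  let i₀ : Fin n := ⟨0, by omega⟩
  let j₀ : Fin n := ⟨1, by omega⟩
  have hij : j₀ ≠ i₀ := by simp [i₀, j₀]
  have hxy : QuadraticMap.polar q (E (.inr i₀.castSucc)) (E (.inl i₀.castSucc)) = 1 :=
    (hE.polar_inr_inl _ _).trans (if_pos rfl)
  -- The comparison of the semi-traces hinges on this: the same element is `c(λ)` with `λ` of trace
  -- one on one side and the quaternion generator `u` on the other.
  have hu : Φ (QuadPair.cliffPair q hq (E (.inl i₀.castSucc)) (E (.inr i₀.castSucc))) =
      1 ⊗ₜ QuadPair.quatSlot c d i₀ (QuadPair.quatU (c i₀) (d i₀)) :=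
    (QuadPair.cliffEquiv_cliffPair hq hE ha _ _).trans
      (QuadPair.Generators.evenHom_inl_inr hE ha _ _)
  obtain ⟨f₀, hf₀⟩ := QuadPair.exists_isCanonicalSemitrace hT Φ ψ hψ hσ
    (QuadPair.quatTensorTrace_involution c d) (by simp; omega) hE
  have hg₀ := QuadPair.isTensorSemitrace_mul (c := c) hd hij
  refine ⟨⟨f₀, hf₀, fun f hf => ?_⟩, ⟨_, hg₀, fun g hg => QuadPair.IsTensorSemitrace.unique hg hg₀⟩,
    fun f g hf hg => ⟨Φ, ψ, hψ, hσ, fun s t hst => ?_⟩⟩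
  · ext1 s
    apply ψ.injective
    rw [hf.apply hT Φ ψ hψ hxy, hf₀.apply hT Φ ψ hψ hxy]
  · obtain rfl := QuadPair.IsTensorSemitrace.unique hg hg₀
    rw [hf.apply hT Φ ψ hψ hxy, hst, hu]
    -- It remains to see that `t ↦ Trd((1 ⊗ u) t)` extends the tensor semi-trace to `K`, which is
    -- checked on tensors `k ⊗ r` with `r` symmetric.
    refine (QuadPair.extendScalars_apply _ _
      ((QuadPair.extendForm K (QuadPair.quatTensorTrace c d)).restrictScalars F ∘ₗ
        LinearMap.mulLeft F (1 ⊗ₜ QuadPair.quatSlot c d i₀ (QuadPair.quatU (c i₀) (d i₀))))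
      (fun k r => ?_) t).symm
    refine (congrArg (QuadPair.extendForm K (QuadPair.quatTensorTrace c d))
      (Algebra.TensorProduct.tmul_mul_tmul _ _ _ _)).trans ?_
    rw [one_mul, QuadPair.extendForm_tmul]
    rfl
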